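/- Let $\phi:\mathbb{R}^d\to\mathbb{R}$ be convex and twice differentiable with $\widehat L$-Lipschitz Hessian, i.e. $\|\nabla^2\phi(y)-\nabla^2\phi(z)\|_2\le \widehat L\|y-z\|$ for all $y,z$, and let $f:\mathbb{R}^d\to\mathbb{R}$ satisfy $|f(y)-\phi(y)|\le\sigma$ for all $y$. Let $x\in\mathbb{R}^d$, $\alpha>0$, $0<\varepsilon<1$, $0<\delta<1$, let $S\in\mathbb{R}^{d\times\ell}$ be a random matrix with columns $s_1,\dots,s_\ell$, and put $$\tau(x,S)=\sum_{i=1}^{\ell}\frac{f(x+\alpha s_i)+f(x-\alpha s_i)-2f(x)}{\alpha^2}.$$ Suppose that one of the following holds, where in (1) and (2) it is also assumed that $\operatorname{tr}\nabla^2\phi(x)>0$, and $\log$ is the natural logarithm: 1. $S$ is a Gaussian sketching matrix (i.i.d. entries with law $N(0,1/\ell)$) and $\ell\ge 8\varepsilon^{-2}\frac{\|\nabla^2\phi(x)\|_2}{\operatorname{tr}\nabla^2\phi(x)}\log\frac2\delta$; 2. $S$ is a Rademacher sketching matrix (i.i.d. entries uniform on $\{\pm1/\sqrt\ell\}$) and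 $\ell\ge 8\varepsilon^{-2}(1+\varepsilon)\frac{\|\nabla^2\phi(x)\|_2}{\operatorname{tr}\nabla^2\phi(x)}\log\frac2\delta$; 3. $d$ is a power of two, $S$ is an SRHT matrix, i.e. $S^\top=\frac1{\sqrt\ell}PH_dD$ with $H_d$ the $\pm1$ Walsh–Hadamard matrix, $D$ a diagonal matrix of independent uniform random signs, and $P\in\mathbb{R}^{\ell\times d}$ a matrix whose rows are standard basis vectors chosen independently and uniformly, independent of $D$; and $\ell\ge\Big(1+\sqrt{8\log\frac{2d}{\delta}}\Big)^2\varepsilon^{-2}\log\frac2\delta$. Then $$\big|\tau(x,S)-\operatorname{tr}\nabla^2\phi(x)\big|\le\varepsilon\operatorname{tr}\nabla^2\phi(x)+\frac{\widehat L\sum_{i=1}^{\ell}\|s_i\|^3}{3}\,\alpha+\frac{4\ell\sigma}{\alpha^2}$$ holds with probability at least $1-\delta$. Moreover, in case (1), with probability at least $1-\delta$ this inequality holds together with $$\sum_{i=1}^{\ell}\|s_i\|^3\le\Big(2d+\log\frac{\ell}{\delta}\Big)^{3/2}\ell^{-1/2},$$ and in cases (2) and (3), almost surely, $$\sum_{i=1}^{\ell}\|s_i\|^3\le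 d^{3/2}\ell^{-1/2}.$$ -/

import Mathlib

open MeasureTheory ProbabilityTheory
open scoped Gradient Kronecker

noncomputable section

/-- The Hessian of `φ` at `x`, as a continuous linear map on `ℝ^d`; its norm is the spectral
norm. -/
def hessian {d : ℕ} (φ : EuclideanSpace ℝ (Fin d) → ℝ) (x : EuclideanSpace ℝ (Fin d)) :
    EuclideanSpace ℝ (Fin d) →L[ℝ] EuclideanSpace ℝ (Fin d) :=
  fderiv ℝ (∇ φ) x

/-- The trace of the Hessian of `φ` at `x`. -/
def hessianTrace {d : ℕ} (φ : EuclideanSpace ℝ (Fin d) → ℝ) (x : EuclideanSpace ℝ (Fin d)) : ℝ :=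
  LinearMap.trace ℝ (EuclideanSpace ℝ (Fin d))
    (hessian φ x : EuclideanSpace ℝ (Fin d) →ₗ[ℝ] EuclideanSpace ℝ (Fin d))

/-- The `i`-th column of a `d × ℓ` matrix, as a vector with the Euclidean norm. -/
def sketchCol {d ℓ : ℕ} (S : Matrix (Fin d) (Fin ℓ) ℝ) (i : Fin ℓ) : EuclideanSpace ℝ (Fin d) :=
  WithLp.toLp 2 (fun j => S j i)

/-- The zeroth-order trace estimator `τ(x, S)` with smoothing parameter `α`. -/
def traceEstimator {d ℓ : ℕ} (f : EuclideanSpace ℝ (Fin d) → ℝ) (α : ℝ)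
    (x : EuclideanSpace ℝ (Fin d)) (S : Matrix (Fin d) (Fin ℓ) ℝ) : ℝ :=
  ∑ i, (f (x + α • sketchCol S i) + f (x - α • sketchCol S i) - 2 * f x) / α ^ 2

/-- The sum of the cubes of the Euclidean norms of the columns of `S`. -/
def sumCubeNorms {d ℓ : ℕ} (S : Matrix (Fin d) (Fin ℓ) ℝ) : ℝ :=
  ∑ i, ‖sketchCol S i‖ ^ 3

/-- The uniform distribution on `{+1, -1}`. -/
def rademacher : Measure ℝ :=
  (2⁻¹ : ENNReal) • Measure.dirac 1 + (2⁻¹ : ENNReal) • Measure.dirac (-1)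

/-- Gaussian sketching matrix: i.i.d. entries with law `N(0, 1/ℓ)`. -/
structure IsGaussianSketch {Ω : Type*} [MeasurableSpace Ω] (P : Measure Ω) {d ℓ : ℕ}
    (S : Ω → Matrix (Fin d) (Fin ℓ) ℝ) : Prop where
  indep : iIndepFun (fun (p : Fin d × Fin ℓ) (ω : Ω) => S ω p.1 p.2) P
  law : ∀ (j : Fin d) (i : Fin ℓ),
    HasLaw (fun ω => S ω j i) (gaussianReal 0 (1 / (ℓ : NNReal))) P

/-- Rademacher sketching matrix: i.i.d. entries, uniform on `{+1, -1}` and scaled by `1/√ℓ`. -/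
structure IsRademacherSketch {Ω : Type*} [MeasurableSpace Ω] (P : Measure Ω) {d ℓ : ℕ}
    (S : Ω → Matrix (Fin d) (Fin ℓ) ℝ) : Prop where
  indep : iIndepFun (fun (p : Fin d × Fin ℓ) (ω : Ω) => S ω p.1 p.2) P
  law : ∀ (j : Fin d) (i : Fin ℓ),
    HasLaw (fun ω => S ω j i) (rademacher.map (fun r => r / √(ℓ : ℝ))) P

/-- The Walsh-Hadamard matrix of order `2 ^ m`: the `m`-fold Kronecker power of
`!![1, 1; 1, -1]`. -/
def walshHadamard : (m : ℕ) → Matrix (Fin (2 ^ m)) (Fin (2 ^ m)) ℝ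
  | 0 => 1
  | m + 1 => Matrix.reindex finProdFinEquiv finProdFinEquiv
      (walshHadamard m ⊗ₖ (!![1, 1; 1, -1] : Matrix (Fin 2) (Fin 2) ℝ))

/-- The `ℓ × d` sampling matrix whose `i`-th row is the standard basis vector `e_{k i}`. -/
def samplingMatrix {d ℓ : ℕ} (k : Fin ℓ → Fin d) : Matrix (Fin ℓ) (Fin d) ℝ :=
  Matrix.of fun i j => if k i = j then 1 else 0

/-- SRHT sketching matrix: `d` is a power of two and `Sᵀ = (1/√ℓ) P H D`, where `H` is the
Walsh-Hadamard matrix of order `d`, `D` is diagonal with independent uniform signs `s`, and `P`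
samples `ℓ` row indices `k` independently and uniformly, independently of `D`. -/
def IsSRHTSketch {Ω : Type*} [MeasurableSpace Ω] (P : Measure Ω) {d ℓ : ℕ}
    (S : Ω → Matrix (Fin d) (Fin ℓ) ℝ) : Prop :=
  ∃ (m : ℕ) (hm : 2 ^ m = d) (s : Fin d → Ω → ℝ) (k : Fin ℓ → Ω → Fin d),
    (∀ j, HasLaw (s j) rademacher P) ∧ iIndepFun s P ∧
    (∀ i, HasLaw (k i) (uniformOn Set.univ) P) ∧ iIndepFun k P ∧
    IndepFun (fun ω j => s j ω) (fun ω i => k i ω) P ∧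
    ∀ ω, (S ω).transpose = (1 / √(ℓ : ℝ)) •
      (samplingMatrix (fun i => k i ω) *
        Matrix.reindex (finCongr hm) (finCongr hm) (walshHadamard m) *
        Matrix.diagonal (fun j => s j ω))

end

/-! ### Second-order Taylor expansion; the Hessian as a positive semidefinite matrix -/

section HessianCalculus

variable {d : ℕ}

/-! Along a column `s`, the second difference of `φ` is `α² ⟨H s, s⟩` with `H = ∇²φ(x)`, up to
`L‖s‖³α³/3`, and the noise adds at most `4σ`. Dividing by `α²` and summing yields the two
deterministic error terms (`abs_traceEstimator_sub_le`). It remains to show that `∑ ⟨H sᵢ, sᵢ⟩` is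
within `ε tr H` of `tr H`. Collect the entries of `√ℓ S` in one vector `z` and put `B = H ⊗ 1`: the
claim becomes `|zᵀBz - tr B| ≤ ε tr B`, where `tr B = ℓ tr H` and `B` has the same spectral bound `a
= ‖H‖` as `H` (`le_abs_centeredForm_of_not_le`). Convexity enters only through positive
semidefiniteness of `H`.

Rademacher: flipping one sign preserves the law. Symmetrising the derivative of the moment
generating function under each flip bounds it by the squared single-coordinate increments, whose sum
is controlled by `‖Br‖² ≤ a rᵀBr`. The right side is again expressed by the generating function and
its derivative, so a differential inequality gives `mgf_centeredForm_le`, and Chernoff's bound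
finishes.

SRHT: given the signs, the columns are i.i.d. uniform rows of a randomised Hadamard matrix.
Orthogonality makes the centred row forms average to zero, and each single row is itself a vector of
independent signs, so the Rademacher estimates apply to it, with `a` replaced by the trace
(`norm_hessian_le_hessianTrace`). For `δ ≥ 1/32` Chebyshev suffices (`srht_chebyshev`); for smaller
`δ` a union bound caps all row forms and Bernstein's inequality handles the sampling
(`srht_chernoff`).

Gaussian: rotation invariance reduces `zᵀBz` to a chi-square sum weighted by eigenvalues
(`exists_map_centeredForm_eq`). The trace bound and the column bound must share one `δ = 2e⁻ʳ`, `r =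
log (2/δ)`. The trace event fails with probability at most `e^(-1.22r) + e^(-2r)`, and also at most
`1/(4r)`, which leaves room. Since `tr B ≤ dℓ‖H‖` and `ε < 1`, the hypothesis forces `dℓ ≥ 8r`, and
this makes the column event likely enough. `add_colSq_tail_le` balances the two over ranges of `r`.

For signs and SRHT every entry of `S` has square `1/ℓ`, so the sum of cubes is deterministic. -/

theorem hessian_hasFDerivAt {φ : EuclideanSpace ℝ (Fin d) → ℝ} (hdiff₂ : Differentiable ℝ (∇ φ))
    (y : EuclideanSpace ℝ (Fin d)) : HasFDerivAt (∇ φ) (hessian φ y) y :=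
  (hdiff₂ y).hasFDerivAt

theorem hessian_symmetric {φ : EuclideanSpace ℝ (Fin d) → ℝ} (hdiff : Differentiable ℝ φ)
    (hdiff₂ : Differentiable ℝ (∇ φ)) (x v w : EuclideanSpace ℝ (Fin d)) :
    inner ℝ (hessian φ x v) w = inner ℝ (hessian φ x w) v := by
  have hf : ∀ y, HasFDerivAt φ (InnerProductSpace.toDual ℝ _ (∇ φ y)) y := fun y =>
    (hdiff y).hasGradientAt.hasFDerivAt
  have hx := ((InnerProductSpace.toDual ℝ (EuclideanSpace ℝ (Fin d))).toContinuousLinearEquiv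
    |>.toContinuousLinearMap.hasFDerivAt).comp x (hessian_hasFDerivAt hdiff₂ x)
  exact second_derivative_symmetric hf hx v w

theorem hasDerivAt_comp_line {φ : EuclideanSpace ℝ (Fin d) → ℝ} (hdiff : Differentiable ℝ φ)
    (x v : EuclideanSpace ℝ (Fin d)) (t : ℝ) :
    HasDerivAt (fun t : ℝ => φ (x + t • v)) (inner ℝ (∇ φ (x + t • v)) v) t := by
  have h1 : HasDerivAt (fun t : ℝ => x + t • v) v t := by
    simpa using ((hasDerivAt_id t).smul_const v).const_add x
  have h2 := (hdiff (x + t • v)).hasGradientAt.hasFDerivAt.comp_hasDerivAt t h1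
  rwa [InnerProductSpace.toDual_apply_apply] at h2

theorem hasDerivAt_gradient_line {φ : EuclideanSpace ℝ (Fin d) → ℝ}
    (hdiff₂ : Differentiable ℝ (∇ φ)) (x v : EuclideanSpace ℝ (Fin d)) (t : ℝ) :
    HasDerivAt (fun t : ℝ => inner ℝ (∇ φ (x + t • v)) v)
      (inner ℝ (hessian φ (x + t • v) v) v) t := by
  have h1 : HasDerivAt (fun t : ℝ => x + t • v) v t := by
    simpa using ((hasDerivAt_id t).smul_const v).const_add x
  have h2 := (hessian_hasFDerivAt hdiff₂ (x + t • v)).comp_hasDerivAt t h1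
  simpa using h2.inner ℝ (hasDerivAt_const t v)

theorem abs_inner_hessian_sub_le {φ : EuclideanSpace ℝ (Fin d) → ℝ} {L : ℝ}
    (hLip : ∀ y z, ‖hessian φ y - hessian φ z‖ ≤ L * ‖y - z‖)
    (x v : EuclideanSpace ℝ (Fin d)) (t : ℝ) :
    |inner ℝ (hessian φ (x + t • v) v) v - inner ℝ (hessian φ x v) v| ≤
      L * (|t| * ‖v‖) * ‖v‖ ^ 2 := by
  rw [← inner_sub_left, ← sub_apply]
  calc _ ≤ ‖(hessian φ (x + t • v) - hessian φ x) v‖ * ‖v‖ := abs_real_inner_le_norm _ _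
    _ ≤ (‖hessian φ (x + t • v) - hessian φ x‖ * ‖v‖) * ‖v‖ := by
        gcongr; exact ContinuousLinearMap.le_opNorm _ _
    _ ≤ (L * ‖(x + t • v) - x‖ * ‖v‖) * ‖v‖ := by
        gcongr; exact hLip _ _
    _ = _ := by rw [add_sub_cancel_left, norm_smul, Real.norm_eq_abs]; ring

/-- Two applications of the mean value inequality to the symmetric remainder: the Lipschitz bound at
`± s v` gives second derivative at most `2L‖v‖³s`, hence first derivative at most `L‖v‖³s²`, hence
the cubic bound. Only differentiability of the gradient is needed, no integrals of the Hessian. -/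
theorem abs_second_difference_sub_le {φ : EuclideanSpace ℝ (Fin d) → ℝ} {L : ℝ}
    (hdiff : Differentiable ℝ φ) (hdiff₂ : Differentiable ℝ (∇ φ))
    (hLip : ∀ y z, ‖hessian φ y - hessian φ z‖ ≤ L * ‖y - z‖)
    (x v : EuclideanSpace ℝ (Fin d)) {t : ℝ} (ht : 0 ≤ t) :
    |φ (x + t • v) + φ (x - t • v) - 2 * φ x - t ^ 2 * inner ℝ (hessian φ x v) v| ≤
      L * ‖v‖ ^ 3 * t ^ 3 / 3 := by
  set c := inner ℝ (hessian φ x v) v with hc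
  have hneg : ∀ s : ℝ, x - s • v = x + s • (-v) := fun s => by rw [smul_neg, sub_eq_add_neg]
  have hk : ∀ s ∈ Set.Icc (0 : ℝ) t, ‖inner ℝ (∇ φ (x + s • v)) v +
      inner ℝ (∇ φ (x + s • (-v))) (-v) - 2 * s * c‖ ≤ L * ‖v‖ ^ 3 * s ^ 2 := by
    have hder : ∀ s : ℝ, HasDerivAt (fun s : ℝ => inner ℝ (∇ φ (x + s • v)) v +
      inner ℝ (∇ φ (x + s • (-v))) (-v) - 2 * s * c)
      (inner ℝ (hessian φ (x + s • v) v) v + inner ℝ (hessian φ (x + s • (-v)) (-v)) (-v) - 2 * c)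
      s := fun s => by
      have h3 : HasDerivAt (fun s : ℝ => 2 * s * c) (2 * c) s := by
        simpa using ((hasDerivAt_id s).const_mul 2).mul_const c
      exact ((hasDerivAt_gradient_line hdiff₂ x v s).add
        (hasDerivAt_gradient_line hdiff₂ x (-v) s)).sub h3
    refine image_norm_le_of_norm_deriv_right_le_deriv_boundary
      (fun s _ => (hder s).continuousAt.continuousWithinAt)
      (fun s _ => (hder s).hasDerivWithinAt) (B' := fun s => L * ‖v‖ ^ 3 * (2 * s)) (by simp)
      (fun s => by simpa using (hasDerivAt_pow 2 s).const_mul (L * ‖v‖ ^ 3)) ?_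
    intro s hs
    have h1 := abs_inner_hessian_sub_le hLip x v s
    have h2 := abs_inner_hessian_sub_le hLip x (-v) s
    have h3 : inner ℝ (hessian φ x (-v)) (-v) = c := by simp [hc]
    rw [h3, norm_neg, abs_of_nonneg hs.1] at h2
    rw [abs_of_nonneg hs.1] at h1
    rw [Real.norm_eq_abs]
    calc _ = |(inner ℝ (hessian φ (x + s • v) v) v - c) +
        (inner ℝ (hessian φ (x + s • (-v)) (-v)) (-v) - c)| := by ring_nf
      _ ≤ _ := abs_add_le _ _
      _ ≤ L * (s * ‖v‖) * ‖v‖ ^ 2 + L * (s * ‖v‖) * ‖v‖ ^ 2 := add_le_add h1 h2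
      _ = _ := by ring
  have hder : ∀ s : ℝ, HasDerivAt
      (fun s : ℝ => φ (x + s • v) + φ (x + s • (-v)) - 2 * φ x - s ^ 2 * c)
      (inner ℝ (∇ φ (x + s • v)) v + inner ℝ (∇ φ (x + s • (-v))) (-v) - 2 * s * c) s := fun s => by
    have h3 : HasDerivAt (fun s : ℝ => s ^ 2 * c) (2 * s * c) s := by
      simpa using (hasDerivAt_pow 2 s).mul_const c
    exact (((hasDerivAt_comp_line hdiff x v s).add
      (hasDerivAt_comp_line hdiff x (-v) s)).sub_const _).sub h3
  have := image_norm_le_of_norm_deriv_right_le_deriv_boundary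
      (fun s _ => (hder s).continuousAt.continuousWithinAt)
      (fun s _ => (hder s).hasDerivWithinAt) (a := 0) (b := t)
      (B := fun s => L * ‖v‖ ^ 3 * s ^ 3 / 3)
      (B' := fun s => L * ‖v‖ ^ 3 * s ^ 2) (by simp; ring)
      (fun s => by
        have := ((hasDerivAt_pow 3 s).const_mul (L * ‖v‖ ^ 3)).div_const 3
        exact this.congr_deriv (by norm_num; ring)) (fun s hs => hk s ⟨hs.1, hs.2.le⟩)
      (Set.right_mem_Icc.2 ht)
  rw [hneg t, ← Real.norm_eq_abs]
  exact this

/-- Second differences of a convex function are nonnegative; divide the Taylor bound by `t²` and let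
`t → 0⁺`. -/
theorem inner_hessian_self_nonneg {φ : EuclideanSpace ℝ (Fin d) → ℝ} {L : ℝ}
    (hconv : ConvexOn ℝ Set.univ φ) (hdiff : Differentiable ℝ φ)
    (hdiff₂ : Differentiable ℝ (∇ φ))
    (hLip : ∀ y z, ‖hessian φ y - hessian φ z‖ ≤ L * ‖y - z‖)
    (x v : EuclideanSpace ℝ (Fin d)) : 0 ≤ inner ℝ (hessian φ x v) v := by
  have key : ∀ t : ℝ, 0 < t → -(L * ‖v‖ ^ 3 / 3 * t) ≤ inner ℝ (hessian φ x v) v := by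
    intro t ht
    have h1 := abs_second_difference_sub_le hdiff hdiff₂ hLip x v ht.le
    have h2 : 2 * φ x ≤ φ (x + t • v) + φ (x - t • v) := by
      have := hconv.2 (Set.mem_univ (x + t • v)) (Set.mem_univ (x - t • v))
        (show (0 : ℝ) ≤ 1 / 2 by norm_num) (show (0 : ℝ) ≤ 1 / 2 by norm_num) (by norm_num)
      rw [← smul_add, show x + t • v + (x - t • v) = (2 : ℝ) • x by rw [two_smul]; abel,
        smul_smul] at this
      norm_num at this
      linarith
    have h3 := (abs_le.1 h1).2
    have h4 : t ^ 2 * -(L * ‖v‖ ^ 3 / 3 * t) ≤ t ^ 2 * inner ℝ (hessian φ x v) v := by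
      nlinarith
    exact le_of_mul_le_mul_left h4 (by positivity)
  have hlim : Filter.Tendsto (fun t : ℝ => -(L * ‖v‖ ^ 3 / 3 * t)) (nhdsWithin 0 (Set.Ioi 0))
      (nhds 0) := by
    have : Continuous fun t : ℝ => -(L * ‖v‖ ^ 3 / 3 * t) := by fun_prop
    simpa using (this.tendsto 0).mono_left nhdsWithin_le_nhds
  exact le_of_tendsto hlim (Filter.eventually_of_mem self_mem_nhdsWithin fun t ht => key t ht)

/-- Cauchy–Schwarz for the semidefinite form `⟨H v, w⟩` at `w = H v`, through the discriminant of
the form along `t v + H v`, followed by cancelling `‖H v‖²`. -/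
theorem norm_apply_sq_le_of_inner_nonneg {E : Type*} [NormedAddCommGroup E]
    [InnerProductSpace ℝ E] (H : E →L[ℝ] E) (hsymm : ∀ v w, inner ℝ (H v) w = inner ℝ (H w) v)
    (hpos : ∀ v, 0 ≤ inner ℝ (H v) v) (v : E) : ‖H v‖ ^ 2 ≤ ‖H‖ * inner ℝ (H v) v := by
  have h1 : inner ℝ (H v) (H v) ^ 2 ≤ inner ℝ (H v) v * inner ℝ (H (H v)) (H v) := by
    have hq : ∀ t : ℝ, 0 ≤ inner ℝ (H v) v * (t * t) + (2 * inner ℝ (H v) (H v)) * t +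
        inner ℝ (H (H v)) (H v) := fun t => by
      have := hpos (t • v + H v)
      simp only [map_add, map_smul, inner_add_left, inner_add_right, inner_smul_left,
        inner_smul_right, hsymm (H v) v] at this
      simp at this ⊢
      linarith
    have := discrim_le_zero hq
    rw [discrim] at this
    nlinarith
  have h2 : inner ℝ (H (H v)) (H v) ≤ ‖H‖ * ‖H v‖ ^ 2 := by
    calc _ ≤ ‖H (H v)‖ * ‖H v‖ := real_inner_le_norm _ _
      _ ≤ (‖H‖ * ‖H v‖) * ‖H v‖ := by gcongr; exact H.le_opNorm _
      _ = _ := by ring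
  rw [real_inner_self_eq_norm_sq] at h1
  rcases (norm_nonneg (H v)).eq_or_lt with h0 | h0
  · rw [← h0]; have := mul_nonneg (norm_nonneg H) (hpos v); simpa using this
  · have h3 : ‖H v‖ ^ 2 * ‖H v‖ ^ 2 ≤ ‖H v‖ ^ 2 * (‖H‖ * inner ℝ (H v) v) := by
      nlinarith [hpos v, mul_le_mul_of_nonneg_left h2 (hpos v)]
    exact le_of_mul_le_mul_left h3 (by positivity)

theorem abs_traceEstimator_sub_le {ℓ : ℕ} {φ f : EuclideanSpace ℝ (Fin d) → ℝ} {L σ α : ℝ}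
    (hdiff : Differentiable ℝ φ) (hdiff₂ : Differentiable ℝ (∇ φ))
    (hnoise : ∀ y, |f y - φ y| ≤ σ)
    (hLip : ∀ y z, ‖hessian φ y - hessian φ z‖ ≤ L * ‖y - z‖) (hα : 0 < α)
    (x : EuclideanSpace ℝ (Fin d)) (S : Matrix (Fin d) (Fin ℓ) ℝ) :
    |traceEstimator f α x S - ∑ i, inner ℝ (hessian φ x (sketchCol S i)) (sketchCol S i)| ≤
      L * sumCubeNorms S / 3 * α + 4 * ℓ * σ / α ^ 2 := by
  rw [traceEstimator, ← Finset.sum_sub_distrib]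
  have hterm : ∀ i, |(f (x + α • sketchCol S i) + f (x - α • sketchCol S i) - 2 * f x) / α ^ 2 -
      inner ℝ (hessian φ x (sketchCol S i)) (sketchCol S i)| ≤
      L * ‖sketchCol S i‖ ^ 3 / 3 * α + 4 * σ / α ^ 2 := by
    intro i
    set s := sketchCol S i
    have h := abs_le.1 (abs_second_difference_sub_le hdiff hdiff₂ hLip x s hα.le)
    have h1 := abs_le.1 (hnoise (x + α • s))
    have h2 := abs_le.1 (hnoise (x - α • s))
    have h3 := abs_le.1 (hnoise x)
    have h4 : |f (x + α • s) + f (x - α • s) - 2 * f x - α ^ 2 * inner ℝ (hessian φ x s) s| ≤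
        L * ‖s‖ ^ 3 * α ^ 3 / 3 + 4 * σ := by
      rw [abs_le]; constructor <;> linarith [h.1, h.2, h1.1, h1.2, h2.1, h2.2, h3.1, h3.2]
    have hα2 : 0 < α ^ 2 := by positivity
    have e : (f (x + α • s) + f (x - α • s) - 2 * f x) / α ^ 2 - inner ℝ (hessian φ x s) s =
        (f (x + α • s) + f (x - α • s) - 2 * f x - α ^ 2 * inner ℝ (hessian φ x s) s) / α ^ 2 := by
      field_simp
    rw [e, abs_div, abs_of_pos hα2, div_le_iff₀ hα2]
    refine h4.trans (le_of_eq ?_)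
    field_simp
  refine (Finset.abs_sum_le_sum_abs _ _).trans ((Finset.sum_le_sum fun i _ => hterm i).trans
    (le_of_eq ?_))
  rw [Finset.sum_add_distrib, sumCubeNorms, Finset.mul_sum, Finset.sum_div, Finset.sum_mul]
  simp
  ring


/-- `A` is symmetric and satisfies `‖A v‖² ≤ a ⟨v, A v⟩`; for `a > 0` this says that `A` is positive
semidefinite with spectral norm at most `a`. -/
structure Matrix.SpectralBound {ι : Type*} [Fintype ι] (A : Matrix ι ι ℝ) (a : ℝ) : Prop where
  symm : ∀ j k, A j k = A k j
  sq_le : ∀ v : ι → ℝ, (A.mulVec v) ⬝ᵥ (A.mulVec v) ≤ a * (v ⬝ᵥ A.mulVec v)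

/-- The matrix of the Hessian in the standard basis. -/
noncomputable def hessianMatrix (φ : EuclideanSpace ℝ (Fin d) → ℝ) (x : EuclideanSpace ℝ (Fin d)) :
    Matrix (Fin d) (Fin d) ℝ :=
  LinearMap.toMatrix (EuclideanSpace.basisFun (Fin d) ℝ).toBasis
    (EuclideanSpace.basisFun (Fin d) ℝ).toBasis (hessian φ x).toLinearMap

theorem trace_hessianMatrix (φ : EuclideanSpace ℝ (Fin d) → ℝ) (x : EuclideanSpace ℝ (Fin d)) :
    (hessianMatrix φ x).trace = hessianTrace φ x := by
  rw [hessianTrace, hessianMatrix, ← LinearMap.trace_eq_matrix_trace]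

theorem hessianMatrix_mulVec (φ : EuclideanSpace ℝ (Fin d) → ℝ) (x v : EuclideanSpace ℝ (Fin d)) :
    (hessianMatrix φ x).mulVec v.ofLp = (hessian φ x v).ofLp := by
  have := LinearMap.toMatrix_mulVec_repr (EuclideanSpace.basisFun (Fin d) ℝ).toBasis
    (EuclideanSpace.basisFun (Fin d) ℝ).toBasis (hessian φ x).toLinearMap v
  ext i
  have e : ⇑((EuclideanSpace.basisFun (Fin d) ℝ).toBasis.repr v) = v.ofLp := by ext; simp
  rw [e] at this
  rw [hessianMatrix]
  simpa using congrFun this i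

theorem inner_hessian_eq_dotProduct (φ : EuclideanSpace ℝ (Fin d) → ℝ)
    (x v w : EuclideanSpace ℝ (Fin d)) :
    inner ℝ (hessian φ x v) w = w.ofLp ⬝ᵥ (hessianMatrix φ x).mulVec v.ofLp := by
  rw [hessianMatrix_mulVec, EuclideanSpace.inner_eq_star_dotProduct]
  simp

theorem hessianMatrix_spectralBound {φ : EuclideanSpace ℝ (Fin d) → ℝ} {L : ℝ}
    (hconv : ConvexOn ℝ Set.univ φ) (hdiff : Differentiable ℝ φ)
    (hdiff₂ : Differentiable ℝ (∇ φ))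
    (hLip : ∀ y z, ‖hessian φ y - hessian φ z‖ ≤ L * ‖y - z‖) (x : EuclideanSpace ℝ (Fin d)) :
    (hessianMatrix φ x).SpectralBound ‖hessian φ x‖ where
  symm j k := by
    have h := hessian_symmetric hdiff hdiff₂ x (EuclideanSpace.single j 1)
      (EuclideanSpace.single k 1)
    rw [inner_hessian_eq_dotProduct, inner_hessian_eq_dotProduct] at h
    simpa using h.symm
  sq_le v := by
    have h := norm_apply_sq_le_of_inner_nonneg (hessian φ x) (hessian_symmetric hdiff hdiff₂ x)
      (inner_hessian_self_nonneg hconv hdiff hdiff₂ hLip x) (WithLp.toLp 2 v)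
    rw [inner_hessian_eq_dotProduct, ← real_inner_self_eq_norm_sq, inner_hessian_eq_dotProduct,
      ← hessianMatrix_mulVec] at h
    exact h

end HessianCalculus

/-! ### Consequences of the spectral bound -/

namespace Matrix.SpectralBound

variable {ι : Type*} [Fintype ι] {A : Matrix ι ι ℝ} {a : ℝ}

theorem diag_sq_le (h : A.SpectralBound a) (j : ι) : A j j ^ 2 ≤ a * A j j := by
  classical
  have h1 := h.sq_le (Pi.single j 1)
  have h2 : A j j ^ 2 ≤ ∑ k, A k j * A k j := by
    rw [sq]
    exact Finset.single_le_sum (f := fun k => A k j * A k j) (fun k _ => mul_self_nonneg _)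
      (Finset.mem_univ j)
  simp [dotProduct, Pi.single_apply] at h1
  linarith

theorem diag_nonneg (h : A.SpectralBound a) (ha : 0 < a) (j : ι) : 0 ≤ A j j := by
  have := h.diag_sq_le j
  by_contra hn
  nlinarith [sq_nonneg (A j j)]

theorem diag_le (h : A.SpectralBound a) (ha : 0 < a) (j : ι) : A j j ≤ a := by
  have := h.diag_sq_le j
  by_contra hn
  nlinarith

theorem quadratic_nonneg (h : A.SpectralBound a) (ha : 0 < a) (v : ι → ℝ) :
    0 ≤ v ⬝ᵥ A.mulVec v := by
  have h1 := h.sq_le v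
  have h2 : 0 ≤ (A.mulVec v) ⬝ᵥ (A.mulVec v) := Finset.sum_nonneg fun i _ => mul_self_nonneg _
  by_contra hn
  nlinarith

theorem trace_nonneg (h : A.SpectralBound a) (ha : 0 < a) : 0 ≤ A.trace :=
  Finset.sum_nonneg fun j _ => h.diag_nonneg ha j

theorem trace_le (h : A.SpectralBound a) (ha : 0 < a) : A.trace ≤ Fintype.card ι * a := by
  have := Finset.sum_le_card_nsmul Finset.univ (fun j => A j j) a fun j _ => h.diag_le ha j
  simpa [Matrix.trace] using this

theorem kronecker_one_mulVec {κ : Type*} [Fintype κ] [DecidableEq κ] (A : Matrix ι ι ℝ)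
    (w : ι × κ → ℝ) (p : ι × κ) :
    (A ⊗ₖ (1 : Matrix κ κ ℝ)).mulVec w p = A.mulVec (fun j => w (j, p.2)) p.1 := by
  simp [Matrix.mulVec, dotProduct, Fintype.sum_prod_type, Matrix.one_apply]

theorem dotProduct_kronecker_one_mulVec {κ : Type*} [Fintype κ] [DecidableEq κ]
    (A : Matrix ι ι ℝ) (w : ι × κ → ℝ) :
    w ⬝ᵥ (A ⊗ₖ (1 : Matrix κ κ ℝ)).mulVec w =
      ∑ i, (fun j => w (j, i)) ⬝ᵥ A.mulVec (fun j => w (j, i)) := by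
  simp only [dotProduct, Fintype.sum_prod_type, kronecker_one_mulVec]
  exact Finset.sum_comm

/-- `A ⊗ 1` acts on the columns separately, so both sides add up over columns and the constant does
not grow with their number. -/
theorem kronecker_one (κ : Type*) [Fintype κ] [DecidableEq κ] (h : A.SpectralBound a) :
    (A ⊗ₖ (1 : Matrix κ κ ℝ)).SpectralBound a where
  symm p q := by
    simp [Matrix.one_apply, h.symm p.1 q.1, eq_comm]
  sq_le w := by
    rw [dotProduct_kronecker_one_mulVec, Finset.mul_sum]
    refine le_trans (le_of_eq ?_) (Finset.sum_le_sum fun i _ => h.sq_le fun j => w (j, i))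
    simp only [dotProduct, Fintype.sum_prod_type, kronecker_one_mulVec]
    exact Finset.sum_comm

end Matrix.SpectralBound

/-! ### Quadratic forms in independent signs: moment generating function and tails -/

section Rademacher

instance isProbabilityMeasure_rademacher : IsProbabilityMeasure rademacher where
  measure_univ := by
    simp [rademacher, ENNReal.inv_two_add_inv_two]

theorem ae_rademacher_sq_eq_one : ∀ᵐ x ∂rademacher, x ^ 2 = 1 := by
  rw [rademacher, ae_add_measure_iff]
  constructor <;> refine Measure.ae_smul_measure ?_ _ <;> rw [ae_dirac_eq] <;> simp

theorem rademacher_map_neg : rademacher.map (fun x => -x) = rademacher := by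
  have hm : Measurable fun x : ℝ => -x := measurable_neg
  rw [rademacher, Measure.map_add _ _ hm, Measure.map_smul, Measure.map_smul]
  rw [Measure.map_dirac' hm, Measure.map_dirac' hm, neg_neg, add_comm]

/-- The law of a vector of independent uniform signs. -/
noncomputable abbrev signMeasure (ι : Type*) [Fintype ι] : Measure (ι → ℝ) :=
  Measure.pi fun _ : ι => rademacher

variable {ι : Type*} [Fintype ι]

theorem ae_signMeasure_sq_eq_one : ∀ᵐ r ∂signMeasure ι, ∀ j, r j ^ 2 = 1 := by
  rw [ae_all_iff]
  exact fun j => (measurePreserving_eval (fun _ : ι => rademacher) j).quasiMeasurePreserving.ae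
    ae_rademacher_sq_eq_one

/-- The law is carried by the cube `[-1, 1]^ι`, on which a continuous function is bounded. -/
theorem integrable_signMeasure_of_continuous {g : (ι → ℝ) → ℝ} (hg : Continuous g) :
    Integrable g (signMeasure ι) := by
  obtain ⟨C, hC⟩ := (isCompact_Icc (a := fun _ : ι => (-1 : ℝ)) (b := fun _ => 1)).exists_bound_of_continuousOn
    hg.continuousOn
  refine Integrable.of_bound hg.aestronglyMeasurable C ?_
  filter_upwards [ae_signMeasure_sq_eq_one (ι := ι)] with r hr
  exact hC r ⟨fun j => (abs_le.1 (abs_le_one_iff_mul_self_le_one.2 (by nlinarith [hr j]))).1,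
    fun j => (abs_le.1 (abs_le_one_iff_mul_self_le_one.2 (by nlinarith [hr j]))).2⟩

/-- Used both for flipping a single coordinate and for multiplying by a row of the Walsh–Hadamard
matrix. -/
theorem measurePreserving_sign_mul {c : ι → ℝ} (hc : ∀ j, c j ^ 2 = 1) :
    MeasurePreserving (fun (r : ι → ℝ) j => c j * r j) (signMeasure ι) (signMeasure ι) := by
  refine measurePreserving_pi (fun _ : ι => rademacher) (fun _ : ι => rademacher)
    (f := fun j x => c j * x) fun j => ⟨by fun_prop, ?_⟩
  rcases mul_eq_zero.1 (show (c j - 1) * (c j + 1) = 0 by linear_combination hc j) with h | h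
  · simp [sub_eq_zero.1 h]
  · simpa [eq_neg_of_add_eq_zero_left h] using rademacher_map_neg

/-- This is `y tanh y ≤ y²` with the denominator cleared. -/
theorem mul_one_sub_exp_neg_le (y : ℝ) :
    y * (1 - Real.exp (-(2 * y))) ≤ y ^ 2 * (1 + Real.exp (-(2 * y))) := by
  have hder : ∀ x : ℝ, HasDerivAt
      (fun x : ℝ => x * (1 + Real.exp (-(2 * x))) - (1 - Real.exp (-(2 * x))))
      (1 - Real.exp (-(2 * x)) * (1 + 2 * x)) x := fun x => by
    have h1 : HasDerivAt (fun x : ℝ => Real.exp (-(2 * x))) (Real.exp (-(2 * x)) * -(2 * 1)) x :=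
      (((hasDerivAt_id x).const_mul 2).neg).exp
    refine (((hasDerivAt_id x).mul (h1.const_add 1)).sub (h1.const_sub 1)).congr_deriv ?_
    simp only [id]; ring
  have hmono : Monotone
      (fun x : ℝ => x * (1 + Real.exp (-(2 * x))) - (1 - Real.exp (-(2 * x)))) := by
    refine monotone_of_deriv_nonneg (fun x => (hder x).differentiableAt) fun x => ?_
    rw [(hder x).deriv, sub_nonneg]
    have h1 := Real.add_one_le_exp (2 * x)
    calc Real.exp (-(2 * x)) * (1 + 2 * x) ≤ Real.exp (-(2 * x)) * Real.exp (2 * x) := by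
          gcongr; linarith
      _ = 1 := by rw [← Real.exp_add]; simp
  rcases le_total 0 y with h | h
  · have := hmono h
    simp at this
    nlinarith
  · have := hmono h
    simp at this
    nlinarith

/-- Averaging the integral with its image under the flip turns `t u` into `t u (1 - e^(-4tu)) / 2`,
which is nonnegative; the upper bound is `y tanh y ≤ y²` at `y = 2 t u`. -/
theorem mul_integral_flip_bounds {u p : (ι → ℝ) → ℝ} (hu : Continuous u) (hp : Continuous p)
    {c : ι → ℝ} (hc : ∀ j, c j ^ 2 = 1) (huc : ∀ r, u (fun j => c j * r j) = -u r)
    (hpc : ∀ r, p (fun j => c j * r j) = p r - 4 * u r) (t : ℝ) :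
    0 ≤ t * ∫ r, u r * Real.exp (t * p r) ∂signMeasure ι ∧
      t * ∫ r, u r * Real.exp (t * p r) ∂signMeasure ι ≤
        2 * t ^ 2 * ∫ r, u r ^ 2 * Real.exp (t * p r) ∂signMeasure ι := by
  have hflip : ∀ g : (ι → ℝ) → ℝ, Continuous g →
      ∫ r, g r ∂signMeasure ι = ∫ r, g (fun j => c j * r j) ∂signMeasure ι := fun g hg => by
    have := measurePreserving_sign_mul hc
    rw [← integral_map this.measurable.aemeasurable hg.aestronglyMeasurable, this.map_eq]
  have h1 : 2 * (t * ∫ r, u r * Real.exp (t * p r) ∂signMeasure ι) =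
      ∫ r, t * u r * (1 - Real.exp (-(2 * (2 * (t * u r))))) * Real.exp (t * p r)
        ∂signMeasure ι := by
    have e : ∀ r, t * u r * (1 - Real.exp (-(2 * (2 * (t * u r))))) * Real.exp (t * p r) =
        t * (u r * Real.exp (t * p r)) +
          t * (u (fun j => c j * r j) * Real.exp (t * p (fun j => c j * r j))) := fun r => by
      rw [huc, hpc, show t * (p r - 4 * u r) = -(2 * (2 * (t * u r))) + t * p r by ring,
        Real.exp_add]; ring
    simp_rw [e]
    rw [integral_add (integrable_signMeasure_of_continuous (by fun_prop))
      (integrable_signMeasure_of_continuous (by fun_prop)), integral_const_mul, integral_const_mul,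
      ← hflip (fun r => u r * Real.exp (t * p r)) (by fun_prop)]
    ring
  have h2 : 2 * (2 * t ^ 2 * ∫ r, u r ^ 2 * Real.exp (t * p r) ∂signMeasure ι) =
      ∫ r, 2 * (t * u r) ^ 2 * (1 + Real.exp (-(2 * (2 * (t * u r))))) * Real.exp (t * p r)
        ∂signMeasure ι := by
    have e : ∀ r, 2 * (t * u r) ^ 2 * (1 + Real.exp (-(2 * (2 * (t * u r))))) *
        Real.exp (t * p r) = 2 * t ^ 2 * (u r ^ 2 * Real.exp (t * p r)) +
          2 * t ^ 2 * (u (fun j => c j * r j) ^ 2 * Real.exp (t * p (fun j => c j * r j))) :=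
      fun r => by
        rw [huc, hpc, show t * (p r - 4 * u r) = -(2 * (2 * (t * u r))) + t * p r by ring,
          Real.exp_add]; ring
    simp_rw [e]
    rw [integral_add (integrable_signMeasure_of_continuous (by fun_prop))
      (integrable_signMeasure_of_continuous (by fun_prop)), integral_const_mul, integral_const_mul,
      ← hflip (fun r => u r ^ 2 * Real.exp (t * p r)) (by fun_prop)]
    ring
  constructor
  · have : 0 ≤ 2 * (t * ∫ r, u r * Real.exp (t * p r) ∂signMeasure ι) := by
      rw [h1]
      refine integral_nonneg fun r => mul_nonneg ?_ (Real.exp_pos _).le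
      rcases le_total 0 (t * u r) with h | h
      · exact mul_nonneg h (sub_nonneg.2 (Real.exp_le_one_iff.2 (by linarith)))
      · exact mul_nonneg_of_nonpos_of_nonpos h (sub_nonpos.2 (Real.one_le_exp (by linarith)))
    linarith
  · have : 2 * (t * ∫ r, u r * Real.exp (t * p r) ∂signMeasure ι) ≤
        2 * (2 * t ^ 2 * ∫ r, u r ^ 2 * Real.exp (t * p r) ∂signMeasure ι) := by
      rw [h1, h2]
      refine integral_mono (integrable_signMeasure_of_continuous (by fun_prop))
        (integrable_signMeasure_of_continuous (by fun_prop)) fun r => ?_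
      refine mul_le_mul_of_nonneg_right ?_ (Real.exp_pos _).le
      have := mul_one_sub_exp_neg_le (2 * (t * u r))
      nlinarith
    linarith

/-- The centred quadratic form `rᵀ A r - tr A`. -/
noncomputable def centeredForm (A : Matrix ι ι ℝ) (r : ι → ℝ) : ℝ := r ⬝ᵥ A.mulVec r - A.trace

theorem continuous_centeredForm (A : Matrix ι ι ℝ) : Continuous (centeredForm A) := by
  unfold centeredForm dotProduct Matrix.mulVec dotProduct
  fun_prop

theorem centeredForm_neg_coord [DecidableEq ι] {A : Matrix ι ι ℝ} (hA : ∀ j k, A j k = A k j)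
    (j : ι) (r : ι → ℝ) :
    centeredForm A (fun k => (if k = j then -1 else 1) * r k) =
      centeredForm A r - 4 * (r j * (A.mulVec r j - A j j * r j)) := by
  have e : (fun k => (if k = j then (-1 : ℝ) else 1) * r k) = r - Pi.single j (2 * r j) := by
    ext k
    by_cases h : k = j
    · subst h; simp; ring
    · simp [h]
  have h1 : r ⬝ᵥ A.mulVec (Pi.single j (2 * r j)) = 2 * r j * A.mulVec r j := by
    rw [Matrix.mulVec_single]
    simp only [dotProduct, Matrix.mulVec, Finset.mul_sum]
    refine Finset.sum_congr rfl fun k _ => ?_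
    simp [hA k j]; ring
  rw [e, centeredForm, centeredForm, Matrix.mulVec_sub, dotProduct_sub, sub_dotProduct,
    sub_dotProduct, h1]
  simp
  ring

theorem mulVec_neg_coord [DecidableEq ι] (A : Matrix ι ι ℝ) (j : ι) (r : ι → ℝ) :
    A.mulVec (fun k => (if k = j then -1 else 1) * r k) j = A.mulVec r j - 2 * (A j j * r j) := by
  have e : (fun k => (if k = j then (-1 : ℝ) else 1) * r k) = r - Pi.single j (2 * r j) := by
    ext k
    by_cases h : k = j
    · subst h; simp; ring
    · simp [h]
  rw [e, Matrix.mulVec_sub]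
  simp; ring

/-- For sign vectors the form splits as `∑ uⱼ`, where flipping `rⱼ` changes the sign of `uⱼ` and
lowers the form by `4uⱼ`. The flip bounds reduce the claim to estimating `∑ E[uⱼ² e^(tp)]`. -/
theorem mul_deriv_mgf_centeredForm_le {A : Matrix ι ι ℝ} {a : ℝ} (hA : A.SpectralBound a)
    (ha : 0 < a) {t : ℝ} (ht : 2 * a * |t| < 1) :
    t * ∫ r, centeredForm A r * Real.exp (t * centeredForm A r) ∂signMeasure ι ≤
      2 * (a * A.trace / (1 - 2 * a * |t|)) * t ^ 2 * mgf (centeredForm A) (signMeasure ι) t := by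
  classical
  rcases eq_or_ne t 0 with rfl | ht0
  · simp
  set p := centeredForm A with hp
  have hpc : Continuous p := continuous_centeredForm A
  set u : ι → (ι → ℝ) → ℝ := fun j r => r j * (A.mulVec r j - A j j * r j) with hu
  have huc : ∀ j, Continuous (u j) := fun j => by
    simp only [hu, Matrix.mulVec, dotProduct]; fun_prop
  set U : ι → ℝ := fun j => ∫ r, u j r * Real.exp (t * p r) ∂signMeasure ι with hU
  set G : ι → ℝ := fun j => ∫ r, u j r ^ 2 * Real.exp (t * p r) ∂signMeasure ι with hG
  have hflip : ∀ j, 0 ≤ t * U j ∧ t * U j ≤ 2 * t ^ 2 * G j := fun j => by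
    refine mul_integral_flip_bounds (huc j) hpc (c := fun k => if k = j then -1 else 1)
      (fun k => by split_ifs <;> norm_num) (fun r => ?_) (fun r => ?_) t
    · simp only [hu]
      rw [mulVec_neg_coord]
      simp only [if_true]
      ring
    · exact centeredForm_neg_coord hA.symm j r
  have hF' : ∫ r, p r * Real.exp (t * p r) ∂signMeasure ι = ∑ j, U j := by
    rw [hU, ← integral_finsetSum _ fun j _ => integrable_signMeasure_of_continuous
      (by have := huc j; fun_prop)]
    refine integral_congr_ae ?_
    filter_upwards [ae_signMeasure_sq_eq_one (ι := ι)] with r hr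
    rw [← Finset.sum_mul]
    congr 1
    simp only [hp, centeredForm, hu, dotProduct, Matrix.trace, Matrix.diag]
    rw [← Finset.sum_sub_distrib]
    refine Finset.sum_congr rfl fun j _ => ?_
    linear_combination A j j * hr j
  set F' := ∫ r, p r * Real.exp (t * p r) ∂signMeasure ι with hF'def
  -- Since `rⱼ² = 1`, `(A r)ⱼ² = (uⱼ + Aⱼⱼ)²`; dropping the squares `Aⱼⱼ²` leaves a sum bounded by
  -- `‖A r‖² ≤ a rᵀAr`.
  have hmain : ∑ j, G j + 2 * ∑ j, A j j * U j ≤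
      a * (F' + A.trace * mgf p (signMeasure ι) t) := by
    have h1 : a * (F' + A.trace * mgf p (signMeasure ι) t) =
        ∫ r, a * (p r + A.trace) * Real.exp (t * p r) ∂signMeasure ι := by
      rw [hF'def, mgf, ← integral_const_mul, ← integral_add
        (integrable_signMeasure_of_continuous (by fun_prop))
        (integrable_signMeasure_of_continuous (by fun_prop)), ← integral_const_mul]
      congr 1; ext r; ring
    have h2 : ∑ j, G j + 2 * ∑ j, A j j * U j =
        ∫ r, ∑ j, (u j r ^ 2 + 2 * (A j j * u j r)) * Real.exp (t * p r) ∂signMeasure ι := by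
      rw [integral_finsetSum _ fun j _ => integrable_signMeasure_of_continuous
        (by have := huc j; fun_prop), Finset.mul_sum, ← Finset.sum_add_distrib]
      refine Finset.sum_congr rfl fun j _ => ?_
      rw [hG, hU]
      simp only
      rw [← integral_const_mul, ← integral_const_mul, ← integral_add
        (integrable_signMeasure_of_continuous (by have := huc j; fun_prop))
        (integrable_signMeasure_of_continuous (by have := huc j; fun_prop))]
      congr 1; ext r; ring
    rw [h1, h2]
    refine integral_mono_ae (integrable_signMeasure_of_continuous (by fun_prop))
      (integrable_signMeasure_of_continuous (by fun_prop)) ?_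
    filter_upwards [ae_signMeasure_sq_eq_one (ι := ι)] with r hr
    rw [← Finset.sum_mul]
    refine mul_le_mul_of_nonneg_right ?_ (Real.exp_pos _).le
    have h3 := hA.sq_le r
    rw [show a * (p r + A.trace) = a * (r ⬝ᵥ A.mulVec r) by rw [hp, centeredForm, sub_add_cancel]]
    refine le_trans ?_ h3
    rw [dotProduct]
    refine Finset.sum_le_sum fun j _ => ?_
    simp only [hu]
    have h4 := hr j
    have h5 : A.mulVec r j * A.mulVec r j - ((r j * (A.mulVec r j - A j j * r j)) ^ 2 +
      2 * (A j j * (r j * (A.mulVec r j - A j j * r j)))) = A j j ^ 2 := by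
      linear_combination (-(A.mulVec r j - A j j * r j) ^ 2 + A j j ^ 2) * h4
    nlinarith [sq_nonneg (A j j)]
  have hGnn : ∀ j, 0 ≤ G j := fun j =>
    integral_nonneg fun r => mul_nonneg (sq_nonneg _) (Real.exp_pos _).le
  have hFnn : 0 ≤ mgf p (signMeasure ι) t := mgf_nonneg
  have hTF : 0 ≤ A.trace * mgf p (signMeasure ι) t := mul_nonneg (hA.trace_nonneg ha) hFnn
  have htF : t * F' ≤ 2 * t ^ 2 * ∑ j, G j := by
    rw [hF', Finset.mul_sum, Finset.mul_sum]
    exact Finset.sum_le_sum fun j _ => (hflip j).2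
  -- All `Uⱼ` have the sign of `t`. For `t > 0` the diagonal sum is dropped; for `t < 0`, `Aⱼⱼ ≤ a`
  -- gives `∑ Aⱼⱼ Uⱼ ≥ a F'`, which turns `a F'` into `-a F' = a |F'|`.
  have hGle : ∑ j, G j ≤ a * A.trace * mgf p (signMeasure ι) t + a * |F'| := by
    rcases ht0.lt_or_gt with h | h
    · have hUn : ∀ j, U j ≤ 0 := fun j => by
        by_contra hn; push Not at hn; nlinarith [(hflip j).1]
      have h1 : a * F' ≤ ∑ j, A j j * U j := by
        rw [hF', Finset.mul_sum]
        exact Finset.sum_le_sum fun j _ => mul_le_mul_of_nonpos_right (hA.diag_le ha j) (hUn j)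
      nlinarith [neg_abs_le F', le_abs_self F', neg_le_abs F']
    · have hUn : ∀ j, 0 ≤ U j := fun j => by
        by_contra hn; push Not at hn; nlinarith [(hflip j).1]
      have h1 : 0 ≤ ∑ j, A j j * U j :=
        Finset.sum_nonneg fun j _ => mul_nonneg (hA.diag_nonneg ha j) (hUn j)
      nlinarith [neg_abs_le F', le_abs_self F', neg_le_abs F']
  have hpos : 0 ≤ t * F' := by
    rw [hF', Finset.mul_sum]
    exact Finset.sum_nonneg fun j _ => (hflip j).1
  have habs : |t| * |F'| = t * F' := by rw [← abs_mul, abs_of_nonneg hpos]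
  have hsq : t ^ 2 = |t| * |t| := by rw [← sq, sq_abs]
  have h1 : t * F' * (1 - 2 * a * |t|) ≤ 2 * (a * A.trace) * t ^ 2 * mgf p (signMeasure ι) t := by
    have h2 : 2 * t ^ 2 * ∑ j, G j ≤
        2 * t ^ 2 * (a * A.trace * mgf p (signMeasure ι) t + a * |F'|) := by gcongr
    have h3 : 2 * t ^ 2 * (a * |F'|) = 2 * a * |t| * (t * F') := by rw [hsq, ← habs]; ring
    nlinarith
  have h4 : 0 < 1 - 2 * a * |t| := by linarith
  rw [show 2 * (a * A.trace / (1 - 2 * a * |t|)) * t ^ 2 * mgf p (signMeasure ι) t =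
    2 * (a * A.trace) * t ^ 2 * mgf p (signMeasure ι) t / (1 - 2 * a * |t|) by ring,
    le_div_iff₀ h4]
  exact h1

/-- A differential inequality for moment generating functions, on a segment from the origin. -/
theorem le_exp_mul_sq_of_mul_deriv_le {F F' : ℝ → ℝ} {C t : ℝ} (hF : ∀ s, HasDerivAt F (F' s) s)
    (h0 : F 0 = 1) (h : ∀ s, |s| ≤ |t| → s * F' s ≤ 2 * C * s ^ 2 * F s) :
    F t ≤ Real.exp (C * t ^ 2) := by
  have hder : ∀ s : ℝ, HasDerivAt (fun s => F (s * t) * Real.exp (-(C * t ^ 2 * s ^ 2)))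
      (F' (s * t) * t * Real.exp (-(C * t ^ 2 * s ^ 2)) +
        F (s * t) * (Real.exp (-(C * t ^ 2 * s ^ 2)) * -(C * t ^ 2 * (2 * s)))) s := fun s => by
    have h1 : HasDerivAt (fun s : ℝ => s * t) t s := by simpa using (hasDerivAt_id s).mul_const t
    have h2 : HasDerivAt (fun s : ℝ => -(C * t ^ 2 * s ^ 2)) (-(C * t ^ 2 * (2 * s))) s := by
      simpa using ((hasDerivAt_pow 2 s).const_mul (C * t ^ 2)).fun_neg
    exact ((hF (s * t)).comp s h1).mul h2.exp
  have hanti : AntitoneOn (fun s => F (s * t) * Real.exp (-(C * t ^ 2 * s ^ 2)))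
      (Set.Icc 0 1) := by
    refine antitoneOn_of_deriv_nonpos (convex_Icc 0 1)
      (fun s _ => (hder s).continuousAt.continuousWithinAt)
      (fun s _ => (hder s).differentiableAt.differentiableWithinAt) fun s hs => ?_
    rw [interior_Icc] at hs
    rw [(hder s).deriv]
    have h1 := h (s * t) (by
      rw [abs_mul, abs_of_pos hs.1]
      exact mul_le_of_le_one_left (abs_nonneg t) hs.2.le)
    have h2 : s * (F' (s * t) * t - 2 * C * s * t ^ 2 * F (s * t)) ≤ 0 := by nlinarith
    have h3 : F' (s * t) * t - 2 * C * s * t ^ 2 * F (s * t) ≤ 0 := by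
      by_contra hn
      push Not at hn
      exact absurd h2 (not_le.2 (mul_pos hs.1 hn))
    have h4 := mul_nonpos_of_nonpos_of_nonneg h3 (Real.exp_pos (-(C * t ^ 2 * s ^ 2))).le
    nlinarith
  have := hanti (Set.left_mem_Icc.2 zero_le_one) (Set.right_mem_Icc.2 zero_le_one) zero_le_one
  simp only [one_mul, one_pow, mul_one, zero_mul, h0] at this
  rw [Real.exp_neg, ← div_eq_mul_inv, div_le_iff₀ (Real.exp_pos _)] at this
  simpa using this

theorem hasDerivAt_mgf_signMeasure {p : (ι → ℝ) → ℝ} (hp : Continuous p) (t : ℝ) :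
    HasDerivAt (mgf p (signMeasure ι)) (∫ r, p r * Real.exp (t * p r) ∂signMeasure ι) t := by
  refine hasDerivAt_mgf ?_
  have : integrableExpSet p (signMeasure ι) = Set.univ := by
    ext s
    simpa [integrableExpSet] using integrable_signMeasure_of_continuous (by fun_prop)
  rw [this, interior_univ]
  trivial

theorem mgf_centeredForm_le {A : Matrix ι ι ℝ} {a : ℝ} (hA : A.SpectralBound a)
    (ha : 0 < a) {t : ℝ} (ht : 2 * a * |t| < 1) :
    mgf (centeredForm A) (signMeasure ι) t ≤
      Real.exp (a * A.trace / (1 - 2 * a * |t|) * t ^ 2) := by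
  refine le_exp_mul_sq_of_mul_deriv_le
    (fun s => hasDerivAt_mgf_signMeasure (continuous_centeredForm A) s) (by simp) fun s hs => ?_
  have hs' : 2 * a * |s| ≤ 2 * a * |t| := by gcongr
  refine (mul_deriv_mgf_centeredForm_le hA ha (hs'.trans_lt ht)).trans ?_
  have hT := hA.trace_nonneg ha
  gcongr
  exact mgf_nonneg

theorem centeredForm_tail_le {A : Matrix ι ι ℝ} {a ε : ℝ} (hA : A.SpectralBound a)
    (ha : 0 < a) (hε : 0 < ε) :
    (signMeasure ι).real {r | ε * A.trace ≤ |centeredForm A r|} ≤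
      2 * Real.exp (-(A.trace / a * (ε ^ 2 / (4 * (1 + ε))))) := by
  -- This choice makes `1 - 2 a t = 1 / (1 + ε)`.
  set t := ε / (2 * a * (1 + ε)) with ht
  have htpos : 0 < t := by positivity
  have hta : 2 * a * t = ε / (1 + ε) := by rw [ht]; field_simp
  have hlt : 2 * a * |t| < 1 := by
    rw [abs_of_pos htpos, hta, div_lt_one (by positivity)]; linarith
  have hexp : -t * (ε * A.trace) + a * A.trace / (1 - 2 * a * t) * t ^ 2 =
      -(A.trace / a * (ε ^ 2 / (4 * (1 + ε)))) := by
    have : 1 - 2 * a * t = 1 / (1 + ε) := by rw [hta]; field_simp; ring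
    rw [this, ht]; field_simp; ring
  have hup : (signMeasure ι).real {r | ε * A.trace ≤ centeredForm A r} ≤
      Real.exp (-(A.trace / a * (ε ^ 2 / (4 * (1 + ε))))) := by
    have h1 := measure_ge_le_exp_mul_mgf (μ := signMeasure ι) (X := centeredForm A)
      (ε * A.trace) htpos.le (integrable_signMeasure_of_continuous
        (by have := continuous_centeredForm A; fun_prop))
    have h2 := mgf_centeredForm_le hA ha hlt
    rw [abs_of_pos htpos] at h2
    refine h1.trans ?_
    rw [← hexp, Real.exp_add]
    gcongr
  have hlo : (signMeasure ι).real {r | centeredForm A r ≤ -(ε * A.trace)} ≤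
      Real.exp (-(A.trace / a * (ε ^ 2 / (4 * (1 + ε))))) := by
    have h1 := measure_le_le_exp_mul_mgf (μ := signMeasure ι) (X := centeredForm A)
      (-(ε * A.trace)) (neg_nonpos.2 htpos.le) (integrable_signMeasure_of_continuous
        (by have := continuous_centeredForm A; fun_prop))
    have h2 := mgf_centeredForm_le hA ha (t := -t) (by rwa [abs_neg])
    rw [abs_neg, abs_of_pos htpos, neg_sq] at h2
    refine h1.trans ?_
    rw [← hexp, Real.exp_add, neg_neg, mul_neg, neg_mul]
    gcongr
  calc _ ≤ (signMeasure ι).real ({r | ε * A.trace ≤ centeredForm A r} ∪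
        {r | centeredForm A r ≤ -(ε * A.trace)}) := by
        refine measureReal_mono fun r hr => ?_
        rcases le_abs.1 (Set.mem_ofPred_eq ▸ hr) with h | h
        · exact Or.inl h
        · exact Or.inr (by simp only [Set.mem_ofPred_eq]; linarith)
    _ ≤ _ := measureReal_union_le _ _
    _ ≤ _ := by linarith

theorem two_mul_exp_neg_le_of_log_le {δ y : ℝ} (hδ : 0 < δ) (hy : Real.log (2 / δ) ≤ y) :
    2 * Real.exp (-y) ≤ δ := by
  have h1 : Real.exp (-y) ≤ Real.exp (-Real.log (2 / δ)) := Real.exp_le_exp.2 (by linarith)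
  rw [← Real.log_inv, Real.exp_log (by positivity), inv_div] at h1
  linarith

end Rademacher

/-! ### Reduction to a centred quadratic form; the Rademacher case -/

section SketchReduction

variable {d ℓ : ℕ}

theorem sum_inner_hessian_sub_trace (hℓ : 0 < ℓ) (φ : EuclideanSpace ℝ (Fin d) → ℝ)
    (x : EuclideanSpace ℝ (Fin d)) (S : Matrix (Fin d) (Fin ℓ) ℝ) :
    ∑ i, inner ℝ (hessian φ x (sketchCol S i)) (sketchCol S i) - hessianTrace φ x =
      centeredForm (hessianMatrix φ x ⊗ₖ (1 : Matrix (Fin ℓ) (Fin ℓ) ℝ))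
        (fun p => S p.1 p.2 * √(ℓ : ℝ)) / ℓ := by
  have hℓ' : (0 : ℝ) < ℓ := by exact_mod_cast hℓ
  rw [centeredForm, Matrix.SpectralBound.dotProduct_kronecker_one_mulVec, Matrix.trace_kronecker,
    trace_hessianMatrix, Matrix.trace_one, Fintype.card_fin, sub_div,
    mul_div_cancel_right₀ _ hℓ'.ne', Finset.sum_div]
  congr 1
  refine Finset.sum_congr rfl fun i _ => ?_
  rw [inner_hessian_eq_dotProduct]
  have e : (fun j => S j i * √(ℓ : ℝ)) = √(ℓ : ℝ) • (sketchCol S i).ofLp := by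
    ext j; simp [sketchCol, mul_comm]
  simp only [e, Matrix.mulVec_smul, smul_dotProduct, dotProduct_smul, smul_eq_mul]
  rw [← mul_assoc, Real.mul_self_sqrt hℓ'.le, mul_div_cancel_left₀ _ hℓ'.ne']

/-- The Taylor and noise errors hold for every `S`, so a failure of the estimate can only come from
the quadratic form. This puts the failure event inside a tail event for all three sketches. -/
theorem le_abs_centeredForm_of_not_le {φ f : EuclideanSpace ℝ (Fin d) → ℝ} {L σ α ε : ℝ}
    (hdiff : Differentiable ℝ φ) (hdiff₂ : Differentiable ℝ (∇ φ))
    (hnoise : ∀ y, |f y - φ y| ≤ σ)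
    (hLip : ∀ y z, ‖hessian φ y - hessian φ z‖ ≤ L * ‖y - z‖) (hα : 0 < α) (hℓ : 0 < ℓ)
    {x : EuclideanSpace ℝ (Fin d)} {S : Matrix (Fin d) (Fin ℓ) ℝ}
    (h : ¬ |traceEstimator f α x S - hessianTrace φ x| ≤
      ε * hessianTrace φ x + L * sumCubeNorms S / 3 * α + 4 * ℓ * σ / α ^ 2) :
    ε * (hessianMatrix φ x ⊗ₖ (1 : Matrix (Fin ℓ) (Fin ℓ) ℝ)).trace <
      |centeredForm (hessianMatrix φ x ⊗ₖ (1 : Matrix (Fin ℓ) (Fin ℓ) ℝ))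
        (fun p => S p.1 p.2 * √(ℓ : ℝ))| := by
  have hℓ' : (0 : ℝ) < ℓ := by exact_mod_cast hℓ
  have h1 := abs_traceEstimator_sub_le hdiff hdiff₂ hnoise hLip hα x S
  have h2 := abs_sub_le (traceEstimator f α x S)
    (∑ i, inner ℝ (hessian φ x (sketchCol S i)) (sketchCol S i)) (hessianTrace φ x)
  rw [sum_inner_hessian_sub_trace hℓ, abs_div, abs_of_pos hℓ'] at h2
  rw [Matrix.trace_kronecker, trace_hessianMatrix, Matrix.trace_one, Fintype.card_fin]
  push Not at h
  have h3 : ε * hessianTrace φ x < |centeredForm (hessianMatrix φ x ⊗ₖ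
      (1 : Matrix (Fin ℓ) (Fin ℓ) ℝ)) (fun p => S p.1 p.2 * √(ℓ : ℝ))| / ℓ := by linarith
  rw [lt_div_iff₀ hℓ'] at h3
  linarith

theorem IsRademacherSketch.hasLaw {Ω : Type*} [MeasurableSpace Ω] {P : Measure Ω}
    [IsProbabilityMeasure P] {S : Ω → Matrix (Fin d) (Fin ℓ) ℝ} (h : IsRademacherSketch P S)
    (hℓ : 0 < ℓ) :
    HasLaw (fun ω (p : Fin d × Fin ℓ) => S ω p.1 p.2 * √(ℓ : ℝ)) (signMeasure (Fin d × Fin ℓ))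
      P := by
  have hℓ' : √(ℓ : ℝ) ≠ 0 := (Real.sqrt_pos.2 (by exact_mod_cast hℓ)).ne'
  have hind := h.indep.comp (fun _ x => x * √(ℓ : ℝ)) fun _ => by fun_prop
  refine hind.hasLaw_pi fun p => ?_
  have h1 : HasLaw (fun x : ℝ => x * √(ℓ : ℝ)) rademacher
      (rademacher.map (fun r => r / √(ℓ : ℝ))) := by
    refine ⟨by fun_prop, ?_⟩
    rw [Measure.map_map (by fun_prop) (by fun_prop)]
    convert Measure.map_id
    ext r
    simp [div_mul_cancel₀ _ hℓ']
  exact h1.comp (h.law p.1 p.2)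

theorem sumCubeNorms_eq_of_sq_eq {S : Matrix (Fin d) (Fin ℓ) ℝ}
    (h : ∀ j i, S j i ^ 2 = 1 / ℓ) :
    sumCubeNorms S = (d : ℝ) ^ (3 / 2 : ℝ) * (ℓ : ℝ) ^ (-(1 / 2) : ℝ) := by
  have hcol : ∀ i, ‖sketchCol S i‖ ^ 3 = ((d : ℝ) / ℓ) ^ (3 / 2 : ℝ) := fun i => by
    have h1 : ‖sketchCol S i‖ ^ 2 = d / ℓ := by
      rw [EuclideanSpace.real_norm_sq_eq]
      simp [sketchCol, h, div_eq_mul_inv]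
    rw [← h1, ← Real.rpow_natCast, ← Real.rpow_natCast, ← Real.rpow_mul (norm_nonneg _)]
    norm_num
  rw [sumCubeNorms, Finset.sum_congr rfl fun i _ => hcol i]
  rcases Nat.eq_zero_or_pos ℓ with rfl | hℓ
  · simp
  have hℓ' : (0 : ℝ) < ℓ := by exact_mod_cast hℓ
  rw [Finset.sum_const, Finset.card_univ, Fintype.card_fin, nsmul_eq_mul,
    Real.div_rpow (Nat.cast_nonneg d) hℓ'.le, show (-(1 / 2) : ℝ) = 1 - 3 / 2 by norm_num,
    Real.rpow_sub hℓ', Real.rpow_one]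
  ring

theorem rademacher_sketch_bounds {Ω : Type*} [MeasurableSpace Ω] {P : Measure Ω}
    [IsProbabilityMeasure P] {S : Ω → Matrix (Fin d) (Fin ℓ) ℝ}
    {φ f : EuclideanSpace ℝ (Fin d) → ℝ} {x : EuclideanSpace ℝ (Fin d)}
    {α σ Lhat ε δ : ℝ} (hα : 0 < α) (hε₀ : 0 < ε) (hδ₀ : 0 < δ) (hδ₁ : δ < 1)
    (hconv : ConvexOn ℝ Set.univ φ) (hdiff : Differentiable ℝ φ)
    (hdiff₂ : Differentiable ℝ (∇ φ)) (hnoise : ∀ y, |f y - φ y| ≤ σ)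
    (hLip : ∀ y z, ‖hessian φ y - hessian φ z‖ ≤ Lhat * ‖y - z‖)
    (hS : IsRademacherSketch P S) (hT : 0 < hessianTrace φ x)
    (hℓ : 8 * ε⁻¹ ^ 2 * (1 + ε) * (‖hessian φ x‖ / hessianTrace φ x) * Real.log (2 / δ) ≤
      (ℓ : ℝ)) :
    P {ω | ¬ |traceEstimator f α x (S ω) - hessianTrace φ x| ≤
        ε * hessianTrace φ x + Lhat * sumCubeNorms (S ω) / 3 * α + 4 * ℓ * σ / α ^ 2}
      ≤ ENNReal.ofReal δ ∧
    ∀ᵐ ω ∂P, sumCubeNorms (S ω) ≤ (d : ℝ) ^ (3 / 2 : ℝ) * (ℓ : ℝ) ^ (-(1 / 2) : ℝ) := by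
  have hlog : 0 < Real.log (2 / δ) := Real.log_pos (by rw [lt_div_iff₀ hδ₀]; linarith)
  have ha : 0 < ‖hessian φ x‖ := by
    refine norm_pos_iff.2 fun h0 => hT.ne' ?_
    simp [hessianTrace, h0]
  have hℓ' : (0 : ℝ) < ℓ := lt_of_lt_of_le (by positivity) hℓ
  have hℓn : 0 < ℓ := by exact_mod_cast hℓ'
  have hlaw := hS.hasLaw hℓn
  have hA := (hessianMatrix_spectralBound hconv hdiff hdiff₂ hLip x).kronecker_one (Fin ℓ)
  constructor
  · have htail := centeredForm_tail_le hA ha hε₀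
    have htr : (hessianMatrix φ x ⊗ₖ (1 : Matrix (Fin ℓ) (Fin ℓ) ℝ)).trace =
        hessianTrace φ x * ℓ := by
      rw [Matrix.trace_kronecker, trace_hessianMatrix, Matrix.trace_one, Fintype.card_fin]
    have hy : Real.log (2 / δ) ≤ (hessianMatrix φ x ⊗ₖ (1 : Matrix (Fin ℓ) (Fin ℓ) ℝ)).trace /
        ‖hessian φ x‖ * (ε ^ 2 / (4 * (1 + ε))) := by
      rw [htr]
      -- The sample size provides twice the exponent that is needed.
      have h1 : 2 * Real.log (2 / δ) = hessianTrace φ x * (8 * ε⁻¹ ^ 2 * (1 + ε) *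
          (‖hessian φ x‖ / hessianTrace φ x) * Real.log (2 / δ)) /
          ‖hessian φ x‖ * (ε ^ 2 / (4 * (1 + ε))) := by field_simp; ring
      calc Real.log (2 / δ) ≤ 2 * Real.log (2 / δ) := by linarith
        _ ≤ _ := by rw [h1]; gcongr
    have hmeas : MeasurableSet {r : Fin d × Fin ℓ → ℝ |
        ε * (hessianMatrix φ x ⊗ₖ (1 : Matrix (Fin ℓ) (Fin ℓ) ℝ)).trace ≤
        |centeredForm (hessianMatrix φ x ⊗ₖ (1 : Matrix (Fin ℓ) (Fin ℓ) ℝ)) r|} :=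
      measurableSet_le measurable_const (continuous_centeredForm _).abs.measurable
    refine (measure_mono fun ω hω => ?_).trans ((hlaw.measure_eq hmeas).le.trans ?_)
    · exact (le_abs_centeredForm_of_not_le hdiff hdiff₂ hnoise hLip hα hℓn hω).le
    · rw [← ofReal_measureReal]
      exact ENNReal.ofReal_le_ofReal (htail.trans (two_mul_exp_neg_le_of_log_le hδ₀ hy))
  · have hsq : ∀ᵐ ω ∂P, ∀ p : Fin d × Fin ℓ, (S ω p.1 p.2 * √(ℓ : ℝ)) ^ 2 = 1 :=
      (hlaw.ae_iff (by fun_prop)).2 ae_signMeasure_sq_eq_one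
    filter_upwards [hsq] with ω hω
    refine (sumCubeNorms_eq_of_sq_eq fun j i => ?_).le
    have := hω (j, i)
    rw [mul_pow, Real.sq_sqrt hℓ'.le] at this
    field_simp
    linarith

end SketchReduction

/-! ### Orthogonality of the Walsh–Hadamard matrix -/

section WalshHadamard

/-- The index bijection of the Kronecker recursion for `walshHadamard`. -/
def walshIndexEquiv (m : ℕ) : Fin (2 ^ m) × Fin 2 ≃ Fin (2 ^ (m + 1)) := finProdFinEquiv

theorem walshHadamard_succ (m : ℕ) : walshHadamard (m + 1) =
    (walshHadamard m ⊗ₖ (!![1, 1; 1, -1] : Matrix (Fin 2) (Fin 2) ℝ)).submatrix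
      (walshIndexEquiv m).symm (walshIndexEquiv m).symm := rfl

theorem walshHadamard_sq_eq_one (m : ℕ) (i j : Fin (2 ^ m)) : walshHadamard m i j ^ 2 = 1 := by
  induction m with
  | zero =>
    have : i = j := Subsingleton.elim (α := Fin 1) i j
    rw [walshHadamard, this, Matrix.one_apply_eq, one_pow]
  | succ m ih =>
    rw [walshHadamard_succ, Matrix.submatrix_apply, Matrix.kroneckerMap_apply, mul_pow, ih, one_mul]
    generalize ((walshIndexEquiv m).symm i).2 = a
    generalize ((walshIndexEquiv m).symm j).2 = b
    fin_cases a <;> fin_cases b <;> simp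

theorem walshHadamard_transpose_mul_self (m : ℕ) :
    (walshHadamard m).transpose * walshHadamard m = (2 ^ m : ℝ) • 1 := by
  induction m with
  | zero => simp [walshHadamard]
  | succ m ih =>
    have h2 : (!![1, 1; 1, -1] : Matrix (Fin 2) (Fin 2) ℝ).transpose * !![1, 1; 1, -1] =
        (2 : ℝ) • 1 := by
      ext i j; fin_cases i <;> fin_cases j <;> simp [Matrix.mul_apply, Fin.sum_univ_two] <;> norm_num
    rw [walshHadamard_succ, Matrix.transpose_submatrix, Matrix.submatrix_mul_equiv,
      ← Matrix.kroneckerMap_transpose, ← Matrix.mul_kronecker_mul, ih, h2,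
      Matrix.smul_kronecker, Matrix.kronecker_smul, Matrix.one_kronecker_one, smul_smul, ← pow_succ]
    ext i j
    simp [Matrix.one_apply]

theorem sum_walshHadamard_mul (m : ℕ) (j j' : Fin (2 ^ m)) :
    ∑ k, walshHadamard m k j * walshHadamard m k j' = if j = j' then 2 ^ m else 0 := by
  have := congrFun (congrFun (walshHadamard_transpose_mul_self m) j) j'
  simpa [Matrix.mul_apply, Matrix.one_apply] using this

/-- The average over the rows of the Walsh-Hadamard matrix of the centred form vanishes. -/
theorem sum_centeredForm_walshHadamard {m : ℕ} (A : Matrix (Fin (2 ^ m)) (Fin (2 ^ m)) ℝ)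
    {s : Fin (2 ^ m) → ℝ} (hs : ∀ j, s j ^ 2 = 1) :
    ∑ k, centeredForm A (fun j => walshHadamard m k j * s j) = 0 := by
  simp only [centeredForm, Finset.sum_sub_distrib, dotProduct, Matrix.mulVec, Finset.mul_sum]
  rw [Finset.sum_comm]
  have h1 : ∀ j, ∑ k, ∑ j', walshHadamard m k j * s j * (A j j' * (walshHadamard m k j' * s j')) =
      2 ^ m * A j j := fun j => by
    rw [Finset.sum_comm]
    have h2 : ∀ j', ∑ k, walshHadamard m k j * s j * (A j j' * (walshHadamard m k j' * s j')) =
        s j * A j j' * s j' * if j = j' then 2 ^ m else 0 := fun j' => by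
      rw [← sum_walshHadamard_mul, Finset.mul_sum]
      exact Finset.sum_congr rfl fun k _ => by ring
    rw [Finset.sum_congr rfl fun j' _ => h2 j']
    simp
    linear_combination 2 ^ m * A j j * hs j
  rw [Finset.sum_congr rfl fun j _ => h1 j, ← Finset.mul_sum]
  simp [Matrix.trace]

end WalshHadamard

/-! ### Splitting over columns, and the operator norm against the trace -/

theorem centeredForm_kronecker_one {ι κ : Type*} [Fintype ι] [Fintype κ] [DecidableEq κ]
    (A : Matrix ι ι ℝ) (w : ι × κ → ℝ) :
    centeredForm (A ⊗ₖ (1 : Matrix κ κ ℝ)) w = ∑ i, centeredForm A (fun j => w (j, i)) := by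
  simp only [centeredForm, Finset.sum_sub_distrib]
  rw [Matrix.SpectralBound.dotProduct_kronecker_one_mulVec, Matrix.trace_kronecker,
    Matrix.trace_one]
  simp [mul_comm]

theorem Matrix.SpectralBound.sum_sq_le {ι : Type*} [Fintype ι] {A : Matrix ι ι ℝ} {a : ℝ}
    (h : A.SpectralBound a) : ∑ j, ∑ k, A j k ^ 2 ≤ a * A.trace := by
  classical
  rw [Finset.sum_comm, Matrix.trace, Finset.mul_sum]
  refine Finset.sum_le_sum fun k _ => ?_
  have h1 := h.sq_le (Pi.single k 1)
  simpa [dotProduct, Pi.single_apply, sq] using h1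

theorem Matrix.SpectralBound.mono {ι : Type*} [Fintype ι] {A : Matrix ι ι ℝ} {a b : ℝ}
    (h : A.SpectralBound a) (ha : 0 < a) (hab : a ≤ b) : A.SpectralBound b :=
  ⟨h.symm, fun v => (h.sq_le v).trans
    (mul_le_mul_of_nonneg_right hab (h.quadratic_nonneg ha v))⟩

/-- The operator norm is at most the Frobenius norm, whose square is at most `‖H‖ tr H`; cancel one
factor `‖H‖`. -/
theorem norm_hessian_le_hessianTrace {d : ℕ} {φ : EuclideanSpace ℝ (Fin d) → ℝ}
    {x : EuclideanSpace ℝ (Fin d)} (h : (hessianMatrix φ x).SpectralBound ‖hessian φ x‖) :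
    ‖hessian φ x‖ ≤ hessianTrace φ x := by
  set a := ‖hessian φ x‖ with ha
  have h1 : a ≤ √(a * hessianTrace φ x) := by
    refine ContinuousLinearMap.opNorm_le_bound _ (Real.sqrt_nonneg _) fun v => ?_
    refine abs_le_of_sq_le_sq' ?_ (by positivity) |>.2
    have hnn : 0 ≤ a * hessianTrace φ x := by
      rw [← trace_hessianMatrix]
      exact le_trans (Finset.sum_nonneg fun j _ => Finset.sum_nonneg fun k _ => sq_nonneg _)
        h.sum_sq_le
    rw [mul_pow, Real.sq_sqrt hnn, ← trace_hessianMatrix]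
    refine le_trans ?_ (mul_le_mul_of_nonneg_right h.sum_sq_le (sq_nonneg ‖v‖))
    rw [EuclideanSpace.real_norm_sq_eq, EuclideanSpace.real_norm_sq_eq, ← hessianMatrix_mulVec,
      Finset.sum_mul]
    refine Finset.sum_le_sum fun j _ => ?_
    exact Finset.sum_mul_sq_le_sq_mul_sq Finset.univ (fun k => hessianMatrix φ x j k)
      fun k => v k
  have ha0 : 0 ≤ a := norm_nonneg _
  rcases ha0.eq_or_lt with h0 | h0
  · have : hessian φ x = 0 := norm_eq_zero.1 (ha ▸ h0.symm)
    rw [← h0, hessianTrace, this]; simp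
  · rw [Real.le_sqrt' h0] at h1
    nlinarith

/-! ### Uniform sampling from a finite population -/

section Sampling

variable {κ : Type*} [Fintype κ] [MeasurableSpace κ] [MeasurableSingletonClass κ]

theorem integral_uniformOn_univ (g : κ → ℝ) :
    ∫ k, g k ∂uniformOn (Set.univ : Set κ) = (∑ k, g k) / Fintype.card κ := by
  rw [uniformOn, ProbabilityTheory.cond, Measure.restrict_univ, integral_smul_measure, integral_count,
    Measure.count_univ]
  simp [div_eq_inv_mul]

variable [Nonempty κ]

/-- The cubic Taylor remainder `(2/9)|x|³` is at most `x²/6` on this range, and `1/2 + 1/6 = 2/3`.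
-/
theorem exp_le_one_add_add_sq {x : ℝ} (hx : |x| ≤ 3 / 4) :
    Real.exp x ≤ 1 + x + 2 / 3 * x ^ 2 := by
  have h := (abs_le.1 (Real.exp_bound (hx.trans (by norm_num)) (n := 3) (by norm_num))).2
  simp [Finset.sum_range_succ, Nat.factorial] at h
  have h1 : |x| ^ 3 ≤ 3 / 4 * x ^ 2 := by
    rw [← sq_abs x, pow_succ']; gcongr
  nlinarith

theorem mgf_uniformOn_le {g : κ → ℝ} {V t : ℝ} (h0 : ∑ k, g k = 0)
    (h2 : (∑ k, g k ^ 2) / Fintype.card κ ≤ V) (ht : ∀ k, |t * g k| ≤ 3 / 4) :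
    mgf g (uniformOn (Set.univ : Set κ)) t ≤ Real.exp (2 / 3 * t ^ 2 * V) := by
  have hc : (0 : ℝ) < Fintype.card κ := by exact_mod_cast Fintype.card_pos
  rw [mgf, integral_uniformOn_univ, div_le_iff₀ hc]
  calc ∑ k, Real.exp (t * g k) ≤ ∑ k, (1 + t * g k + 2 / 3 * t ^ 2 * g k ^ 2) :=
        Finset.sum_le_sum fun k _ => (exp_le_one_add_add_sq (ht k)).trans (le_of_eq (by ring))
    _ = (1 + 2 / 3 * t ^ 2 * ((∑ k, g k ^ 2) / Fintype.card κ)) * Fintype.card κ := by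
        rw [Finset.sum_add_distrib, Finset.sum_add_distrib, ← Finset.mul_sum, h0,
          ← Finset.mul_sum]
        simp
        field_simp
    _ ≤ (1 + 2 / 3 * t ^ 2 * V) * Fintype.card κ := by gcongr
    _ ≤ _ := by
        gcongr
        linarith [Real.add_one_le_exp (2 / 3 * t ^ 2 * V)]

/-- Bernstein bound for sums of i.i.d. uniform samples from a finite population. -/
theorem sampling_tail_le {ℓ : ℕ} {g : κ → ℝ} {V y t : ℝ} (h0 : ∑ k, g k = 0)
    (h2 : (∑ k, g k ^ 2) / Fintype.card κ ≤ V) (ht0 : 0 ≤ t) (ht : ∀ k, |t * g k| ≤ 3 / 4) :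
    (Measure.pi fun _ : Fin ℓ => uniformOn (Set.univ : Set κ)).real
      {k | y ≤ |∑ i, g (k i)|} ≤ 2 * Real.exp (-t * y + ℓ * (2 / 3 * t ^ 2 * V)) := by
  set ν := Measure.pi fun _ : Fin ℓ => uniformOn (Set.univ : Set κ)
  have hint : ∀ f : (Fin ℓ → κ) → ℝ, Integrable f ν := fun f => Integrable.of_finite
  have hone : ∀ {g : κ → ℝ}, ∑ k, g k = 0 → (∑ k, g k ^ 2) / Fintype.card κ ≤ V →
      (∀ k, |t * g k| ≤ 3 / 4) → ν.real {k | y ≤ ∑ i, g (k i)} ≤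
        Real.exp (-t * y + ℓ * (2 / 3 * t ^ 2 * V)) := fun {g} h0 h2 ht => by
    refine (measure_ge_le_exp_mul_mgf (X := fun k => ∑ i, g (k i)) y ht0 (hint _)).trans ?_
    rw [Real.exp_add]
    gcongr
    have h3 : mgf (fun k : Fin ℓ → κ => ∑ i, g (k i)) ν t =
        mgf g (uniformOn (Set.univ : Set κ)) t ^ ℓ := by
      simp only [mgf, Finset.mul_sum, Real.exp_sum]
      rw [integral_fintype_prod_eq_prod (f := fun (_ : Fin ℓ) k => Real.exp (t * g k))]
      simp
    rw [h3, Real.exp_nat_mul]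
    exact pow_le_pow_left₀ mgf_nonneg (mgf_uniformOn_le h0 h2 ht) _
  have hneg := hone (g := fun k => -g k) (by simp [h0]) (by simpa using h2) (by simpa using ht)
  have hpos := hone h0 h2 ht
  calc _ ≤ ν.real ({k | y ≤ ∑ i, g (k i)} ∪ {k | y ≤ ∑ i, -g (k i)}) := by
        refine measureReal_mono fun r hr => ?_
        rcases le_abs.1 (Set.mem_ofPred_eq ▸ hr) with h | h
        · exact Or.inl h
        · exact Or.inr (by simpa using h)
    _ ≤ _ := measureReal_union_le _ _
    _ ≤ _ := by linarith

/-- Chebyshev bound for sums of i.i.d. uniform samples from a finite population. -/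
theorem sampling_chebyshev {ℓ : ℕ} {g : κ → ℝ} {y : ℝ} (hy : 0 < y) (h0 : ∑ k, g k = 0) :
    (Measure.pi fun _ : Fin ℓ => uniformOn (Set.univ : Set κ))
      {k | y ≤ |∑ i, g (k i)|} ≤
      ENNReal.ofReal (ℓ * ((∑ k, g k ^ 2) / Fintype.card κ) / y ^ 2) := by
  set ν := Measure.pi fun _ : Fin ℓ => uniformOn (Set.univ : Set κ)
  have hmean : ∫ k, g k ∂uniformOn (Set.univ : Set κ) = 0 := by simp [integral_uniformOn_univ, h0]
  have hvar : Var[∑ i, fun k : Fin ℓ → κ => g (k i); ν] = ℓ * ((∑ k, g k ^ 2) / Fintype.card κ) := by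
    rw [variance_sum_pi (X := fun _ : Fin ℓ => g) fun i => MemLp.of_discrete]
    simp [variance_eq_integral (Measurable.of_discrete (f := g)).aemeasurable, hmean,
      integral_uniformOn_univ]
  have h1 := meas_ge_le_variance_div_sq (μ := ν) (X := ∑ i, fun k : Fin ℓ → κ => g (k i))
    MemLp.of_discrete hy
  rw [hvar] at h1
  have h2 : ∫ k, (∑ i, fun k : Fin ℓ → κ => g (k i)) k ∂ν = 0 := by
    simp only [Finset.sum_apply]
    rw [integral_finsetSum _ fun i _ => Integrable.of_finite]
    refine Finset.sum_eq_zero fun i _ => ?_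
    rw [← hmean]
    exact integral_comp_eval (μ := fun _ : Fin ℓ => uniformOn (Set.univ : Set κ)) (i := i)
      (f := g) (Measurable.of_discrete).aestronglyMeasurable
  rw [h2] at h1
  simpa using h1

end Sampling

/-! ### Second moment and upper tail of a single sign form -/

theorem two_add_sq_le_exp_add_exp_neg (x : ℝ) : 2 + x ^ 2 ≤ Real.exp x + Real.exp (-x) := by
  have h1 : (x / 2) ^ 2 ≤ Real.sinh (x / 2) ^ 2 := by
    rcases le_total 0 (x / 2) with h | h
    · exact pow_le_pow_left₀ h (Real.self_le_sinh_iff.2 h) 2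
    · nlinarith [Real.sinh_le_self_iff.2 h]
  have h2 : Real.exp x + Real.exp (-x) = 4 * Real.sinh (x / 2) ^ 2 + 2 := by
    have h3 : Real.exp x = Real.exp (x / 2) ^ 2 := by rw [← Real.exp_nat_mul]; congr 1; push_cast; ring
    have h4 : Real.exp (-x) = Real.exp (-(x / 2)) ^ 2 := by
      rw [← Real.exp_nat_mul]; congr 1; push_cast; ring
    have h5 : Real.exp (x / 2) * Real.exp (-(x / 2)) = 1 := by rw [← Real.exp_add]; simp
    rw [Real.sinh_eq, h3, h4]
    linear_combination 2 * h5
  linarith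

/-- The second moment is read off from the generating function at `± 1/(8T)`, by `2 + x² ≤ eˣ +
e⁻ˣ`; there both values are at most `e^(1/48)`. -/
theorem integral_centeredForm_sq_le {ι : Type*} [Fintype ι] {A : Matrix ι ι ℝ}
    (hA : A.SpectralBound A.trace) (hT : 0 < A.trace) :
    ∫ r, centeredForm A r ^ 2 ∂signMeasure ι ≤ 3 * A.trace ^ 2 := by
  set T := A.trace with hTdef
  have hc := continuous_centeredForm A
  set t := 1 / (8 * T) with ht
  have htpos : 0 < t := by positivity
  have hTt : T * t = 1 / 8 := by rw [ht]; field_simp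
  have h1 : (1 / 48 : ℝ) = T * T / (1 - 2 * T * t) * t ^ 2 := by
    rw [show 1 - 2 * T * t = 3 / 4 by linarith]
    linear_combination (-(4 / 3 : ℝ)) * (T * t + 1 / 8) * hTt
  have hm : ∀ s : ℝ, |s| = t → mgf (centeredForm A) (signMeasure ι) s ≤ Real.exp (1 / 48) := by
    intro s hs
    have := mgf_centeredForm_le hA hT (t := s) (by rw [hs]; linarith)
    rwa [hs, ← sq_abs s, hs, ← hTdef, ← h1] at this
  have h2 := hm t (abs_of_pos htpos)
  have h3 := hm (-t) (by rw [abs_neg, abs_of_pos htpos])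
  have h4 : 2 + t ^ 2 * ∫ r, centeredForm A r ^ 2 ∂signMeasure ι ≤
      mgf (centeredForm A) (signMeasure ι) t + mgf (centeredForm A) (signMeasure ι) (-t) := by
    rw [mgf, mgf, ← integral_add (integrable_signMeasure_of_continuous (by fun_prop))
      (integrable_signMeasure_of_continuous (by fun_prop)), ← integral_const_mul]
    have : ∫ r, ((2 : ℝ) + t ^ 2 * centeredForm A r ^ 2) ∂signMeasure ι =
        2 + ∫ r, t ^ 2 * centeredForm A r ^ 2 ∂signMeasure ι := by
      rw [integral_add (integrable_const _) (integrable_signMeasure_of_continuous (by fun_prop))]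
      simp
    rw [← this]
    refine integral_mono (integrable_signMeasure_of_continuous (by fun_prop))
      (integrable_signMeasure_of_continuous (by fun_prop)) fun r => ?_
    have := two_add_sq_le_exp_add_exp_neg (t * centeredForm A r)
    simpa [mul_pow] using this
  have h5 : Real.exp (1 / 48) ≤ 1 + 1 / 48 + 2 / 3 * (1 / 48) ^ 2 :=
    exp_le_one_add_add_sq (by rw [abs_of_pos] <;> norm_num)
  have h6 : T ^ 2 * (64 * t ^ 2) = 1 := by
    linear_combination 64 * (T * t + 1 / 8) * hTt
  have h7 : 64 * t ^ 2 * ∫ r, centeredForm A r ^ 2 ∂signMeasure ι ≤ 3 := by linarith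
  calc ∫ r, centeredForm A r ^ 2 ∂signMeasure ι
      = T ^ 2 * (64 * t ^ 2 * ∫ r, centeredForm A r ^ 2 ∂signMeasure ι) := by
        rw [← mul_assoc, h6, one_mul]
    _ ≤ T ^ 2 * 3 := by gcongr
    _ = _ := by ring

theorem centeredForm_upper_tail_le {ι : Type*} [Fintype ι] {A : Matrix ι ι ℝ}
    (hA : A.SpectralBound A.trace) (hT : 0 < A.trace) (y : ℝ) :
    (signMeasure ι).real {r | y * A.trace ≤ centeredForm A r} ≤
      Real.exp (-(3 / 8 * y) + 9 / 16) := by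
  set T := A.trace with hTdef
  have hc := continuous_centeredForm A
  set t := 3 / (8 * T) with ht
  have htpos : 0 < t := by positivity
  have hTt : T * t = 3 / 8 := by rw [ht]; field_simp
  have h1 := mgf_centeredForm_le hA hT (t := t) (by rw [abs_of_pos htpos]; linarith)
  rw [abs_of_pos htpos, ← hTdef, show 1 - 2 * T * t = 1 / 4 by linarith,
    show T * T / (1 / 4) * t ^ 2 = 9 / 16 by linear_combination 4 * (T * t + 3 / 8) * hTt] at h1
  refine (measure_ge_le_exp_mul_mgf (X := centeredForm A) (y * T) htpos.le
    (integrable_signMeasure_of_continuous (by fun_prop))).trans ?_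
  rw [Real.exp_add, show -t * (y * T) = -(3 / 8 * y) by linear_combination (-y) * hTt]
  gcongr

/-! ### The SRHT case -/

section SRHT

/-- Checked on the dyadic ranges `2^-(n+1) ≤ δ ≤ 2^-n` for `n ≤ 4`, using `r ≥ (n + 1) log 2` on
each. -/
theorem srht_chebyshev_numeric {δ r R : ℝ} (hδ : 1 / 32 ≤ δ) (hδ₁ : δ < 1)
    (hr : r = Real.log (2 / δ)) (hR : 8 * r + 5 ≤ R) : 3 / (R * r) ≤ δ := by
  have hδ0 : 0 < δ := by linarith
  have hlog2 := Real.log_two_gt_d9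
  have hmono : ∀ n : ℕ, δ ≤ (1 / 2) ^ n → (n + 1) * 0.693 ≤ r := fun n hn => by
    have h1 : (2 : ℝ) ^ (n + 1) ≤ 2 / δ := by
      rw [le_div_iff₀ hδ0]
      calc (2 : ℝ) ^ (n + 1) * δ ≤ 2 ^ (n + 1) * (1 / 2) ^ n := by gcongr
        _ = 2 := by rw [pow_succ, mul_right_comm, ← mul_pow]; norm_num
    have h2 := Real.log_le_log (by positivity) h1
    rw [Real.log_pow, ← hr] at h2
    push_cast at h2
    have : (0 : ℝ) ≤ n := Nat.cast_nonneg n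
    nlinarith
  have hr0 := hmono 0 (by simpa using hδ₁.le)
  norm_num at hr0
  have key : 3 ≤ δ * ((8 * r + 5) * r) → 3 / (R * r) ≤ δ := fun h => by
    rw [div_le_iff₀ (by apply mul_pos <;> linarith)]
    refine h.trans ?_
    gcongr
  have chunk : ∀ n : ℕ, δ ≤ (1 / 2) ^ n → (1 / 2) ^ (n + 1) ≤ δ →
      3 * 2 ^ (n + 1) ≤ (8 * ((n + 1) * 0.693) + 5) * ((n + 1) * (0.693 : ℝ)) →
      3 / (R * r) ≤ δ := fun n h1 h2 h3 => by
    have h4 := hmono n h1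
    refine key ?_
    have h5 : (8 * ((n + 1) * 0.693) + 5) * ((n + 1) * (0.693 : ℝ)) ≤ (8 * r + 5) * r := by
      gcongr
    calc (3 : ℝ) = (1 / 2) ^ (n + 1) * (3 * 2 ^ (n + 1)) := by
          rw [mul_left_comm, ← mul_pow]; norm_num
      _ ≤ δ * ((8 * r + 5) * r) := by
          exact mul_le_mul h2 (h3.trans h5) (by positivity) hδ0.le
  rcases le_total (1 / 2) δ with h | h
  · exact chunk 0 (by norm_num; linarith) (by norm_num; linarith) (by norm_num)
  rcases le_total (1 / 4) δ with h' | h'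
  · exact chunk 1 (by norm_num; linarith) (by norm_num; linarith) (by norm_num)
  rcases le_total (1 / 8) δ with h | h
  · exact chunk 2 (by norm_num; linarith) (by norm_num; linarith) (by norm_num)
  rcases le_total (1 / 16) δ with h' | h'
  · exact chunk 3 (by norm_num; linarith) (by norm_num; linarith) (by norm_num)
  · exact chunk 4 (by norm_num; linarith) (by norm_num; linarith) (by norm_num)

/-- For `δ < 1/32` the square root in `R` gives `R/8 ≥ L + 1.525`, which absorbs the constants of
the union bound. Each of the two exponentials is then at most `0.62 · δ/2`, the second counted
twice: `0.93 δ` in all. -/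
theorem srht_chernoff_numeric {δ r L R D : ℝ} (hδ₀ : 0 < δ) (hδ : δ < 1 / 32)
    (hr : r = Real.log (2 / δ)) (hD : 1 ≤ D) (hL : L = Real.log (2 * D / δ))
    (hR : R = (1 + √(8 * L)) ^ 2) :
    D * Real.exp (-(3 / 8 * (R / 3 - 1)) + 9 / 16) + 2 * Real.exp (-(9 / 8 * r)) ≤ δ := by
  have hlog2 := Real.log_two_gt_d9
  have hr4 : 4 ≤ r := by
    have h1 : (2 : ℝ) ^ 6 ≤ 2 / δ := by rw [le_div_iff₀ hδ₀]; linarith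
    have h2 := Real.log_le_log (by positivity) h1
    rw [Real.log_pow, ← hr] at h2
    push_cast at h2
    linarith
  have hrL : r ≤ L := by
    rw [hr, hL]
    exact Real.log_le_log (by positivity) (by gcongr; linarith)
  have hexpr : Real.exp (-r) = δ / 2 := by
    rw [hr, ← Real.log_inv, Real.exp_log (by positivity), inv_div]
  have hexpL : D * Real.exp (-L) = δ / 2 := by
    rw [hL, ← Real.log_inv, Real.exp_log (by positivity), inv_div]
    field_simp
  have hsq : 5.6 ≤ √(8 * L) := Real.le_sqrt_of_sq_le (by norm_num; linarith)
  have hRle : L + 1.525 ≤ R / 8 := by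
    rw [hR, add_sq, Real.sq_sqrt (by linarith)]
    linarith
  have hsmall : ∀ x : ℝ, 0.5 ≤ x → Real.exp (-x) ≤ 0.62 := fun x hx => by
    have h1 := Real.quadratic_le_exp_of_nonneg (show (0 : ℝ) ≤ 0.5 by norm_num)
    have h2 : Real.exp (-x) ≤ Real.exp (-0.5) := Real.exp_le_exp.2 (by linarith)
    rw [Real.exp_neg 0.5] at h2
    refine h2.trans (inv_le_of_inv_le₀ (by norm_num) (le_trans (by norm_num) h1))
  have h1 : D * Real.exp (-(3 / 8 * (R / 3 - 1)) + 9 / 16) ≤ δ / 2 * 0.62 := by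
    have : Real.exp (-(3 / 8 * (R / 3 - 1)) + 9 / 16) ≤ Real.exp (-L) * Real.exp (-0.58) := by
      rw [← Real.exp_add]
      exact Real.exp_le_exp.2 (by linarith)
    calc _ ≤ D * (Real.exp (-L) * Real.exp (-0.58)) := by gcongr
      _ = δ / 2 * Real.exp (-0.58) := by rw [← mul_assoc, hexpL]
      _ ≤ _ := by gcongr; exact hsmall _ (by norm_num)
  have h2 : Real.exp (-(9 / 8 * r)) ≤ δ / 2 * 0.62 := by
    rw [show -(9 / 8 * r) = -r + -(r / 8) by ring, Real.exp_add, hexpr]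
    gcongr
    exact hsmall _ (by linarith)
  linarith

variable {m ℓ : ℕ}

/-- The law of the signs and of the sampled indices of an SRHT matrix. -/
noncomputable abbrev srhtMeasure (m ℓ : ℕ) : Measure ((Fin (2 ^ m) → ℝ) × (Fin ℓ → Fin (2 ^ m))) :=
  (signMeasure (Fin (2 ^ m))).prod
    (Measure.pi fun _ : Fin ℓ => uniformOn (Set.univ : Set (Fin (2 ^ m))))

/-- The quadratic form at the `k`-th row of the randomised Walsh-Hadamard matrix. -/
noncomputable def walshForm (A : Matrix (Fin (2 ^ m)) (Fin (2 ^ m)) ℝ) (s : Fin (2 ^ m) → ℝ)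
    (k : Fin (2 ^ m)) : ℝ :=
  centeredForm A (fun j => walshHadamard m k j * s j)

theorem continuous_walshForm (A : Matrix (Fin (2 ^ m)) (Fin (2 ^ m)) ℝ) (k : Fin (2 ^ m)) :
    Continuous fun s => walshForm A s k :=
  (continuous_centeredForm A).comp (by fun_prop)

theorem measurableSet_walshForm (A : Matrix (Fin (2 ^ m)) (Fin (2 ^ m)) ℝ) (y : ℝ) :
    MeasurableSet {q : (Fin (2 ^ m) → ℝ) × (Fin ℓ → Fin (2 ^ m)) |
      y ≤ |∑ i, walshForm A q.1 (q.2 i)|} := by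
  refine measurableSet_le measurable_const (Measurable.abs ?_)
  refine measurable_from_prod_countable_left fun k => ?_
  exact (continuous_finsetSum _ fun i _ => continuous_walshForm A (k i)).measurable

/-- The rows are dependent, but each alone is a sign vector with the original law. -/
theorem walshForm_integral_comp {A : Matrix (Fin (2 ^ m)) (Fin (2 ^ m)) ℝ} {g : ℝ → ℝ}
    (hg : Continuous g) (k : Fin (2 ^ m)) :
    ∫ s, g (walshForm A s k) ∂signMeasure (Fin (2 ^ m)) =
      ∫ s, g (centeredForm A s) ∂signMeasure (Fin (2 ^ m)) := by
  have h := measurePreserving_sign_mul (walshHadamard_sq_eq_one m k)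
  have := integral_map (μ := signMeasure (Fin (2 ^ m))) h.measurable.aemeasurable
    (f := fun s => g (centeredForm A s))
    (hg.comp (continuous_centeredForm A)).aestronglyMeasurable
  rw [h.map_eq] at this
  exact this.symm

/-- Chebyshev conditionally on the signs; the conditional variance is then averaged, row by row,
over the signs. -/
theorem srht_chebyshev {A : Matrix (Fin (2 ^ m)) (Fin (2 ^ m)) ℝ}
    (hA : A.SpectralBound A.trace) (hT : 0 < A.trace) {ε : ℝ} (hε : 0 < ε) (hℓ : 0 < ℓ) :
    srhtMeasure m ℓ {q | ε * A.trace * ℓ ≤ |∑ i, walshForm A q.1 (q.2 i)|} ≤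
      ENNReal.ofReal (3 / (ε ^ 2 * ℓ)) := by
  have hℓ' : (0 : ℝ) < ℓ := by exact_mod_cast hℓ
  rw [Measure.prod_apply (measurableSet_walshForm A _)]
  set c : ℝ := ε * A.trace * ℓ with hc
  have hcpos : 0 < c := by positivity
  have hw := continuous_walshForm A
  calc _ ≤ ∫⁻ s, ENNReal.ofReal (ℓ * ((∑ k, walshForm A s k ^ 2) / Fintype.card (Fin (2 ^ m))) /
        c ^ 2) ∂signMeasure (Fin (2 ^ m)) := by
        refine lintegral_mono_ae ?_
        filter_upwards [ae_signMeasure_sq_eq_one (ι := Fin (2 ^ m))] with s hs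
        exact sampling_chebyshev hcpos (sum_centeredForm_walshHadamard A hs)
    _ = ENNReal.ofReal (∫ s, ℓ * ((∑ k, walshForm A s k ^ 2) / Fintype.card (Fin (2 ^ m))) /
        c ^ 2 ∂signMeasure (Fin (2 ^ m))) := by
        refine (ofReal_integral_eq_lintegral_ofReal
          (integrable_signMeasure_of_continuous ?_) ?_).symm
        · fun_prop
        · exact Filter.Eventually.of_forall fun s => by
            have : 0 ≤ ∑ k, walshForm A s k ^ 2 := Finset.sum_nonneg fun k _ => sq_nonneg _
            positivity
    _ ≤ _ := by
        refine ENNReal.ofReal_le_ofReal ?_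
        rw [integral_div, integral_const_mul, integral_div, integral_finsetSum _ fun k _ =>
          integrable_signMeasure_of_continuous (by fun_prop)]
        simp_rw [walshForm_integral_comp (g := fun x => x ^ 2) (continuous_pow 2)]
        rw [Finset.sum_const, nsmul_eq_mul, Finset.card_univ, mul_div_cancel_left₀ _ (by simp)]
        calc _ ≤ ℓ * (3 * A.trace ^ 2) / c ^ 2 := by
              gcongr
              exact integral_centeredForm_sq_le hA hT
          _ = _ := by rw [hc]; field_simp

/-- Average `(g + T)(b - g) ≥ 0` and use mean zero (Bhatia–Davis). -/
theorem sampling_variance_le {κ : Type*} [Fintype κ] [Nonempty κ] {g : κ → ℝ} {T b : ℝ}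
    (h0 : ∑ k, g k = 0) (hlo : ∀ k, -T ≤ g k) (hhi : ∀ k, g k ≤ b) :
    (∑ k, g k ^ 2) / Fintype.card κ ≤ b * T := by
  have hc : (0 : ℝ) < Fintype.card κ := by exact_mod_cast Fintype.card_pos
  rw [div_le_iff₀ hc]
  calc ∑ k, g k ^ 2 ≤ ∑ k, ((b - T) * g k + b * T) := Finset.sum_le_sum fun k _ => by
        nlinarith [mul_nonneg (sub_nonneg.2 (hlo k)) (sub_nonneg.2 (hhi k))]
    _ = _ := by
        rw [Finset.sum_add_distrib, ← Finset.mul_sum, h0]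
        simp [mul_comm]

/-- Outside a bad set of signs every row form lies in `[-T, (R - 1)T]`; there the variance is at
most `R T²` and Bernstein applies conditionally. -/
theorem srht_chernoff {A : Matrix (Fin (2 ^ m)) (Fin (2 ^ m)) ℝ}
    (hA : A.SpectralBound A.trace) (hT : 0 < A.trace) {ε : ℝ} (hε : 0 < ε) (hε₁ : ε < 1)
    {R : ℝ} (hR : 2 ≤ R) :
    srhtMeasure m ℓ {q | ε * A.trace * ℓ ≤ |∑ i, walshForm A q.1 (q.2 i)|} ≤
      ENNReal.ofReal (2 ^ m * Real.exp (-(3 / 8 * (R - 1)) + 9 / 16) +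
        2 * Real.exp (-(3 / 8 * (ε ^ 2 * ℓ / R)))) := by
  rw [Measure.prod_apply (measurableSet_walshForm A _)]
  set T := A.trace with hTdef
  have hw := continuous_walshForm A
  set bad : Set (Fin (2 ^ m) → ℝ) := ⋃ k, {s | (R - 1) * T ≤ walshForm A s k} with hbad
  have hbadm : MeasurableSet bad := MeasurableSet.iUnion fun k =>
    measurableSet_le measurable_const (hw k).measurable
  have hbadle : signMeasure (Fin (2 ^ m)) bad ≤
      ENNReal.ofReal (2 ^ m * Real.exp (-(3 / 8 * (R - 1)) + 9 / 16)) := by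
    refine (measure_iUnion_fintype_le _ _).trans ?_
    have h1 : ∀ k, signMeasure (Fin (2 ^ m)) {s | (R - 1) * T ≤ walshForm A s k} ≤
        ENNReal.ofReal (Real.exp (-(3 / 8 * (R - 1)) + 9 / 16)) := fun k => by
      have h := measurePreserving_sign_mul (walshHadamard_sq_eq_one m k)
      have h2 := h.measure_preimage (s := {s | (R - 1) * T ≤ centeredForm A s})
        (measurableSet_le measurable_const (continuous_centeredForm A).measurable).nullMeasurableSet
      change signMeasure (Fin (2 ^ m)) {s | (R - 1) * T ≤ walshForm A s k} = _ at h2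
      rw [h2, ← ofReal_measureReal]
      exact ENNReal.ofReal_le_ofReal (centeredForm_upper_tail_le hA hT (R - 1))
    refine (Finset.sum_le_sum fun k _ => h1 k).trans (le_of_eq ?_)
    rw [Finset.sum_const, Finset.card_univ, Fintype.card_fin, nsmul_eq_mul,
      ENNReal.ofReal_mul (by positivity)]
    congr 1
    rw [ENNReal.ofReal_pow (by norm_num)]
    simp
  set e := ENNReal.ofReal (2 * Real.exp (-(3 / 8 * (ε ^ 2 * ℓ / R)))) with he
  have hpt : ∀ᵐ s ∂signMeasure (Fin (2 ^ m)),
      (Measure.pi fun _ : Fin ℓ => uniformOn (Set.univ : Set (Fin (2 ^ m))))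
        (Prod.mk s ⁻¹' {q | ε * T * ℓ ≤ |∑ i, walshForm A q.1 (q.2 i)|}) ≤
      bad.indicator 1 s + e := by
    filter_upwards [ae_signMeasure_sq_eq_one (ι := Fin (2 ^ m))] with s hs
    by_cases hsb : s ∈ bad
    · rw [Set.indicator_of_mem hsb]
      exact prob_le_one.trans le_self_add
    · rw [Set.indicator_of_notMem hsb, zero_add]
      have hhi : ∀ k, walshForm A s k ≤ (R - 1) * T := fun k => by
        by_contra hn
        push Not at hn
        exact hsb (Set.mem_iUnion.2 ⟨k, hn.le⟩)
      have hlo : ∀ k, -T ≤ walshForm A s k := fun k => by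
        have := hA.quadratic_nonneg hT (fun j => walshHadamard m k j * s j)
        rw [walshForm, centeredForm]
        linarith
      have h0 := sum_centeredForm_walshHadamard A hs
      -- It minimises `-t ε T ℓ + (2/3) ℓ t² R T²`, and `ε < 1` keeps `|t g| ≤ 3/4`.
      set t := 3 * ε / (4 * (R * T)) with ht
      have htpos : 0 < t := by positivity
      have hRT : t * (R * T) = 3 / 4 * ε := by rw [ht]; field_simp
      have htb : ∀ k, |t * walshForm A s k| ≤ 3 / 4 := fun k => by
        have h1 : |walshForm A s k| ≤ R * T := abs_le.2 ⟨by nlinarith [hlo k], by nlinarith [hhi k]⟩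
        rw [abs_mul, abs_of_pos htpos]
        calc t * |walshForm A s k| ≤ t * (R * T) := by gcongr
          _ ≤ 3 / 4 := by rw [hRT]; linarith
      have hV : (∑ k, walshForm A s k ^ 2) / Fintype.card (Fin (2 ^ m)) ≤ R * T * T :=
        (sampling_variance_le h0 hlo hhi).trans (by nlinarith)
      have h2 := sampling_tail_le (ℓ := ℓ) (y := ε * T * ℓ) h0 hV htpos.le htb
      have h3 : -t * (ε * T * ℓ) + ℓ * (2 / 3 * t ^ 2 * (R * T * T)) =
          -(3 / 8 * (ε ^ 2 * ℓ / R)) := by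
        rw [ht]; field_simp; ring
      rw [h3] at h2
      rw [he, ← ofReal_measureReal]
      exact ENNReal.ofReal_le_ofReal h2
  refine (lintegral_mono_ae hpt).trans ?_
  rw [lintegral_add_right _ measurable_const, lintegral_indicator_one hbadm, lintegral_const,
    measure_univ, mul_one, ENNReal.ofReal_add (by positivity) (by positivity)]
  gcongr

theorem srht_sketch_entry {d : ℕ} (hm : 2 ^ m = d) (hℓ : 0 < ℓ) {s : Fin d → ℝ}
    {k : Fin ℓ → Fin d} {S : Matrix (Fin d) (Fin ℓ) ℝ}
    (h : S.transpose = (1 / √(ℓ : ℝ)) • (samplingMatrix k *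
      Matrix.reindex (finCongr hm) (finCongr hm) (walshHadamard m) * Matrix.diagonal s))
    (j : Fin d) (i : Fin ℓ) :
    S j i * √(ℓ : ℝ) =
      Matrix.reindex (finCongr hm) (finCongr hm) (walshHadamard m) (k i) j * s j := by
  have hℓ' : √(ℓ : ℝ) ≠ 0 := (Real.sqrt_pos.2 (by exact_mod_cast hℓ)).ne'
  have h1 := congrFun (congrFun h i) j
  rw [Matrix.transpose_apply, Matrix.smul_apply, Matrix.mul_diagonal, Matrix.mul_apply] at h1
  simp only [samplingMatrix, Matrix.of_apply, ite_mul, one_mul, zero_mul, Finset.sum_ite_eq,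
    Finset.mem_univ, if_true] at h1
  rw [h1, smul_eq_mul]
  field_simp

theorem srht_sketch_bounds {d : ℕ} {Ω : Type*} [MeasurableSpace Ω] {P : Measure Ω}
    [IsProbabilityMeasure P] {S : Ω → Matrix (Fin d) (Fin ℓ) ℝ}
    {φ f : EuclideanSpace ℝ (Fin d) → ℝ} {x : EuclideanSpace ℝ (Fin d)}
    {α σ Lhat ε δ : ℝ} (hα : 0 < α) (hε₀ : 0 < ε) (hε₁ : ε < 1) (hδ₀ : 0 < δ) (hδ₁ : δ < 1)
    (hconv : ConvexOn ℝ Set.univ φ) (hdiff : Differentiable ℝ φ)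
    (hdiff₂ : Differentiable ℝ (∇ φ)) (hnoise : ∀ y, |f y - φ y| ≤ σ)
    (hLip : ∀ y z, ‖hessian φ y - hessian φ z‖ ≤ Lhat * ‖y - z‖)
    (hS : IsSRHTSketch P S)
    (hℓ : (1 + √(8 * Real.log (2 * d / δ))) ^ 2 * ε⁻¹ ^ 2 * Real.log (2 / δ) ≤ (ℓ : ℝ)) :
    P {ω | ¬ |traceEstimator f α x (S ω) - hessianTrace φ x| ≤
        ε * hessianTrace φ x + Lhat * sumCubeNorms (S ω) / 3 * α + 4 * ℓ * σ / α ^ 2}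
      ≤ ENNReal.ofReal δ ∧
    ∀ᵐ ω ∂P, sumCubeNorms (S ω) ≤ (d : ℝ) ^ (3 / 2 : ℝ) * (ℓ : ℝ) ^ (-(1 / 2) : ℝ) := by
  obtain ⟨m, hm, s, k, hs, hsind, hk, hkind, hsk, hSω⟩ := hS
  subst hm
  have hD : (1 : ℝ) ≤ ((2 ^ m : ℕ) : ℝ) := by exact_mod_cast Nat.one_le_two_pow
  set r := Real.log (2 / δ) with hr
  set L := Real.log (2 * ((2 ^ m : ℕ) : ℝ) / δ) with hL
  set R := (1 + √(8 * L)) ^ 2 with hR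
  have hlog2 := Real.log_two_gt_d9
  have hr0 : 0.69 ≤ r := by
    have : Real.log 2 ≤ r := Real.log_le_log (by norm_num) (by rw [le_div_iff₀ hδ₀]; linarith)
    linarith
  have hrL : r ≤ L := Real.log_le_log (by positivity) (by gcongr; linarith)
  have hsq : 2 ≤ √(8 * L) := Real.le_sqrt_of_sq_le (by norm_num; linarith)
  have hR5 : 8 * r + 5 ≤ R := by
    rw [hR, add_sq, Real.sq_sqrt (by linarith)]
    linarith
  have hRr : R * r ≤ ε ^ 2 * ℓ := by
    calc R * r = ε ^ 2 * (R * ε⁻¹ ^ 2 * r) := by field_simp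
      _ ≤ ε ^ 2 * ℓ := by gcongr
  have hℓ' : (0 : ℝ) < ℓ := by
    have : 0 < R * r := by apply mul_pos <;> linarith
    exact (mul_pos_iff_of_pos_left (by positivity)).1 (this.trans_le hRr)
  have hℓn : 0 < ℓ := by exact_mod_cast hℓ'
  have hentry : ∀ ω j i, S ω j i * √(ℓ : ℝ) = walshHadamard m (k i ω) j * s j ω := fun ω j i => by
    simpa using srht_sketch_entry rfl hℓn (hSω ω) j i
  have hslaw : HasLaw (fun ω j => s j ω) (signMeasure (Fin (2 ^ m))) P := hsind.hasLaw_pi hs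
  have hklaw : HasLaw (fun ω i => k i ω)
      (Measure.pi fun _ : Fin ℓ => uniformOn (Set.univ : Set (Fin (2 ^ m)))) P :=
    hkind.hasLaw_pi hk
  have hlaw : HasLaw (fun ω => (fun j => s j ω, fun i => k i ω)) (srhtMeasure m ℓ) P :=
    (indepFun_iff_hasLaw_prodMk_prod hslaw hklaw).1 hsk
  constructor
  · have hA := hessianMatrix_spectralBound hconv hdiff hdiff₂ hLip x
    have haT := norm_hessian_le_hessianTrace hA
    set A := hessianMatrix φ x with hAdef
    have hform : ∀ ω, centeredForm (A ⊗ₖ (1 : Matrix (Fin ℓ) (Fin ℓ) ℝ))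
        (fun p => S ω p.1 p.2 * √(ℓ : ℝ)) = ∑ i, walshForm A (fun j => s j ω) (k i ω) :=
      fun ω => by
        rw [centeredForm_kronecker_one]
        simp only [hentry, walshForm]
    have htr : (A ⊗ₖ (1 : Matrix (Fin ℓ) (Fin ℓ) ℝ)).trace = A.trace * ℓ := by
      rw [Matrix.trace_kronecker, Matrix.trace_one, Fintype.card_fin]
    rcases (norm_nonneg (hessian φ x)).eq_or_lt with ha | ha
    -- Positivity of the trace is not assumed for SRHT. If the Hessian vanishes, failure would mean
    -- `0 < 0`; otherwise the trace is positive because it dominates the norm.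
    · have hH : hessian φ x = 0 := norm_eq_zero.1 ha.symm
      have hA0 : A = 0 := by rw [hAdef, hessianMatrix, hH]; simp
      refine (measure_mono_null (t := ∅) (fun ω hω => ?_) measure_empty).le.trans zero_le
      have h1 := le_abs_centeredForm_of_not_le hdiff hdiff₂ hnoise hLip hα hℓn hω
      rw [← hAdef, hA0] at h1
      simp [centeredForm] at h1
    have hT : 0 < A.trace := by rw [trace_hessianMatrix]; linarith
    have hAT : A.SpectralBound A.trace := hA.mono ha (by rwa [trace_hessianMatrix])
    have hmain : srhtMeasure m ℓ {q | ε * A.trace * ℓ ≤ |∑ i, walshForm A q.1 (q.2 i)|} ≤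
        ENNReal.ofReal δ := by
      rcases le_or_gt (1 / 32) δ with hδ | hδ
      · refine (srht_chebyshev hAT hT hε₀ hℓn).trans (ENNReal.ofReal_le_ofReal ?_)
        refine le_trans ?_ (srht_chebyshev_numeric hδ hδ₁ hr hR5)
        have : 0 < R * r := by apply mul_pos <;> linarith
        gcongr
      -- The cap `R / 3` splits the budget: the union bound keeps exponent `R/8`, which exceeds `L`,
      -- while Bernstein gets `(9/8) r`.
      · refine (srht_chernoff hAT hT hε₀ hε₁ (R := R / 3) ?_).trans
          (ENNReal.ofReal_le_ofReal ?_)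
        · linarith
        · refine le_trans ?_ (srht_chernoff_numeric hδ₀ hδ hr hD hL hR)
          push_cast
          refine add_le_add le_rfl (mul_le_mul_of_nonneg_left (Real.exp_le_exp.2
            (neg_le_neg ?_)) zero_le_two)
          have hR0 : 0 < R := by linarith
          rw [div_div_eq_mul_div, mul_div_assoc', le_div_iff₀ hR0]
          linarith
    refine (measure_mono fun ω hω => ?_).trans
      ((hlaw.measure_eq (measurableSet_walshForm A _)).le.trans hmain)
    have h1 := (le_abs_centeredForm_of_not_le hdiff hdiff₂ hnoise hLip hα hℓn hω).le
    rw [hform, htr, ← mul_assoc] at h1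
    exact h1
  · have hsq : ∀ᵐ ω ∂P, ∀ j, s j ω ^ 2 = 1 :=
      (hslaw.ae_iff (p := fun s => ∀ j, s j ^ 2 = 1) (by fun_prop)).2 ae_signMeasure_sq_eq_one
    filter_upwards [hsq] with ω hω
    refine (sumCubeNorms_eq_of_sq_eq fun j i => ?_).le
    have h1 : (S ω j i * √(ℓ : ℝ)) ^ 2 = 1 := by
      rw [hentry, mul_pow, walshHadamard_sq_eq_one, hω, one_mul]
    rw [mul_pow, Real.sq_sqrt hℓ'.le] at h1
    field_simp
    linarith

end SRHT

/-! ### Weighted chi-square variables: moments and tails -/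

section ChiSquare

theorem integral_exp_mul_sq_gaussianReal {u : ℝ} (hu : u < 1 / 2) :
    ∫ z, Real.exp (u * z ^ 2) ∂gaussianReal 0 1 = Real.exp (-(1 / 2) * Real.log (1 - 2 * u)) := by
  rw [integral_gaussianReal_eq_integral_smul one_ne_zero]
  have h1 : ∀ z : ℝ, gaussianPDFReal 0 1 z • Real.exp (u * z ^ 2) =
      (√(2 * Real.pi))⁻¹ * Real.exp (-(1 / 2 - u) * z ^ 2) := fun z => by
    rw [gaussianPDFReal_def, smul_eq_mul, mul_assoc, ← Real.exp_add]
    simp only [NNReal.coe_one, mul_one, sub_zero]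
    congr 2
    ring
  simp_rw [h1]
  rw [integral_const_mul, integral_gaussian, ← Real.sqrt_inv, ← Real.sqrt_mul (by positivity)]
  have h2 : (2 * Real.pi)⁻¹ * (Real.pi / (1 / 2 - u)) = (1 - 2 * u)⁻¹ := by
    have : 1 - 2 * u ≠ 0 := by linarith
    have : 1 / 2 - u ≠ 0 := by linarith
    field_simp
  have h3 : 0 < 1 - 2 * u := by linarith
  rw [h2, Real.sqrt_eq_rpow, Real.rpow_def_of_pos (by positivity), Real.log_inv]
  congr 1; ring

/-- The law of a vector of independent standard Gaussian variables. -/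
noncomputable abbrev gaussianMeasure (ι : Type*) [Fintype ι] : Measure (ι → ℝ) :=
  Measure.pi fun _ : ι => gaussianReal 0 1

variable {ι : Type*} [Fintype ι]

theorem mgf_weighted_sum_sq {w : ι → ℝ} {t : ℝ} (ht : ∀ p, t * w p < 1 / 2) :
    mgf (fun z => ∑ p, w p * z p ^ 2) (gaussianMeasure ι) t =
      Real.exp (∑ p, -(1 / 2) * Real.log (1 - 2 * (t * w p))) := by
  simp only [mgf, Finset.mul_sum, Real.exp_sum]
  rw [integral_fintype_prod_eq_prod (f := fun p z => Real.exp (t * (w p * z ^ 2)))]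
  refine Finset.prod_congr rfl fun p _ => ?_
  rw [← integral_exp_mul_sq_gaussianReal (ht p)]
  simp only [mul_assoc]

/-- A non-integrable function has Bochner integral `0`, so a nonzero generating function already
certifies integrability. -/
theorem integrable_exp_of_mgf_eq_exp {Ω : Type*} [MeasurableSpace Ω] {μ : Measure Ω} {X : Ω → ℝ}
    {t c : ℝ} (h : mgf X μ t = Real.exp c) : Integrable (fun ω => Real.exp (t * X ω)) μ :=
  Integrable.of_integral_ne_zero (by rw [← mgf, h]; exact (Real.exp_pos c).ne')

/-- The moments of a random variable with the moment generating function of a chi-square law. -/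
theorem integral_pow_mul_exp_of_mgf {Ω : Type*} [MeasurableSpace Ω] {μ : Measure Ω} {X : Ω → ℝ}
    {c : ℝ} (h : ∀ t < 1 / 2, mgf X μ t = Real.exp (-c * Real.log (1 - 2 * t))) (n : ℕ) :
    ∀ t < 1 / 2, ∫ ω, X ω ^ n * Real.exp (t * X ω) ∂μ =
      (∏ k ∈ Finset.range n, (2 * (c + k))) * Real.exp (-(c + n) * Real.log (1 - 2 * t)) := by
  have hint : ∀ t < 1 / 2, t ∈ interior (integrableExpSet X μ) := fun t ht =>
    mem_interior.2 ⟨Set.Iio (1 / 2), fun s hs => integrable_exp_of_mgf_eq_exp (h s hs),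
      isOpen_Iio, ht⟩
  induction n with
  | zero => intro t ht; simpa [mgf] using h t ht
  | succ n ih =>
    intro t ht
    have h1 := hasDerivAt_integral_pow_mul_exp_real (hint t ht) n
    have hpos : 0 < 1 - 2 * t := by linarith
    have h2 : HasDerivAt (fun t : ℝ => (∏ k ∈ Finset.range n, (2 * (c + k))) *
        Real.exp (-(c + n) * Real.log (1 - 2 * t)))
        ((∏ k ∈ Finset.range n, (2 * (c + k))) * (Real.exp (-(c + n) * Real.log (1 - 2 * t)) *
          (-(c + n) * (-(2 * 1) / (1 - 2 * t))))) t :=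
      ((((((hasDerivAt_id t).const_mul 2).const_sub 1).log hpos.ne').const_mul _).exp).const_mul _
    have h3 : (fun t : ℝ => (∏ k ∈ Finset.range n, (2 * (c + k))) *
        Real.exp (-(c + n) * Real.log (1 - 2 * t))) =ᶠ[nhds t]
        fun t => ∫ ω, X ω ^ n * Real.exp (t * X ω) ∂μ := by
      filter_upwards [Iio_mem_nhds ht] with s hs using (ih s hs).symm
    -- The next moment is the derivative of the current one; equate the derivative under the
    -- integral with that of the closed form.
    rw [h1.unique (h2.congr_of_eventuallyEq h3.symm), Finset.prod_range_succ]
    have h4 : Real.exp (-(c + (n + 1 : ℕ)) * Real.log (1 - 2 * t)) =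
        Real.exp (-(c + n) * Real.log (1 - 2 * t)) / (1 - 2 * t) := by
      rw [eq_div_iff hpos.ne', ← Real.exp_log hpos, Real.log_exp, ← Real.exp_add]
      congr 1; push_cast; ring
    rw [h4]
    ring

theorem zero_mem_interior_integrableExpSet_of_mgf {Ω : Type*} [MeasurableSpace Ω] {μ : Measure Ω}
    {X : Ω → ℝ} {c : ℝ} (h : ∀ t < 1 / 2, mgf X μ t = Real.exp (-c * Real.log (1 - 2 * t))) :
    0 ∈ interior (integrableExpSet X μ) :=
  mem_interior.2 ⟨Set.Iio (1 / 2), fun s hs => integrable_exp_of_mgf_eq_exp (h s hs),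
      isOpen_Iio, by norm_num⟩

theorem integral_pow_of_mgf {Ω : Type*} [MeasurableSpace Ω] {μ : Measure Ω} {X : Ω → ℝ}
    {c : ℝ} (h : ∀ t < 1 / 2, mgf X μ t = Real.exp (-c * Real.log (1 - 2 * t))) (n : ℕ) :
    ∫ ω, X ω ^ n ∂μ = ∏ k ∈ Finset.range n, (2 * (c + k)) := by
  simpa using integral_pow_mul_exp_of_mgf h n 0 (by norm_num)

theorem mgf_sq_gaussianReal {t : ℝ} (ht : t < 1 / 2) :
    mgf (fun z => z ^ 2) (gaussianReal 0 1) t = Real.exp (-(1 / 2) * Real.log (1 - 2 * t)) :=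
  integral_exp_mul_sq_gaussianReal ht

theorem variance_sq_gaussianReal : Var[fun z => z ^ 2; gaussianReal 0 1] = 2 := by
  have h1 := integral_pow_of_mgf (fun t ht => mgf_sq_gaussianReal ht) 1
  have h2 := integral_pow_of_mgf (fun t ht => mgf_sq_gaussianReal ht) 2
  simp only [Finset.prod_range_succ, Finset.prod_range_zero] at h1 h2
  norm_num at h1 h2
  have hm : MemLp (fun z : ℝ => z ^ 2) 2 (gaussianReal 0 1) := by
    exact_mod_cast memLp_of_mem_interior_integrableExpSet
      (zero_mem_interior_integrableExpSet_of_mgf fun t ht => mgf_sq_gaussianReal ht) 2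
  rw [variance_eq_sub hm]
  simp only [Pi.pow_apply]
  rw [h2, h1]
  norm_num

theorem integral_sq_gaussianReal : ∫ z, z ^ 2 ∂gaussianReal 0 1 = 1 := by
  simpa using integral_pow_of_mgf (fun t ht => mgf_sq_gaussianReal ht) 1

theorem memLp_sq_gaussianReal : MemLp (fun z : ℝ => z ^ 2) 2 (gaussianReal 0 1) := by
  exact_mod_cast memLp_of_mem_interior_integrableExpSet
    (zero_mem_interior_integrableExpSet_of_mgf fun t ht => mgf_sq_gaussianReal ht) 2

/-- The difference vanishes at `0`, increases up to `c` and decreases afterwards, so only the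
endpoint `1` matters, where `0.305 < 1 - log 2`. -/
theorem log_one_add_le_sub_sq {ε : ℝ} (h0 : 0 ≤ ε) (h1 : ε ≤ 1) :
    Real.log (1 + ε) ≤ ε - 0.305 * ε ^ 2 := by
  have hder : ∀ x : ℝ, 0 ≤ x → HasDerivAt (fun x : ℝ => x - 0.305 * x ^ 2 - Real.log (1 + x))
      (1 - 0.305 * (2 * x) - 1 / (1 + x)) x := fun x hx => by
    have h2 : HasDerivAt (fun x : ℝ => 0.305 * x ^ 2) (0.305 * (2 * x)) x := by
      simpa using (hasDerivAt_pow 2 x).const_mul (0.305 : ℝ)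
    exact ((hasDerivAt_id x).sub h2).sub
      (((hasDerivAt_id x).const_add 1).log (by simp only [id]; linarith))
  set c : ℝ := 1 / 0.61 - 1 with hc
  have hsign : ∀ x : ℝ, 0 ≤ x →
      1 - 0.305 * (2 * x) - 1 / (1 + x) = x * (0.61 * (c - x)) / (1 + x) := fun x hx => by
    rw [hc]; field_simp; ring
  have hc0 : 0 < c := by rw [hc]; norm_num
  have hc1 : c < 1 := by rw [hc]; norm_num
  rcases le_total ε c with h | h
  · have hmono : MonotoneOn (fun x : ℝ => x - 0.305 * x ^ 2 - Real.log (1 + x)) (Set.Icc 0 c) := by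
      refine monotoneOn_of_deriv_nonneg (convex_Icc 0 c)
        (fun x hx => (hder x hx.1).continuousAt.continuousWithinAt)
        (fun x hx => (hder x (interior_subset hx).1).differentiableAt.differentiableWithinAt)
        fun x hx => ?_
      have hx' := interior_subset hx
      rw [(hder x hx'.1).deriv, hsign x hx'.1]
      have := hx'.1
      have := sub_nonneg.2 hx'.2
      positivity
    have := hmono ⟨le_rfl, hc0.le⟩ ⟨h0, h⟩ h0
    norm_num at this
    linarith
  · have hanti : AntitoneOn (fun x : ℝ => x - 0.305 * x ^ 2 - Real.log (1 + x)) (Set.Icc c 1) := by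
      refine antitoneOn_of_deriv_nonpos (convex_Icc c 1)
        (fun x hx => (hder x (hc0.le.trans hx.1)).continuousAt.continuousWithinAt)
        (fun x hx => (hder x (hc0.le.trans
          (interior_subset hx).1)).differentiableAt.differentiableWithinAt)
        fun x hx => ?_
      have hx' := interior_subset hx
      have hx0 := hc0.le.trans hx'.1
      rw [(hder x hx0).deriv, hsign x hx0]
      refine div_nonpos_of_nonpos_of_nonneg (mul_nonpos_of_nonneg_of_nonpos hx0 ?_) (by linarith)
      exact mul_nonpos_of_nonneg_of_nonpos (by norm_num) (sub_nonpos.2 hx'.1)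
    have := hanti ⟨h, h1⟩ ⟨hc1.le, le_rfl⟩ h1
    have hl := Real.log_two_lt_d9
    norm_num at this
    linarith

/-- Concavity of `log` on the chord from `1` to `1 - 2u`. -/
theorem neg_half_log_mul_le {u θ : ℝ} (hu : u < 1 / 2) (hθ₀ : 0 ≤ θ) (hθ₁ : θ ≤ 1) :
    -(1 / 2) * Real.log (1 - 2 * (θ * u)) ≤ θ * (-(1 / 2) * Real.log (1 - 2 * u)) := by
  have h := strictConcaveOn_log_Ioi.concaveOn.2 (Set.mem_Ioi.2 one_pos)
    (Set.mem_Ioi.2 (show 0 < 1 - 2 * u by linarith)) (sub_nonneg.2 hθ₁) hθ₀ (by ring)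
  simp only [smul_eq_mul, Real.log_one, mul_zero, zero_add] at h
  rw [show (1 - θ) * 1 + θ * (1 - 2 * u) = 1 - 2 * (θ * u) by ring] at h
  linarith

theorem neg_half_log_one_add_le {u : ℝ} (hu : 0 ≤ u) :
    -(1 / 2) * Real.log (1 + 2 * u) ≤ -u + u ^ 2 := by
  have h := Real.le_log_one_add_of_nonneg (show 0 ≤ 2 * u by linarith)
  have h2 : 2 * u - 2 * u ^ 2 ≤ 2 * (2 * u) / (2 * u + 2) := by
    rw [le_div_iff₀ (by linarith)]
    nlinarith [pow_nonneg hu 3]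
  linarith

/-- The centred weighted chi-square variable. -/
noncomputable def centeredWeightedSq (w : ι → ℝ) (z : ι → ℝ) : ℝ :=
  (∑ p, w p * z p ^ 2) - ∑ p, w p

theorem continuous_centeredWeightedSq (w : ι → ℝ) : Continuous (centeredWeightedSq w) := by
  unfold centeredWeightedSq; fun_prop

/-- The cumulant generating function is convex in each weight, so the chord over `[0, a]` makes it
linear in `w p`: only the sum of the weights remains. With `1 - 2ta = 1/(1 + ε)` the exponent is
`(T/2a)(log (1 + ε) - ε)`. -/
theorem centeredWeightedSq_upper_tail {w : ι → ℝ} {a ε : ℝ} (ha : 0 < a) (hw0 : ∀ p, 0 ≤ w p)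
    (hwa : ∀ p, w p ≤ a) (hε₀ : 0 < ε) (hε₁ : ε ≤ 1) :
    (gaussianMeasure ι).real {z | ε * ∑ p, w p ≤ centeredWeightedSq w z} ≤
      Real.exp (-((∑ p, w p) / a * (0.1525 * ε ^ 2))) := by
  set T := ∑ p, w p with hT
  have hT0 : 0 ≤ T := Finset.sum_nonneg fun p _ => hw0 p
  set t := ε / (2 * a * (1 + ε)) with ht
  have htpos : 0 < t := by positivity
  have hta : 2 * (t * a) = ε / (1 + ε) := by rw [ht]; field_simp
  have h1m : 1 - 2 * (t * a) = (1 + ε)⁻¹ := by rw [hta]; field_simp; ring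
  have hta' : t * a < 1 / 2 := by
    have : 0 < (1 + ε)⁻¹ := by positivity
    linarith
  have htw : ∀ p, t * w p < 1 / 2 := fun p =>
    (mul_le_mul_of_nonneg_left (hwa p) htpos.le).trans_lt hta'
  have hmgf := mgf_weighted_sum_sq htw
  have h1 := measure_ge_le_exp_mul_mgf (X := fun z => ∑ p, w p * z p ^ 2)
    (μ := gaussianMeasure ι) (T + ε * T) htpos.le (integrable_exp_of_mgf_eq_exp hmgf)
  have h2 : ∑ p, -(1 / 2) * Real.log (1 - 2 * (t * w p)) ≤ T / a * (1 / 2 * Real.log (1 + ε)) := by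
    rw [hT, Finset.sum_div, Finset.sum_mul]
    refine Finset.sum_le_sum fun p _ => ?_
    have := neg_half_log_mul_le (θ := w p / a) hta' (by have := hw0 p; positivity)
      (by rw [div_le_one ha]; exact hwa p)
    rw [h1m, Real.log_inv, show w p / a * (t * a) = t * w p by field_simp] at this
    linarith
  have h3 : {z : ι → ℝ | ε * T ≤ centeredWeightedSq w z} =
      {z | T + ε * T ≤ ∑ p, w p * z p ^ 2} := by
    ext z
    simp only [Set.mem_ofPred_eq, centeredWeightedSq, ← hT]
    constructor <;> intro h <;> linarith
  rw [h3]
  refine h1.trans ?_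
  rw [hmgf, ← Real.exp_add]
  refine Real.exp_le_exp.2 ?_
  have h4 : -t * (T + ε * T) = -(T / a * (ε / 2)) := by rw [ht]; field_simp
  have h5 := log_one_add_le_sub_sq hε₀.le hε₁
  have h6 : T / a * (1 / 2 * Real.log (1 + ε)) ≤ T / a * (1 / 2 * (ε - 0.305 * ε ^ 2)) := by
    gcongr
  rw [h4]
  linarith

theorem centeredWeightedSq_lower_tail {w : ι → ℝ} {a ε : ℝ} (ha : 0 < a) (hw0 : ∀ p, 0 ≤ w p)
    (hwa : ∀ p, w p ≤ a) (hε₀ : 0 < ε) :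
    (gaussianMeasure ι).real {z | centeredWeightedSq w z ≤ -(ε * ∑ p, w p)} ≤
      Real.exp (-((∑ p, w p) / a * (ε ^ 2 / 4))) := by
  set T := ∑ p, w p with hT
  set t := ε / (2 * a) with ht
  have htpos : 0 < t := by positivity
  have htw : ∀ p, -t * w p < 1 / 2 := fun p => by
    have := mul_nonneg htpos.le (hw0 p)
    linarith
  have hmgf := mgf_weighted_sum_sq htw
  have h1 := measure_le_le_exp_mul_mgf (X := fun z => ∑ p, w p * z p ^ 2)
    (μ := gaussianMeasure ι) (T - ε * T) (neg_nonpos.2 htpos.le) (integrable_exp_of_mgf_eq_exp hmgf)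
  have h2 : ∑ p, -(1 / 2) * Real.log (1 - 2 * (-t * w p)) ≤ -t * T + t ^ 2 * a * T := by
    rw [hT, Finset.mul_sum, Finset.mul_sum, ← Finset.sum_add_distrib]
    refine Finset.sum_le_sum fun p _ => ?_
    have := neg_half_log_one_add_le (mul_nonneg htpos.le (hw0 p))
    rw [show 1 - 2 * (-t * w p) = 1 + 2 * (t * w p) by ring]
    have h3 : t ^ 2 * (w p * w p) ≤ t ^ 2 * (a * w p) := by
      have := hw0 p
      have := hwa p
      gcongr
    linarith
  have h3 : {z : ι → ℝ | centeredWeightedSq w z ≤ -(ε * T)} =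
      {z | ∑ p, w p * z p ^ 2 ≤ T - ε * T} := by
    ext z
    simp only [Set.mem_ofPred_eq, centeredWeightedSq, ← hT]
    constructor <;> intro h <;> linarith
  rw [h3]
  refine h1.trans ?_
  rw [hmgf, ← Real.exp_add]
  refine Real.exp_le_exp.2 ?_
  have h4 : - -t * (T - ε * T) + (-t * T + t ^ 2 * a * T) = -(T / a * (ε ^ 2 / 4)) := by
    rw [ht]; field_simp; ring
  linarith

theorem centeredWeightedSq_tail {w : ι → ℝ} {a ε : ℝ} (ha : 0 < a) (hw0 : ∀ p, 0 ≤ w p)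
    (hwa : ∀ p, w p ≤ a) (hε₀ : 0 < ε) (hε₁ : ε ≤ 1) :
    (gaussianMeasure ι).real {z | ε * ∑ p, w p ≤ |centeredWeightedSq w z|} ≤
      Real.exp (-((∑ p, w p) / a * (0.1525 * ε ^ 2))) +
        Real.exp (-((∑ p, w p) / a * (ε ^ 2 / 4))) := by
  calc _ ≤ (gaussianMeasure ι).real ({z | ε * ∑ p, w p ≤ centeredWeightedSq w z} ∪
        {z | centeredWeightedSq w z ≤ -(ε * ∑ p, w p)}) := by
        refine measureReal_mono fun r hr => ?_
        rcases le_abs.1 (Set.mem_ofPred_eq ▸ hr) with h | h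
        · exact Or.inl h
        · exact Or.inr (by simp only [Set.mem_ofPred_eq]; linarith)
    _ ≤ _ := measureReal_union_le _ _
    _ ≤ _ := add_le_add (centeredWeightedSq_upper_tail ha hw0 hwa hε₀ hε₁)
        (centeredWeightedSq_lower_tail ha hw0 hwa hε₀)

/-- The exponential tails alone exceed the available `δ` when `δ` is close to `1`; this variance
bound covers that range. -/
theorem centeredWeightedSq_chebyshev {w : ι → ℝ} {a ε : ℝ} (ha : 0 < a) (hw0 : ∀ p, 0 ≤ w p)
    (hwa : ∀ p, w p ≤ a) (hT : 0 < ∑ p, w p) (hε₀ : 0 < ε) :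
    (gaussianMeasure ι).real {z | ε * ∑ p, w p ≤ |centeredWeightedSq w z|} ≤
      2 / ((∑ p, w p) / a * ε ^ 2) := by
  set T := ∑ p, w p with hTdef
  set X : (ι → ℝ) → ℝ := ∑ p, fun z : ι → ℝ => w p * z p ^ 2 with hX
  have hL : ∀ p, MemLp (fun x : ℝ => w p * x ^ 2) 2 (gaussianReal 0 1) := fun p =>
    memLp_sq_gaussianReal.const_mul (w p)
  have hvar : Var[X; gaussianMeasure ι] = ∑ p, w p ^ 2 * 2 := by
    rw [hX, variance_sum_pi (X := fun p x => w p * x ^ 2) hL]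
    refine Finset.sum_congr rfl fun p _ => ?_
    rw [variance_const_mul, variance_sq_gaussianReal]
  have hLpi : ∀ p, MemLp (fun z : ι → ℝ => w p * z p ^ 2) 2 (gaussianMeasure ι) := fun p =>
    (hL p).comp_measurePreserving (measurePreserving_eval (fun _ : ι => gaussianReal 0 1) p)
  have hmean : ∫ z, X z ∂gaussianMeasure ι = T := by
    simp only [hX, Finset.sum_apply]
    rw [integral_finsetSum _ fun p _ => (hLpi p).integrable one_le_two]
    refine Finset.sum_congr rfl fun p _ => ?_
    have := integral_comp_eval (μ := fun _ : ι => gaussianReal 0 1) (i := p)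
      (f := fun x => w p * x ^ 2) (by fun_prop)
    rw [this, integral_const_mul, integral_sq_gaussianReal, mul_one]
  have h1 := meas_ge_le_variance_div_sq (μ := gaussianMeasure ι) (X := X)
    (memLp_finsetSum' _ fun p _ => hLpi p) (mul_pos hε₀ hT)
  rw [hvar, hmean] at h1
  have h2 : (gaussianMeasure ι).real {z | ε * T ≤ |X z - T|} ≤
      (∑ p, w p ^ 2 * 2) / (ε * T) ^ 2 :=
    ENNReal.toReal_le_of_le_ofReal
      (div_nonneg (Finset.sum_nonneg fun p _ => by positivity) (by positivity)) h1
  have h3 : ∀ z, X z - T = centeredWeightedSq w z := fun z => by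
    simp [hX, centeredWeightedSq, ← hTdef]
  simp_rw [h3] at h2
  refine h2.trans ?_
  have h4 : ∑ p, w p ^ 2 * 2 ≤ a * T * 2 := by
    rw [← Finset.sum_mul, hTdef, Finset.mul_sum]
    gcongr with p
    rw [sq]
    exact mul_le_mul_of_nonneg_right (hwa p) (hw0 p)
  calc _ ≤ a * T * 2 / (ε * T) ^ 2 := by gcongr
    _ = _ := by field_simp

end ChiSquare

/-! ### Diagonalising a Gaussian quadratic form -/

section Rotation

variable {ι : Type*} [Fintype ι]

/-- Under the standard Gaussian law, a centred quadratic form is a centred weighted chi-square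
variable, with the eigenvalues as weights. -/
theorem exists_map_centeredForm_eq {A : Matrix ι ι ℝ} {a : ℝ} (hA : A.SpectralBound a)
    (ha : 0 < a) : ∃ w : ι → ℝ, (∀ p, 0 ≤ w p) ∧ (∀ p, w p ≤ a) ∧ ∑ p, w p = A.trace ∧
      (gaussianMeasure ι).map (centeredForm A) =
        (gaussianMeasure ι).map (centeredWeightedSq w) := by
  classical
  have hH : A.IsHermitian := by
    ext i j
    simp [hA.symm i j]
  set b := hH.eigenvectorBasis with hb
  set w := hH.eigenvalues with hw
  have hmul : ∀ p, A.mulVec (b p).ofLp = w p • (b p).ofLp := fun p => hH.mulVec_eigenvectorBasis p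
  have htr : ∑ p, w p = A.trace := by
    rw [hH.trace_eq_sum_eigenvalues]; simp [hw]
  have hdot : ∀ p q, (b p).ofLp ⬝ᵥ (b q).ofLp = if p = q then 1 else 0 := fun p q => by
    have := orthonormal_iff_ite.1 b.orthonormal q p
    rw [EuclideanSpace.inner_eq_star_dotProduct] at this
    simpa [eq_comm] using this
  have hsq : ∀ p, w p * w p ≤ a * w p := fun p => by
    have := hA.sq_le (b p).ofLp
    rw [hmul] at this
    simpa [hdot] using this
  have hw0 : ∀ p, 0 ≤ w p := fun p => by
    by_contra hn; push Not at hn; nlinarith [hsq p]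
  refine ⟨w, hw0, fun p => ?_, htr, ?_⟩
  · by_contra hn; push Not at hn; nlinarith [hsq p]
  have hcomp : centeredForm A ∘ (fun v : EuclideanSpace ℝ ι => v.ofLp) ∘
      (fun x : ι → ℝ => ∑ i, x i • b i) = centeredWeightedSq w := by
    ext x
    simp only [Function.comp, centeredForm, centeredWeightedSq, htr]
    congr 1
    have h1 : (∑ i, x i • b i).ofLp = ∑ i, x i • (b i).ofLp := by
      rw [WithLp.ofLp_sum]; rfl
    rw [h1, Matrix.mulVec_sum]
    simp only [Matrix.mulVec_smul, hmul, dotProduct_sum, sum_dotProduct, smul_dotProduct,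
      dotProduct_smul, hdot, smul_eq_mul, mul_ite, mul_one, mul_zero, Finset.sum_ite_eq',
      Finset.mem_univ, if_true]
    exact Finset.sum_congr rfl fun p _ => by ring
  have hcont := continuous_centeredForm A
  have hm1 : Measurable (fun v : EuclideanSpace ℝ ι => v.ofLp) := by fun_prop
  have hm2 : Measurable (fun x : ι → ℝ => ∑ i, x i • b i) := by fun_prop
  -- The standard Gaussian has independent standard coordinates in every orthonormal basis, hence in
  -- the eigenbasis.
  rw [← hcomp, ← Function.comp_assoc, ← Measure.map_map (hcont.measurable.comp hm1) hm2,
    ← stdGaussian_eq_map_pi_orthonormalBasis b, ← map_pi_eq_stdGaussian,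
    Measure.map_map (hcont.measurable.comp hm1) (by fun_prop)]
  rfl

theorem gaussian_centeredForm_tail {A : Matrix ι ι ℝ} {a ε : ℝ} (hA : A.SpectralBound a)
    (ha : 0 < a) (hT : 0 < A.trace) (hε₀ : 0 < ε) (hε₁ : ε ≤ 1) :
    (gaussianMeasure ι).real {z | ε * A.trace ≤ |centeredForm A z|} ≤
      min (2 / (A.trace / a * ε ^ 2)) (Real.exp (-(A.trace / a * (0.1525 * ε ^ 2))) +
        Real.exp (-(A.trace / a * (ε ^ 2 / 4)))) := by
  obtain ⟨w, hw0, hwa, htr, hmap⟩ := exists_map_centeredForm_eq hA ha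
  have hS : MeasurableSet {y : ℝ | ε * A.trace ≤ |y|} :=
    measurableSet_le measurable_const (by fun_prop)
  have h1 := map_measureReal_apply (μ := gaussianMeasure ι) (continuous_centeredForm A).measurable hS
  rw [hmap, map_measureReal_apply (continuous_centeredWeightedSq w).measurable hS] at h1
  change _ = (gaussianMeasure ι).real {z | ε * A.trace ≤ |centeredForm A z|} at h1
  rw [← h1, ← htr]
  exact le_min (centeredWeightedSq_chebyshev ha hw0 hwa (htr ▸ hT) hε₀)
    (centeredWeightedSq_tail ha hw0 hwa hε₀ hε₁)

end Rotation

/-! ### Sums of cubes of Gaussian column norms -/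

section ColumnNorms

variable {d ℓ : ℕ}

/-- The squared norm of the `i`-th column. -/
def colSq (i : Fin ℓ) (z : Fin d × Fin ℓ → ℝ) : ℝ := ∑ j, z (j, i) ^ 2

theorem continuous_colSq (i : Fin ℓ) : Continuous (colSq i : (Fin d × Fin ℓ → ℝ) → ℝ) := by
  unfold colSq; fun_prop

theorem colSq_nonneg (i : Fin ℓ) (z : Fin d × Fin ℓ → ℝ) : 0 ≤ colSq i z :=
  Finset.sum_nonneg fun _ _ => sq_nonneg _

theorem mgf_colSq (i : Fin ℓ) {t : ℝ} (ht : t < 1 / 2) :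
    mgf (colSq i) (gaussianMeasure (Fin d × Fin ℓ)) t =
      Real.exp (-(d / 2) * Real.log (1 - 2 * t)) := by
  have h1 : (colSq i : (Fin d × Fin ℓ → ℝ) → ℝ) =
      fun z => ∑ p : Fin d × Fin ℓ, (if p.2 = i then 1 else 0) * z p ^ 2 := by
    ext z
    simp [colSq, Fintype.sum_prod_type]
  rw [h1, mgf_weighted_sum_sq fun p => by split_ifs <;> linarith,
    Fintype.sum_prod_type]
  congr 1
  have h2 : ∀ j : Fin d, ∑ i' : Fin ℓ, -(1 / 2) * Real.log (1 - 2 * (t * if i' = i then 1 else 0)) =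
      -(1 / 2) * Real.log (1 - 2 * t) := fun j => by
    rw [Finset.sum_eq_single i (fun i' _ h => by simp [h]) (by simp)]
    simp
  rw [Finset.sum_congr rfl fun j _ => h2 j]
  simp
  ring

theorem mgf_sum_colSq {t : ℝ} (ht : t < 1 / 2) :
    mgf (fun z => ∑ i, colSq i z) (gaussianMeasure (Fin d × Fin ℓ)) t =
      Real.exp (-(d * ℓ / 2) * Real.log (1 - 2 * t)) := by
  have h1 : (fun z => ∑ i, colSq i z : (Fin d × Fin ℓ → ℝ) → ℝ) =
      fun z => ∑ p : Fin d × Fin ℓ, 1 * z p ^ 2 := by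
    ext z
    simp only [colSq, Fintype.sum_prod_type, one_mul]
    exact Finset.sum_comm
  rw [h1, mgf_weighted_sum_sq fun p => by linarith]
  congr 1
  simp
  ring

theorem sum_colSq_tail :
    (gaussianMeasure (Fin d × Fin ℓ)).real {z | 2 * (d * ℓ : ℝ) ≤ ∑ i, colSq i z} ≤
      Real.exp (-(0.1525 * (d * ℓ))) := by
  have hm := mgf_sum_colSq (d := d) (ℓ := ℓ) (t := 1 / 4) (by norm_num)
  refine (measure_ge_le_exp_mul_mgf (X := fun z => ∑ i, colSq i z) (2 * (d * ℓ : ℝ))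
    (by norm_num : (0 : ℝ) ≤ 1 / 4) (integrable_exp_of_mgf_eq_exp hm)).trans ?_
  rw [hm, ← Real.exp_add]
  refine Real.exp_le_exp.2 ?_
  rw [show (1 - 2 * (1 / 4) : ℝ) = 2⁻¹ by norm_num, Real.log_inv]
  have h1 := Real.log_two_lt_d9
  have h2 : (0 : ℝ) ≤ d * ℓ := by positivity
  nlinarith

theorem colSq_tail (i : Fin ℓ) (y : ℝ) :
    (gaussianMeasure (Fin d × Fin ℓ)).real {z | y ≤ colSq i z} ≤
      Real.exp (-(3 / 8 * y) + d * Real.log 2) := by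
  have hm := mgf_colSq (d := d) i (t := 3 / 8) (by norm_num)
  refine (measure_ge_le_exp_mul_mgf (X := colSq i) y
    (by norm_num : (0 : ℝ) ≤ 3 / 8) (integrable_exp_of_mgf_eq_exp hm)).trans ?_
  rw [hm, ← Real.exp_add]
  refine Real.exp_le_exp.2 (le_of_eq ?_)
  rw [show (1 - 2 * (3 / 8) : ℝ) = (2 ^ 2)⁻¹ by norm_num, Real.log_inv, Real.log_pow]
  push_cast
  ring

theorem integrable_colSq_pow (i : Fin ℓ) (n : ℕ) :
    Integrable (fun z => colSq i z ^ n) (gaussianMeasure (Fin d × Fin ℓ)) :=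
  integrable_pow_of_mem_interior_integrableExpSet
    (zero_mem_interior_integrableExpSet_of_mgf fun _ ht => mgf_colSq i ht) n

theorem integral_colSq_pow (i : Fin ℓ) (n : ℕ) :
    ∫ z, colSq i z ^ n ∂gaussianMeasure (Fin d × Fin ℓ) =
      ∏ k ∈ Finset.range n, ((d : ℝ) + 2 * k) := by
  rw [integral_pow_of_mgf (fun _ ht => mgf_colSq i ht) n]
  exact Finset.prod_congr rfl fun k _ => by ring

theorem iIndepFun_colSq_pair {i i' : Fin ℓ} (h : i ≠ i') {g : ℝ → ℝ} (hg : Measurable g) :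
    IndepFun (fun z => g (colSq i z)) (fun z => g (colSq i' z))
      (gaussianMeasure (Fin d × Fin ℓ)) := by
  classical
  set T : Fin ℓ → Finset (Fin d × Fin ℓ) := fun i => Finset.univ.filter fun p => p.2 = i with hT
  have hind : iIndepFun (fun (p : Fin d × Fin ℓ) (z : Fin d × Fin ℓ → ℝ) => z p)
      (gaussianMeasure (Fin d × Fin ℓ)) :=
    iIndepFun_pi (X := fun _ x => x) fun _ => aemeasurable_id
  have hdisj : Disjoint (T i) (T i') := by
    rw [Finset.disjoint_left]
    intro p hp hp'
    simp only [hT, Finset.mem_filter, Finset.mem_univ, true_and] at hp hp'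
    exact h (hp.symm.trans hp')
  have h1 := hind.indepFun_finset (T i) (T i') hdisj fun p => measurable_pi_apply p
  have hcol : ∀ (i : Fin ℓ) (z : Fin d × Fin ℓ → ℝ), colSq i z = ∑ p : T i, z p ^ 2 := fun i z => by
    rw [Finset.sum_coe_sort (T i) fun p => z p ^ 2, Finset.sum_filter, Fintype.sum_prod_type]
    simp [colSq]
  have h2 := h1.comp (φ := fun v => g (∑ p, v p ^ 2)) (ψ := fun v => g (∑ p, v p ^ 2))
    (by fun_prop) (by fun_prop)
  simpa [Function.comp_def, hcol] using h2

/-- AM–GM on `√Q`; with `b = √d` it bounds the mean of `Q^(3/2)` by the first two moments of `Q`. -/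
theorem mul_sqrt_le_of_sq {Q b : ℝ} (hQ : 0 ≤ Q) (hb : 0 < b) :
    Q * √Q ≤ (b * Q + Q ^ 2 / b) / 2 := by
  have h1 : √Q ≤ (b + Q / b) / 2 := by
    refine Real.sqrt_le_iff.2 ⟨by positivity, ?_⟩
    have : (b + Q / b) ^ 2 - 4 * Q = (b - Q / b) ^ 2 := by field_simp; ring
    nlinarith [sq_nonneg (b - Q / b)]
  calc Q * √Q ≤ Q * ((b + Q / b) / 2) := by gcongr
    _ = _ := by ring

/-- Tangent line of the convex function `Q^(3/2)` at `e`; integrated, it is the Jensen lower bound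
on the mean that the variance estimate needs. -/
theorem tangent_le_mul_sqrt {Q e : ℝ} (hQ : 0 ≤ Q) (he : 0 ≤ e) :
    e * √e + 3 / 2 * √e * (Q - e) ≤ Q * √Q := by
  obtain ⟨x, hx, rfl⟩ : ∃ x : ℝ, 0 ≤ x ∧ Q = x ^ 2 := ⟨√Q, Real.sqrt_nonneg _, (Real.sq_sqrt hQ).symm⟩
  obtain ⟨y, hy, rfl⟩ : ∃ y : ℝ, 0 ≤ y ∧ e = y ^ 2 := ⟨√e, Real.sqrt_nonneg _, (Real.sq_sqrt he).symm⟩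
  rw [Real.sqrt_sq hx, Real.sqrt_sq hy]
  nlinarith [mul_nonneg (sq_nonneg (x - y)) hx, mul_nonneg (sq_nonneg (x - y)) hy]

theorem memLp_colSq_mul_sqrt (i : Fin ℓ) :
    MemLp (fun z => colSq i z * √(colSq i z)) 2 (gaussianMeasure (Fin d × Fin ℓ)) := by
  have hc := continuous_colSq (d := d) i
  rw [memLp_two_iff_integrable_sq (by fun_prop : Continuous _).aestronglyMeasurable]
  refine (integrable_colSq_pow i 3).congr (Filter.Eventually.of_forall fun z => ?_)
  simp only [mul_pow, Real.sq_sqrt (colSq_nonneg i z)]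
  ring

theorem integral_colSq_mul_sqrt_le (hd : 0 < d) (i : Fin ℓ) :
    ∫ z, colSq i z * √(colSq i z) ∂gaussianMeasure (Fin d × Fin ℓ) ≤ √d * (d + 1) := by
  have hd' : (0 : ℝ) < d := by exact_mod_cast hd
  set b := √d with hb
  have hbpos : 0 < b := Real.sqrt_pos.2 hd'
  have hb2 : b ^ 2 = d := Real.sq_sqrt hd'.le
  have h1 := integrable_colSq_pow (d := d) i 1
  have h2 := integrable_colSq_pow (d := d) i 2
  have e1 := integral_colSq_pow (d := d) i 1
  have e2 := integral_colSq_pow (d := d) i 2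
  simp only [Finset.prod_range_succ, Finset.prod_range_zero, pow_one] at h1 e1 e2
  push_cast at e1 e2
  calc _ ≤ ∫ z, (b * colSq i z + colSq i z ^ 2 / b) / 2 ∂gaussianMeasure (Fin d × Fin ℓ) := by
        refine integral_mono ((memLp_colSq_mul_sqrt i).integrable one_le_two)
          (((h1.const_mul b).add (h2.div_const b)).div_const 2) fun z => ?_
        exact mul_sqrt_le_of_sq (colSq_nonneg i z) hbpos
    _ = _ := by
        rw [integral_div, integral_add (h1.const_mul b) (h2.div_const b), integral_const_mul,
          integral_div, e1, e2, ← hb2]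
        field_simp
        ring

theorem le_integral_colSq_mul_sqrt (i : Fin ℓ) :
    d * √d ≤ ∫ z, colSq i z * √(colSq i z) ∂gaussianMeasure (Fin d × Fin ℓ) := by
  have h1 := integrable_colSq_pow (d := d) i 1
  have e1 := integral_colSq_pow (d := d) i 1
  simp only [Finset.prod_range_succ, Finset.prod_range_zero, pow_one] at h1 e1
  push_cast at e1
  calc (d * √d : ℝ) = ∫ z, (d * √d + 3 / 2 * √d * (colSq i z - d))
        ∂gaussianMeasure (Fin d × Fin ℓ) := by
        have h2 : Integrable (fun z => 3 / 2 * √d * (colSq i z - d))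
            (gaussianMeasure (Fin d × Fin ℓ)) := (h1.sub (integrable_const _)).const_mul _
        rw [integral_add (integrable_const _) h2, integral_const_mul (3 / 2 * √d),
          integral_sub h1 (integrable_const _), e1]
        simp
    _ ≤ _ := integral_mono ((integrable_const _).add ((h1.sub (integrable_const _)).const_mul _))
        ((memLp_colSq_mul_sqrt i).integrable one_le_two) fun z =>
          tangent_le_mul_sqrt (colSq_nonneg i z) (Nat.cast_nonneg d)

theorem variance_colSq_mul_sqrt_le (i : Fin ℓ) :
    Var[fun z => colSq i z * √(colSq i z); gaussianMeasure (Fin d × Fin ℓ)] ≤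
      6 * d ^ 2 + 8 * d := by
  have e3 := integral_colSq_pow (d := d) i 3
  simp only [Finset.prod_range_succ, Finset.prod_range_zero] at e3
  push_cast at e3
  have h1 : ∫ z, (colSq i z * √(colSq i z)) ^ 2 ∂gaussianMeasure (Fin d × Fin ℓ) =
      d * (d + 2) * (d + 4) := by
    have : ∀ z : Fin d × Fin ℓ → ℝ, (colSq i z * √(colSq i z)) ^ 2 = colSq i z ^ 3 := fun z => by
      rw [mul_pow, Real.sq_sqrt (colSq_nonneg i z)]; ring
    simp_rw [this]
    rw [e3]; ring
  rw [variance_eq_sub (memLp_colSq_mul_sqrt i)]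
  simp only [Pi.pow_apply]
  rw [h1]
  have h2 := pow_le_pow_left₀ (by positivity) (le_integral_colSq_mul_sqrt (d := d) i) 2
  rw [mul_pow, Real.sq_sqrt (Nat.cast_nonneg d)] at h2
  linarith

theorem sum_colSq_mul_sqrt_chebyshev (hd : 0 < d) (hℓ : 0 < ℓ) {K : ℝ} (hK : 0 < K) {y : ℝ}
    (hy : √d * (d + 1) + √d * K ≤ y) :
    (gaussianMeasure (Fin d × Fin ℓ)).real
      {z | ℓ * y ≤ ∑ i, colSq i z * √(colSq i z)} ≤ (6 * d + 8) / (ℓ * K ^ 2) := by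
  have hd' : (0 : ℝ) < d := by exact_mod_cast hd
  have hℓ' : (0 : ℝ) < ℓ := by exact_mod_cast hℓ
  set γ := gaussianMeasure (Fin d × Fin ℓ)
  set X : (Fin d × Fin ℓ → ℝ) → ℝ := ∑ i, fun z => colSq i z * √(colSq i z) with hX
  have hvar : Var[X; γ] ≤ ℓ * (6 * d ^ 2 + 8 * d) := by
    rw [hX, IndepFun.variance_sum (fun i _ => memLp_colSq_mul_sqrt i) fun i _ i' _ h =>
      iIndepFun_colSq_pair (g := fun x => x * √x) h (by fun_prop)]
    refine (Finset.sum_le_sum fun i _ => variance_colSq_mul_sqrt_le i).trans ?_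
    simp
    linarith
  have hmean : ∫ z, X z ∂γ ≤ ℓ * (√d * (d + 1)) := by
    simp only [hX, Finset.sum_apply]
    rw [integral_finsetSum _ fun i _ => (memLp_colSq_mul_sqrt i).integrable one_le_two]
    refine (Finset.sum_le_sum fun i _ => integral_colSq_mul_sqrt_le hd i).trans ?_
    simp
  have hc : 0 < ℓ * (√d * K) := by positivity
  have h1 := meas_ge_le_variance_div_sq (μ := γ) (X := X)
    (memLp_finsetSum' _ fun i _ => memLp_colSq_mul_sqrt i) hc
  have h2 : γ.real {z | ℓ * (√d * K) ≤ |X z - ∫ z, X z ∂γ|} ≤ Var[X; γ] / (ℓ * (√d * K)) ^ 2 :=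
    ENNReal.toReal_le_of_le_ofReal (div_nonneg (variance_nonneg _ _) (by positivity)) h1
  calc _ ≤ γ.real {z | ℓ * (√d * K) ≤ |X z - ∫ z, X z ∂γ|} := by
        refine measureReal_mono fun z hz => ?_
        simp only [Set.mem_ofPred_eq] at hz ⊢
        refine le_trans ?_ (le_abs_self _)
        have h3 : X z = ∑ i, colSq i z * √(colSq i z) := by simp [hX]
        have h4 : ℓ * (√d * (d + 1) + √d * K) ≤ ℓ * y := by gcongr
        rw [h3]
        linarith
    _ ≤ _ := h2
    _ ≤ ℓ * (6 * d ^ 2 + 8 * d) / (ℓ * (√d * K)) ^ 2 := by gcongr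
    _ = _ := by
        rw [mul_pow, mul_pow, Real.sq_sqrt hd'.le]
        field_simp

/-- If `∑ Qᵢ ≤ 2dℓ` and every `Qᵢ ≤ B`, then `∑ Qᵢ^(3/2) ≤ 2dℓ√B`; the value of `B` makes this equal
to `ℓ M^(3/2)`. -/
theorem sum_colSq_mul_sqrt_chernoff (hd : 0 < d) {M : ℝ} (hM : 0 ≤ M) :
    (gaussianMeasure (Fin d × Fin ℓ)).real
      {z | ℓ * (M * √M) < ∑ i, colSq i z * √(colSq i z)} ≤
      Real.exp (-(0.1525 * (d * ℓ))) +
        ℓ * Real.exp (-(3 / 8 * (M ^ 3 / (4 * d ^ 2))) + d * Real.log 2) := by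
  have hd' : (0 : ℝ) < d := by exact_mod_cast hd
  set γ := gaussianMeasure (Fin d × Fin ℓ)
  set B := M ^ 3 / (4 * d ^ 2) with hB
  have hB0 : 0 ≤ B := by positivity
  have hsqB : √B * (2 * d) = M * √M := by
    have h1 : B = (M * √M / (2 * d)) ^ 2 := by
      rw [div_pow, mul_pow, Real.sq_sqrt hM, hB]; ring
    rw [h1, Real.sqrt_sq (by positivity)]
    field_simp
  calc _ ≤ γ.real ({z | 2 * (d * ℓ : ℝ) ≤ ∑ i, colSq i z} ∪ ⋃ i, {z | B ≤ colSq i z}) := by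
        refine measureReal_mono fun z hz => ?_
        by_contra hn
        simp only [Set.mem_union, Set.mem_iUnion, Set.mem_ofPred_eq, not_or, not_exists,
          not_le] at hn hz
        have h1 : ∑ i, colSq i z * √(colSq i z) ≤ ∑ i, colSq i z * √B :=
          Finset.sum_le_sum fun i _ => mul_le_mul_of_nonneg_left
            (Real.sqrt_le_sqrt (hn.2 i).le) (colSq_nonneg i z)
        rw [← Finset.sum_mul] at h1
        have h2 : (∑ i, colSq i z) * √B ≤ 2 * (d * ℓ) * √B := by
          gcongr
          exact hn.1.le
        have h3 : 2 * (d * ℓ) * √B = ℓ * (M * √M) := by rw [← hsqB]; ring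
        linarith
    _ ≤ _ := measureReal_union_le _ _
    _ ≤ _ := by
        refine add_le_add sum_colSq_tail ((measureReal_iUnion_fintype_le _).trans ?_)
        refine (Finset.sum_le_sum fun i _ => colSq_tail i B).trans ?_
        simp

theorem colSq_mul_sqrt_tail_one {M : ℝ} (hM : 2 * (d : ℝ) ≤ M) :
    (gaussianMeasure (Fin d × Fin 1)).real
      {z | M * √M < ∑ i, colSq i z * √(colSq i z)} ≤ Real.exp (-(0.1525 * d)) := by
  have h := sum_colSq_tail (d := d) (ℓ := 1)
  simp only [Nat.cast_one, mul_one] at h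
  refine le_trans (measureReal_mono fun z hz => ?_) h
  simp only [Set.mem_ofPred_eq, Finset.univ_unique, Finset.sum_singleton] at hz ⊢
  by_contra hn
  push Not at hn
  have h1 : colSq default z ≤ M := (hn.trans_le hM).le
  have h2 := mul_le_mul h1 (Real.sqrt_le_sqrt h1) (Real.sqrt_nonneg _)
    ((colSq_nonneg _ z).trans h1)
  linarith

end ColumnNorms

/-! ### Numerical estimates for sharing the failure probability -/

section Numerics

theorem log_ten_gt : (2.302 : ℝ) < Real.log 10 := by
  have h1 : 93 * Real.log 2 ≤ 28 * Real.log 10 := by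
    have h : Real.log ((2 : ℝ) ^ 93) ≤ Real.log ((10 : ℝ) ^ 28) :=
      Real.log_le_log (by positivity) (by norm_num)
    rw [Real.log_pow, Real.log_pow] at h
    exact_mod_cast h
  have := Real.log_two_gt_d9
  linarith

theorem log_four_eq : Real.log 4 = 2 * Real.log 2 := by
  rw [show (4 : ℝ) = 2 ^ 2 by norm_num, Real.log_pow]; norm_num

/-- `t ↦ t e⁻ᵗ` is at least the smaller of its values at the ends of an interval. -/
theorem min_le_mul_exp_neg {a b r : ℝ} (ha : 0 < a) (h1 : a ≤ Real.exp (-r))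
    (h2 : Real.exp (-r) ≤ b) :
    min (a * -Real.log a) (b * -Real.log b) ≤ r * Real.exp (-r) := by
  have h := Real.concaveOn_negMulLog.min_le_of_mem_Icc (x := a) (y := b) (z := Real.exp (-r))
    ha.le (ha.le.trans (h1.trans h2)) ⟨h1, h2⟩
  simp only [Real.negMulLog, Real.log_exp] at h
  rw [neg_mul, neg_mul] at h
  simp only [mul_neg]
  linarith

theorem exp_neg_le_inv {y : ℝ} (hy : 0 ≤ y) : Real.exp (-y) ≤ (1 + y)⁻¹ := by
  rw [Real.exp_neg]
  exact inv_anti₀ (by linarith) (by linarith [Real.add_one_le_exp y])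

theorem exp_neg_le_inv_sq {y : ℝ} (hy : 0 ≤ y) :
    Real.exp (-y) ≤ ((1 + y / 2 + (y / 2) ^ 2 / 2)⁻¹) ^ 2 := by
  have h1 := Real.quadratic_le_exp_of_nonneg (x := y / 2) (by positivity)
  have h2 : Real.exp (-y) = (Real.exp (y / 2))⁻¹ ^ 2 := by
    rw [← Real.exp_neg, ← Real.exp_nat_mul]; congr 1; push_cast; ring
  rw [h2]
  gcongr

variable {r : ℝ}

theorem exp_neg_mul_add_one (c r : ℝ) :
    Real.exp (-((1 + c) * r)) = Real.exp (-r) * Real.exp (-(c * r)) := by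
  rw [← Real.exp_add]; congr 1; ring

theorem exp_neg_two_mul (r : ℝ) : Real.exp (-(2 * r)) = Real.exp (-r) * Real.exp (-r) := by
  rw [← Real.exp_add]; congr 1; ring

theorem le_mul_exp_neg_of_le_log_four (h1 : Real.log 2 ≤ r) (h2 : r ≤ Real.log 4) :
    0.346 ≤ r * Real.exp (-r) := by
  have e2 := Real.log_two_gt_d9
  have l4 := log_four_eq
  have ha : (1 / 4 : ℝ) ≤ Real.exp (-r) := by
    rw [one_div, ← Real.exp_log (by norm_num : (0 : ℝ) < 4), ← Real.exp_neg]
    exact Real.exp_le_exp.2 (by linarith)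
  have hb : Real.exp (-r) ≤ 1 / 2 := by
    rw [one_div, ← Real.exp_log (by norm_num : (0 : ℝ) < 2), ← Real.exp_neg]
    exact Real.exp_le_exp.2 (by linarith)
  refine le_trans ?_ (min_le_mul_exp_neg (by norm_num) ha hb)
  rw [one_div, one_div, Real.log_inv, Real.log_inv, l4]
  exact le_min (by linarith) (by linarith)

theorem le_mul_exp_neg_of_le_log_ten (h1 : Real.log 4 ≤ r) (h2 : r ≤ Real.log 10) :
    0.2302 ≤ r * Real.exp (-r) := by
  have e2 := Real.log_two_gt_d9
  have e10 := log_ten_gt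
  have l4 := log_four_eq
  have ha : (1 / 10 : ℝ) ≤ Real.exp (-r) := by
    rw [one_div, ← Real.exp_log (by norm_num : (0 : ℝ) < 10), ← Real.exp_neg]
    exact Real.exp_le_exp.2 (by linarith)
  have hb : Real.exp (-r) ≤ 1 / 4 := by
    rw [one_div, ← Real.exp_log (by norm_num : (0 : ℝ) < 4), ← Real.exp_neg]
    exact Real.exp_le_exp.2 (by linarith)
  refine le_trans ?_ (min_le_mul_exp_neg (by norm_num) ha hb)
  rw [one_div, one_div, Real.log_inv, Real.log_inv, l4]
  exact le_min (by linarith) (by linarith)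

theorem div_le_mul_exp_neg {c k : ℝ} (hr : 0 < r) (hk : 0 < k) (hc : 0 ≤ c)
    (h : k ≤ r * Real.exp (-r)) : c / r ≤ c / k * Real.exp (-r) := by
  rw [div_mul_eq_mul_div, div_le_div_iff₀ hr hk]
  nlinarith

theorem exp_neg_le_quarter (h : Real.log 4 ≤ r) : Real.exp (-r) ≤ 1 / 4 := by
  rw [one_div, ← Real.exp_log (by norm_num : (0 : ℝ) < 4), ← Real.exp_neg]
  exact Real.exp_le_exp.2 (by linarith)

theorem exp_neg_le_tenth (h : Real.log 10 ≤ r) : Real.exp (-r) ≤ 1 / 10 := by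
  rw [one_div, ← Real.exp_log (by norm_num : (0 : ℝ) < 10), ← Real.exp_neg]
  exact Real.exp_le_exp.2 (by linarith)

theorem exp_neg_le_of_log_four_le (h : Real.log 4 ≤ r) : Real.exp (-(0.22 * r)) ≤ 0.7664 := by
  have e2 := Real.log_two_gt_d9
  have l4 := log_four_eq
  refine (Real.exp_le_exp.2 (by linarith : -(0.22 * r) ≤ -0.30492)).trans ?_
  refine (exp_neg_le_inv (by norm_num)).trans (by norm_num)

theorem exp_neg_le_of_log_ten_le (h : Real.log 10 ≤ r) : Real.exp (-(0.22 * r)) ≤ 0.6056 := by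
  have e10 := log_ten_gt
  refine (Real.exp_le_exp.2 (by linarith : -(0.22 * r) ≤ -0.50644)).trans ?_
  refine (exp_neg_le_inv_sq (by norm_num)).trans (by norm_num)

theorem exp_neg_le_third_of_log_ten_le (h : Real.log 10 ≤ r) : Real.exp (-(0.48 * r)) ≤ 0.333 := by
  have e10 := log_ten_gt
  refine (Real.exp_le_exp.2 (by linarith : -(0.48 * r) ≤ -1 + -0.10496)).trans ?_
  rw [Real.exp_add]
  have h1 : Real.exp (-1) < 0.36788 := by
    have := Real.exp_neg_one_lt_d9; linarith
  have h2 : Real.exp (-0.10496) ≤ 0.90502 := (exp_neg_le_inv (by norm_num)).trans (by norm_num)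
  calc Real.exp (-1) * Real.exp (-0.10496) ≤ 0.36788 * 0.90502 := by gcongr
    _ ≤ 0.333 := by norm_num

/-- This and the next three bounds add the trace failure to the column failure and compare with `δ =
2e⁻ʳ`. Polynomial terms `c/r` are converted to multiples of `e⁻ʳ` by lower bounds for `r e⁻ʳ` on the
given range. -/
theorem budget_single (hr : Real.log 2 ≤ r) :
    min (1 / (4 * r)) (Real.exp (-(1.22 * r)) + Real.exp (-(2 * r))) + Real.exp (-(1.22 * r)) ≤
      2 * Real.exp (-r) := by
  have e2 := Real.log_two_gt_d9
  have hr0 : 0 < r := by linarith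
  have hq := Real.exp_pos (-r)
  have h122 := exp_neg_mul_add_one 0.22 r
  norm_num only at h122 ⊢
  rcases le_total r (Real.log 4) with h | h
  · have h1 := div_le_mul_exp_neg (c := 1 / 4) hr0 (by norm_num) (by norm_num)
      (le_mul_exp_neg_of_le_log_four hr h)
    have h2 : Real.exp (-(11 / 50 * r)) ≤ 1 := Real.exp_le_one_iff.2 (by linarith)
    have h3 : 1 / (4 * r) = 1 / 4 / r := by field_simp
    have h4 := min_le_left (1 / (4 * r)) (Real.exp (-(61 / 50 * r)) + Real.exp (-(2 * r)))
    norm_num only at h1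
    nlinarith
  · have h1 := exp_neg_le_of_log_four_le h
    have h2 := exp_neg_le_quarter h
    have h4 := min_le_right (1 / (4 * r)) (Real.exp (-(61 / 50 * r)) + Real.exp (-(2 * r)))
    have h5 := exp_neg_two_mul r
    norm_num only at h1
    nlinarith

theorem budget_small (hr : Real.log 2 ≤ r) (h : r ≤ Real.log 4) :
    1 / (4 * r) + 3 / (8 * r) ≤ 2 * Real.exp (-r) := by
  have e2 := Real.log_two_gt_d9
  have hr0 : 0 < r := by linarith
  have hq := Real.exp_pos (-r)
  have h1 := div_le_mul_exp_neg (c := 5 / 8) hr0 (by norm_num) (by norm_num)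
      (le_mul_exp_neg_of_le_log_four hr h)
  have h3 : 1 / (4 * r) + 3 / (8 * r) = 5 / 8 / r := by field_simp; norm_num
  norm_num only at h1
  nlinarith

theorem budget_medium (hr : Real.log 4 ≤ r) (h : r ≤ Real.log 10) :
    Real.exp (-(1.22 * r)) + Real.exp (-(2 * r)) + 1.8 / (8 * r) ≤ 2 * Real.exp (-r) := by
  have e2 := Real.log_two_gt_d9
  have l4 := log_four_eq
  have hr0 : 0 < r := by linarith
  have hq := Real.exp_pos (-r)
  have h122 := exp_neg_mul_add_one 0.22 r
  have h1 := div_le_mul_exp_neg (c := 9 / 40) hr0 (by norm_num) (by norm_num)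
      (le_mul_exp_neg_of_le_log_ten hr h)
  have h2 := exp_neg_le_quarter hr
  have h3 : 1.8 / (8 * r) = 9 / 40 / r := by field_simp; norm_num
  have h4 := exp_neg_le_of_log_four_le hr
  have h5 := exp_neg_two_mul r
  norm_num only at h122 h1 h3 h4 ⊢
  nlinarith

theorem budget_large (h : Real.log 10 ≤ r) :
    Real.exp (-(1.22 * r)) + Real.exp (-(2 * r)) +
      (Real.exp (-(1.22 * r)) + 2 * Real.exp (-r) * Real.exp (-(0.48 * r))) ≤
      2 * Real.exp (-r) := by
  have hq := Real.exp_pos (-r)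
  have h122 := exp_neg_mul_add_one 0.22 r
  have h2 := exp_neg_le_tenth h
  have h4 := exp_neg_le_of_log_ten_le h
  have h5 := exp_neg_two_mul r
  have h6 := exp_neg_le_third_of_log_ten_le h
  norm_num only at h122 h4 h6 ⊢
  nlinarith

/-- After clearing denominators, the terms up to `Λ²` nearly form the perfect square supplied to
`nlinarith`, so `1.48` has little room to grow. -/
theorem mul_log_two_add_le {d Λ : ℝ} (hd : 0 < d) (hΛ : 0 ≤ Λ) :
    d * Real.log 2 + 1.48 * Λ ≤ 3 / 8 * ((2 * d + Λ) ^ 3 / (4 * d ^ 2)) := by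
  have e2 := Real.log_two_lt_d9
  rw [mul_div_assoc', le_div_iff₀ (by positivity)]
  have h1 : d * Real.log 2 ≤ d * 0.69315 := by gcongr; linarith
  have h2 : (d * Real.log 2 + 1.48 * Λ) * (4 * d ^ 2) ≤ (d * 0.69315 + 1.48 * Λ) * (4 * d ^ 2) := by
    gcongr
  refine h2.trans ?_
  nlinarith [mul_nonneg hd.le (sq_nonneg (0.4768 * d - 1.489 * Λ)), pow_nonneg hΛ 3,
    mul_nonneg hd.le (sq_nonneg Λ), pow_pos hd 3]

/-- Tangent line of `x^(3/2)` at `2d`, with slopes `2√2` and `3/√2` rounded down. -/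
theorem sqrt_mul_le_mul_sqrt {d r M : ℝ} (hd : 0 < d) (hr : 0 ≤ r) (hM : 2 * d + r ≤ M) :
    √d * (2.828 * d + 2.121 * r) ≤ M * √M := by
  have hM0 : 0 ≤ M := by linarith
  refine le_of_sq_le_sq ?_ (by positivity)
  rw [mul_pow, mul_pow, Real.sq_sqrt hd.le, Real.sq_sqrt hM0]
  have h1 : (2 * d + r) ^ 3 ≤ M ^ 3 := by gcongr
  nlinarith [pow_pos hd 3, mul_nonneg (sq_nonneg d) hr, mul_nonneg hd.le (sq_nonneg r),
    pow_nonneg hr 3]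

end Numerics

/-! ### The Gaussian case -/

section GaussianSketch

variable {d ℓ : ℕ}

theorem div_le_div_mul_of_le {d ℓ K c r : ℝ} (hd : 0 < d) (hℓ : 0 < ℓ) (hr : 0 < r) (hK : 0 < K)
    (hN : 8 * r ≤ d * ℓ) (h : d * (6 * d + 8) ≤ c * K ^ 2) :
    (6 * d + 8) / (ℓ * K ^ 2) ≤ c / (8 * r) := by
  rw [div_le_div_iff₀ (by positivity) (by positivity)]
  calc (6 * d + 8) * (8 * r) ≤ (6 * d + 8) * (d * ℓ) := by gcongr
    _ = d * (6 * d + 8) * ℓ := by ring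
    _ ≤ c * K ^ 2 * ℓ := by gcongr
    _ = _ := by ring

/-- Both failure probabilities of a Gaussian sketch together are at most `δ`. -/
theorem add_colSq_tail_le {δ t : ℝ} (hd : 0 < d) (hℓ : 0 < ℓ) (hδ₀ : 0 < δ) (hδ₁ : δ < 1)
    (hN : 8 * Real.log (2 / δ) ≤ d * ℓ)
    (ht : t ≤ min (1 / (4 * Real.log (2 / δ))) (Real.exp (-(1.22 * Real.log (2 / δ))) +
      Real.exp (-(2 * Real.log (2 / δ))))) :
    t + (gaussianMeasure (Fin d × Fin ℓ)).real
      {z | ℓ * ((2 * d + Real.log (ℓ / δ)) * √(2 * d + Real.log (ℓ / δ))) <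
        ∑ i, colSq i z * √(colSq i z)} ≤ δ := by
  have hd1 : (1 : ℝ) ≤ d := by exact_mod_cast hd
  have hd' : (0 : ℝ) < d := by linarith
  have hℓ1 : (1 : ℝ) ≤ ℓ := by exact_mod_cast hℓ
  have hℓ' : (0 : ℝ) < ℓ := by linarith
  have e2 := Real.log_two_gt_d9
  have l4 := log_four_eq
  set r := Real.log (2 / δ) with hr
  have hrδ : 2 * Real.exp (-r) = δ := by
    rw [hr, ← Real.log_inv, Real.exp_log (by positivity)]; field_simp
  have hr2 : Real.log 2 ≤ r := Real.log_le_log (by norm_num) (by rw [le_div_iff₀ hδ₀]; linarith)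
  have hr0 : 0 < r := by linarith
  set Λ := Real.log (ℓ / δ) with hΛ
  have hΛ0 : 0 ≤ Λ := Real.log_nonneg (by rw [le_div_iff₀ hδ₀]; linarith)
  have hNtail : Real.exp (-(0.1525 * (d * ℓ))) ≤ Real.exp (-(1.22 * r)) :=
    Real.exp_le_exp.2 (by linarith)
  -- A single column is separate because `r ≤ Λ` needs `ℓ ≥ 2`; for `ℓ = 1` the event just says that
  -- one chi-square variable exceeds `M ≥ 2d`.
  rcases (Nat.one_le_iff_ne_zero.2 hℓ.ne').eq_or_lt with h1 | h1
  · subst h1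
    have h2 := colSq_mul_sqrt_tail_one (d := d) (M := 2 * d + Λ) (by linarith)
    simp only [Nat.cast_one, mul_one, one_mul] at hNtail ⊢
    have h3 := budget_single hr2
    linarith
  have hℓ2 : (2 : ℝ) ≤ ℓ := by exact_mod_cast h1
  have hrΛ : r ≤ Λ := Real.log_le_log (by positivity) (by gcongr)
  have hM := sqrt_mul_le_mul_sqrt (M := 2 * d + Λ) hd' hr0.le (by linarith)
  have hcheb : ∀ c : ℝ, (d : ℝ) * (6 * d + 8) ≤ c * (1.828 * d + 2.121 * r - 1) ^ 2 →
      (gaussianMeasure (Fin d × Fin ℓ)).real {z | ℓ * ((2 * d + Λ) * √(2 * d + Λ)) <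
        ∑ i, colSq i z * √(colSq i z)} ≤ c / (8 * r) := fun c hc => by
    have hK : (0 : ℝ) < 1.828 * d + 2.121 * r - 1 := by linarith
    refine (measureReal_mono fun z hz => ?_).trans ((sum_colSq_mul_sqrt_chebyshev hd hℓ hK
      (y := (2 * d + Λ) * √(2 * d + Λ)) ?_).trans (div_le_div_mul_of_le hd' hℓ' hr0 hK hN hc))
    · exact (Set.mem_ofPred_eq ▸ hz : _ < _).le
    · refine le_of_eq_of_le ?_ hM
      ring
  rcases le_total r (Real.log 4) with h4 | h4
  · have h2 := hcheb 3 (by nlinarith)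
    have h3 := budget_small hr2 h4
    have h5 := ht.trans (min_le_left _ _)
    linarith
  rcases le_total r (Real.log 10) with h10 | h10
  · have h2 := hcheb 1.8 (by nlinarith)
    have h3 := budget_medium h4 h10
    have h5 := ht.trans (min_le_right _ _)
    linarith
  · have h2 := sum_colSq_mul_sqrt_chernoff (ℓ := ℓ) hd (M := 2 * d + Λ) (by positivity)
    have h3 := budget_large h10
    have h5 := ht.trans (min_le_right _ _)
    have h6 : ℓ * Real.exp (-(3 / 8 * ((2 * d + Λ) ^ 3 / (4 * d ^ 2))) + d * Real.log 2) ≤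
        2 * Real.exp (-r) * Real.exp (-(0.48 * r)) := by
      -- The logarithm in `M` pays for the union bound over the `ℓ` columns: `ℓ e^(-1.48Λ) = δ
      -- e^(-0.48Λ)`.
      have h7 : (ℓ : ℝ) = δ * Real.exp Λ := by
        rw [hΛ, Real.exp_log (by positivity)]; field_simp
      rw [hrδ, h7, mul_assoc, ← Real.exp_add]
      have h8 := mul_log_two_add_le hd' hΛ0
      gcongr
      linarith
    linarith

theorem IsGaussianSketch.hasLaw {Ω : Type*} [MeasurableSpace Ω] {P : Measure Ω}
    [IsProbabilityMeasure P] {S : Ω → Matrix (Fin d) (Fin ℓ) ℝ} (h : IsGaussianSketch P S)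
    (hℓ : 0 < ℓ) :
    HasLaw (fun ω (p : Fin d × Fin ℓ) => S ω p.1 p.2 * √(ℓ : ℝ)) (gaussianMeasure (Fin d × Fin ℓ))
      P := by
  have hℓ' : (0 : ℝ) < ℓ := by exact_mod_cast hℓ
  have hind := h.indep.comp (fun _ x => x * √(ℓ : ℝ)) fun _ => by fun_prop
  refine hind.hasLaw_pi fun p => ?_
  have h1 : HasLaw (fun x : ℝ => x * √(ℓ : ℝ)) (gaussianReal 0 1)
      (gaussianReal 0 (1 / (ℓ : NNReal))) := by
    refine ⟨by fun_prop, ?_⟩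
    rw [gaussianReal_map_mul_const]
    congr 1
    · simp
    · ext
      simp [Real.sq_sqrt hℓ'.le, hℓ'.ne']
  exact h1.comp (h.law p.1 p.2)

theorem sum_colSq_eq_sumCubeNorms (hℓ : 0 < ℓ) (S : Matrix (Fin d) (Fin ℓ) ℝ) :
    ∑ i, colSq i (fun p : Fin d × Fin ℓ => S p.1 p.2 * √(ℓ : ℝ)) *
      √(colSq i (fun p : Fin d × Fin ℓ => S p.1 p.2 * √(ℓ : ℝ))) = ℓ * √ℓ * sumCubeNorms S := by
  have hℓ' : (0 : ℝ) < ℓ := by exact_mod_cast hℓ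
  rw [sumCubeNorms, Finset.mul_sum]
  refine Finset.sum_congr rfl fun i _ => ?_
  have h1 : colSq i (fun p : Fin d × Fin ℓ => S p.1 p.2 * √(ℓ : ℝ)) =
      ℓ * ‖sketchCol S i‖ ^ 2 := by
    rw [EuclideanSpace.real_norm_sq_eq, Finset.mul_sum]
    refine Finset.sum_congr rfl fun j _ => ?_
    rw [mul_pow, Real.sq_sqrt hℓ'.le, mul_comm]
    rfl
  rw [h1, Real.sqrt_mul hℓ'.le, Real.sqrt_sq (norm_nonneg _)]
  ring

theorem sumCubeNorms_le_of_sum_colSq_le (hℓ : 0 < ℓ) {S : Matrix (Fin d) (Fin ℓ) ℝ} {M : ℝ}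
    (hM : 0 < M) (h : ∑ i, colSq i (fun p : Fin d × Fin ℓ => S p.1 p.2 * √(ℓ : ℝ)) *
      √(colSq i (fun p : Fin d × Fin ℓ => S p.1 p.2 * √(ℓ : ℝ))) ≤ ℓ * (M * √M)) :
    sumCubeNorms S ≤ M ^ (3 / 2 : ℝ) * (ℓ : ℝ) ^ (-(1 / 2) : ℝ) := by
  have hℓ' : (0 : ℝ) < ℓ := by exact_mod_cast hℓ
  rw [sum_colSq_eq_sumCubeNorms hℓ, mul_assoc] at h
  have h2 := le_of_mul_le_mul_left h hℓ'
  rw [Real.rpow_neg hℓ'.le, ← Real.sqrt_eq_rpow, ← div_eq_mul_inv,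
    le_div_iff₀ (Real.sqrt_pos.2 hℓ'), show (3 / 2 : ℝ) = 1 + 1 / 2 by norm_num,
    Real.rpow_add hM, Real.rpow_one, ← Real.sqrt_eq_rpow]
  linarith

theorem gaussian_sketch_bounds {Ω : Type*} [MeasurableSpace Ω] {P : Measure Ω}
    [IsProbabilityMeasure P] {S : Ω → Matrix (Fin d) (Fin ℓ) ℝ}
    {φ f : EuclideanSpace ℝ (Fin d) → ℝ} {x : EuclideanSpace ℝ (Fin d)}
    {α σ Lhat ε δ : ℝ} (hα : 0 < α) (hε₀ : 0 < ε) (hε₁ : ε < 1) (hδ₀ : 0 < δ) (hδ₁ : δ < 1)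
    (hconv : ConvexOn ℝ Set.univ φ) (hdiff : Differentiable ℝ φ)
    (hdiff₂ : Differentiable ℝ (∇ φ)) (hnoise : ∀ y, |f y - φ y| ≤ σ)
    (hLip : ∀ y z, ‖hessian φ y - hessian φ z‖ ≤ Lhat * ‖y - z‖)
    (hS : IsGaussianSketch P S) (hT : 0 < hessianTrace φ x)
    (hℓ : 8 * ε⁻¹ ^ 2 * (‖hessian φ x‖ / hessianTrace φ x) * Real.log (2 / δ) ≤ (ℓ : ℝ)) :
    P {ω | ¬ (|traceEstimator f α x (S ω) - hessianTrace φ x| ≤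
          ε * hessianTrace φ x + Lhat * sumCubeNorms (S ω) / 3 * α + 4 * ℓ * σ / α ^ 2 ∧
        sumCubeNorms (S ω) ≤
          (2 * (d : ℝ) + Real.log (ℓ / δ)) ^ (3 / 2 : ℝ) * (ℓ : ℝ) ^ (-(1 / 2) : ℝ))}
      ≤ ENNReal.ofReal δ := by
  have hlog : 0 < Real.log (2 / δ) := Real.log_pos (by rw [lt_div_iff₀ hδ₀]; linarith)
  have ha : 0 < ‖hessian φ x‖ := by
    refine norm_pos_iff.2 fun h0 => hT.ne' ?_
    simp [hessianTrace, h0]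
  have hℓ' : (0 : ℝ) < ℓ := lt_of_lt_of_le (by positivity) hℓ
  have hℓn : 0 < ℓ := by exact_mod_cast hℓ'
  have hℓ1 : (1 : ℝ) ≤ ℓ := by exact_mod_cast hℓn
  have hdn : 0 < d := by
    rcases Nat.eq_zero_or_pos d with rfl | h
    · exact absurd (Subsingleton.elim (hessian φ x) 0) (norm_pos_iff.1 ha)
    · exact h
  have hd' : (0 : ℝ) < d := by exact_mod_cast hdn
  have hlaw := hS.hasLaw hℓn
  have hA := (hessianMatrix_spectralBound hconv hdiff hdiff₂ hLip x).kronecker_one (Fin ℓ)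
  set B := hessianMatrix φ x ⊗ₖ (1 : Matrix (Fin ℓ) (Fin ℓ) ℝ)
  have htr : B.trace = hessianTrace φ x * ℓ := by
    rw [Matrix.trace_kronecker, trace_hessianMatrix, Matrix.trace_one, Fintype.card_fin]
  have htr0 : 0 < B.trace := htr ▸ mul_pos hT hℓ'
  have hE : 8 * Real.log (2 / δ) ≤ B.trace / ‖hessian φ x‖ * ε ^ 2 := by
    rw [htr]
    have h1 : 8 * Real.log (2 / δ) = hessianTrace φ x * (8 * ε⁻¹ ^ 2 *
        (‖hessian φ x‖ / hessianTrace φ x) * Real.log (2 / δ)) / ‖hessian φ x‖ * ε ^ 2 := by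
      field_simp
    rw [h1]; gcongr
  -- The trace is at most dimension times norm, so the sample-size hypothesis also bounds the total
  -- number of Gaussian entries from below.
  have hN : 8 * Real.log (2 / δ) ≤ d * ℓ := by
    have h1 := hA.trace_le ha
    rw [Fintype.card_prod, Fintype.card_fin, Fintype.card_fin, Nat.cast_mul] at h1
    have h2 : B.trace / ‖hessian φ x‖ ≤ d * ℓ := (div_le_iff₀ ha).2 h1
    have h3 : ε ^ 2 ≤ 1 := pow_le_one₀ hε₀.le hε₁.le
    refine hE.trans ((mul_le_mul h2 h3 (by positivity) (by positivity)).trans ?_)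
    rw [mul_one]
  have htail := gaussian_centeredForm_tail hA ha htr0 hε₀ hε₁.le
  set γ := gaussianMeasure (Fin d × Fin ℓ)
  set M := 2 * (d : ℝ) + Real.log (ℓ / δ)
  have hM : 0 < M := by
    have : 0 ≤ Real.log (ℓ / δ) := Real.log_nonneg (by rw [le_div_iff₀ hδ₀]; linarith)
    positivity
  set U : Set (Fin d × Fin ℓ → ℝ) := {z | ε * B.trace ≤ |centeredForm B z|}
  set V : Set (Fin d × Fin ℓ → ℝ) := {z | ℓ * (M * √M) < ∑ i, colSq i z * √(colSq i z)}
  have hUm : MeasurableSet U :=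
    measurableSet_le measurable_const (continuous_centeredForm _).abs.measurable
  have hVm : MeasurableSet V := by
    refine measurableSet_lt measurable_const (Continuous.measurable ?_)
    exact continuous_finsetSum _ fun i _ => (continuous_colSq i).mul (continuous_colSq i).sqrt
  have hsum : γ.real U + γ.real V ≤ δ := by
    refine add_colSq_tail_le hdn hℓn hδ₀ hδ₁ hN (htail.trans (min_le_min ?_ ?_))
    · rw [div_le_div_iff₀ (by positivity) (by positivity)]
      linarith
    · exact add_le_add (Real.exp_le_exp.2 (by linarith)) (Real.exp_le_exp.2 (by linarith))
  refine (measure_mono fun ω hω => ?_).trans ((hlaw.measure_eq (hUm.union hVm)).le.trans ?_)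
  · by_contra hn
    refine hω ⟨?_, sumCubeNorms_le_of_sum_colSq_le hℓn hM (not_lt.1 fun h => hn (Or.inr h))⟩
    by_contra h
    exact hn (Or.inl (le_abs_centeredForm_of_not_le hdiff hdiff₂ hnoise hLip hα hℓn h).le)
  · rw [← ofReal_measureReal]
    exact ENNReal.ofReal_le_ofReal ((measureReal_union_le _ _).trans hsum)

end GaussianSketch

/-! ### The three sketches together -/

theorem theorem4 {d ℓ : ℕ} {Ω : Type*} [MeasurableSpace Ω] (P : Measure Ω)
    [IsProbabilityMeasure P] (S : Ω → Matrix (Fin d) (Fin ℓ) ℝ)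
    (φ f : EuclideanSpace ℝ (Fin d) → ℝ) (x : EuclideanSpace ℝ (Fin d))
    (α σ Lhat ε δ : ℝ) (hα : 0 < α) (hε₀ : 0 < ε) (hε₁ : ε < 1) (hδ₀ : 0 < δ) (hδ₁ : δ < 1)
    (hconv : ConvexOn ℝ Set.univ φ) (hdiff : Differentiable ℝ φ)
    (hdiff₂ : Differentiable ℝ (∇ φ))
    (hnoise : ∀ y, |f y - φ y| ≤ σ)
    (hLip : ∀ y z, ‖hessian φ y - hessian φ z‖ ≤ Lhat * ‖y - z‖) :
    -- Gaussian sketch: failure probability at most `δ`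
    (IsGaussianSketch P S → 0 < hessianTrace φ x →
      8 * ε⁻¹ ^ 2 * (‖hessian φ x‖ / hessianTrace φ x) * Real.log (2 / δ) ≤ (ℓ : ℝ) →
      P {ω | ¬ (|traceEstimator f α x (S ω) - hessianTrace φ x| ≤
            ε * hessianTrace φ x + Lhat * sumCubeNorms (S ω) / 3 * α + 4 * ℓ * σ / α ^ 2 ∧
          sumCubeNorms (S ω) ≤
            (2 * (d : ℝ) + Real.log (ℓ / δ)) ^ (3 / 2 : ℝ) * (ℓ : ℝ) ^ (-(1 / 2) : ℝ))}
        ≤ ENNReal.ofReal δ) ∧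
    -- Rademacher sketch
    (IsRademacherSketch P S → 0 < hessianTrace φ x →
      8 * ε⁻¹ ^ 2 * (1 + ε) * (‖hessian φ x‖ / hessianTrace φ x) * Real.log (2 / δ) ≤ (ℓ : ℝ) →
      P {ω | ¬ |traceEstimator f α x (S ω) - hessianTrace φ x| ≤
            ε * hessianTrace φ x + Lhat * sumCubeNorms (S ω) / 3 * α + 4 * ℓ * σ / α ^ 2}
        ≤ ENNReal.ofReal δ ∧
      ∀ᵐ ω ∂P, sumCubeNorms (S ω) ≤ (d : ℝ) ^ (3 / 2 : ℝ) * (ℓ : ℝ) ^ (-(1 / 2) : ℝ)) ∧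
    -- SRHT sketch
    (IsSRHTSketch P S →
      (1 + √(8 * Real.log (2 * d / δ))) ^ 2 * ε⁻¹ ^ 2 * Real.log (2 / δ) ≤ (ℓ : ℝ) →
      P {ω | ¬ |traceEstimator f α x (S ω) - hessianTrace φ x| ≤
            ε * hessianTrace φ x + Lhat * sumCubeNorms (S ω) / 3 * α + 4 * ℓ * σ / α ^ 2}
        ≤ ENNReal.ofReal δ ∧
      ∀ᵐ ω ∂P, sumCubeNorms (S ω) ≤ (d : ℝ) ^ (3 / 2 : ℝ) * (ℓ : ℝ) ^ (-(1 / 2) : ℝ)) := by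
  refine ⟨fun hS hT hℓ => ?_, fun hS hT hℓ => ?_, fun hS hℓ => ?_⟩
  · exact gaussian_sketch_bounds hα hε₀ hε₁ hδ₀ hδ₁ hconv hdiff hdiff₂ hnoise hLip hS hT hℓ
  · exact rademacher_sketch_bounds hα hε₀ hδ₀ hδ₁ hconv hdiff hdiff₂ hnoise hLip hS hT hℓ
  · exact srht_sketch_bounds hα hε₀ hε₁ hδ₀ hδ₁ hconv hdiff hdiff₂ hnoise hLip hS hℓ
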